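/- **Theorem 2.** Virtual diagrams are generic oriented knot or link diagrams in the plane whose double points are either classical crossings (with over/under information) or virtual crossings. Two virtual diagrams are called equivalent if they are related by planar isotopy and the generalised Reidemeister moves: the classical moves I, II, III, the same moves with virtual crossings only, and the triangle move with two virtual crossings and one classical crossing. Walking once along each component of a virtual diagram $K$ and noting, at each passage through a classical crossing, its label, whether it is passed over (O) or under (U), and its sign ($+$ if the direction of the overcrossing strand turns counterclockwise, through the smaller angle, to that of the undercrossing strand, $-$ otherwise) gives a signed Gauss code of $K$, one sequence for each component; virtual crossings are ignored. The underlying Gauss code retains only the labels. A Gauss code is planar if it is the Gauss code of a planar shadow, i.e. of a generic family of oriented closed curves in the plane, walked along in the same way. The signs of a signed Gauss code are standard if some planar shadow with the underlying Gauss code has local orientations at its crossings that, together with the given O/U specifications, induce exactly these signs. Let $K$ be a virtual knot (or link) diagram with a signed Gauss code whose underlying Gauss code is planar and whose signs are standard. Then $K$ is equivalent, through planar isotopy and generalised Reidemeister moves, to a classical diagram, i.e. a diagram without virtual crossings. -/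

import Mathlib

namespace VirtualKnot

/-!
Plane diagrams of oriented links are put in general position with respect to a vertical direction
and recorded from bottom to top as a sequence of slices, each of which contains exactly one
minimum, maximum or crossing, next to vertical strands. A point where a horizontal line between
two slices meets the diagram carries a direction: `true` is upwards, `false` is downwards.
The parameter `T` is the kind of decoration carried by the double points.
-/

/-- The elementary pieces of a plane diagram.
* `cup a` is a minimum whose left branch has direction `a`;
* `cap a` is a maximum whose left branch has direction `a`;
* `cross t a b` is a transverse double point with decoration `t`, formed by a strand of direction
  `a` that joins bottom left to top right (the *rising* strand) and a strand of direction `b` that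
  joins bottom right to top left (the *falling* strand). -/
inductive Gen (T : Type) : Type
  | cup (a : Bool)
  | cap (a : Bool)
  | cross (t : T) (a b : Bool)

/-- The directions of the strands at the bottom of an elementary piece, from left to right. -/
def Gen.dom {T : Type} : Gen T → List Bool
  | .cup _ => []
  | .cap a => [a, !a]
  | .cross _ a b => [a, b]

/-- The directions of the strands at the top of an elementary piece, from left to right. -/
def Gen.cod {T : Type} : Gen T → List Bool
  | .cup a => [a, !a]
  | .cap _ => []
  | .cross _ a b => [b, a]

/-- A horizontal slice: an elementary piece with vertical strands to its left and to its right. -/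
structure Slice (T : Type) : Type where
  left : List Bool
  gen : Gen T
  right : List Bool

/-- The directions of the strands at the bottom of a slice. -/
def Slice.dom {T : Type} (s : Slice T) : List Bool := s.left ++ s.gen.dom ++ s.right

/-- The directions of the strands at the top of a slice. -/
def Slice.cod {T : Type} (s : Slice T) : List Bool := s.left ++ s.gen.cod ++ s.right

/-- Add vertical strands on the far left and on the far right of a slice. -/
def Slice.pad {T : Type} (L R : List Bool) (s : Slice T) : Slice T :=
  ⟨L ++ s.left, s.gen, s.right ++ R⟩

/-- The slices of `w`, stacked from bottom to top, fit together to a tangle diagram with bottom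
boundary `A` and top boundary `B`. -/
def IsTangle {T : Type} (A : List Bool) : List (Slice T) → List Bool → Prop
  | [], B => A = B
  | s :: w, B => A = s.dom ∧ IsTangle s.cod w B

/-- An oriented link diagram in the plane (a closed tangle diagram) with double points decorated
by `T`. -/
structure PlaneDiagram (T : Type) : Type where
  word : List (Slice T)
  closed : IsTangle [] word []

/-! ### Walking along a diagram -/

/-- Follow a strand through an elementary piece. It is entered from the bottom (`side = false`) or
from the top (`side = true`) through its `k`-th end on that side, `k = 0, 1`; the result is the
side and the number of the end through which it is left. -/
def Gen.through {T : Type} (side : Bool) (k : ℕ) : Gen T → Bool × ℕ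
  | .cross _ _ _ => (!side, 1 - k)
  | .cup _ => (side, 1 - k)
  | .cap _ => (side, 1 - k)

/-- The number of ends of an elementary piece at its bottom (`false`) or top (`true`). -/
def Gen.ends {T : Type} (g : Gen T) (side : Bool) : ℕ :=
  if side then g.cod.length else g.dom.length

/-- Follow a strand through a slice that is entered at position `j` of the given side. -/
def Slice.through {T : Type} (s : Slice T) (side : Bool) (j : ℕ) : Bool × ℕ :=
  if j < s.left.length then (!side, j)
  else if j < s.left.length + s.gen.ends side then
    ((s.gen.through side (j - s.left.length)).1,
      s.left.length + (s.gen.through side (j - s.left.length)).2)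
  else (!side, j - s.gen.ends side + s.gen.ends (!side))

/-- If entering the slice `s` at position `j` of the given side means entering a double point, its
decoration, the directions of its rising and its falling strand, and whether the strand entered is
the rising one. -/
def Slice.crossed {T : Type} (s : Slice T) (side : Bool) (j : ℕ) :
    Option (T × Bool × Bool × Bool) :=
  match s.gen with
  | .cross t a b =>
      if s.left.length ≤ j ∧ j < s.left.length + 2 then
        some (t, a, b, decide (j - s.left.length = side.toNat))
      else none
  | _ => none

namespace PlaneDiagram

variable {T : Type}

/-- The directions of the strands on the horizontal line below slice number `i` (equivalently,
above slice number `i - 1`). -/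
def level (D : PlaneDiagram T) : ℕ → List Bool
  | 0 => []
  | i + 1 => (D.word[i]?.map Slice.cod).getD []

/-- `(i, j)` is the `j`-th point on the line below slice number `i`. -/
def IsPoint (D : PlaneDiagram T) (p : ℕ × ℕ) : Prop := p.2 < (D.level p.1).length

/-- The direction of the diagram at a point. -/
def dir (D : PlaneDiagram T) (p : ℕ × ℕ) : Bool := (D.level p.1).getD p.2 true

/-- The number of the slice that is entered when the diagram is followed from a point in its
direction. -/
def sliceAfter (D : PlaneDiagram T) (p : ℕ × ℕ) : ℕ := if D.dir p then p.1 else p.1 - 1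

/-- The next point in the direction of the diagram. -/
def next (D : PlaneDiagram T) (p : ℕ × ℕ) : ℕ × ℕ :=
  match D.word[D.sliceAfter p]? with
  | none => p
  | some s =>
      (D.sliceAfter p + (s.through (!(D.dir p)) p.2).1.toNat, (s.through (!(D.dir p)) p.2).2)

/-- The double point (if any) that lies between a point and the next one: the number of its slice,
its decoration, the directions of its rising and its falling strand, and whether it is
traversed on the rising strand. -/
def passage (D : PlaneDiagram T) (p : ℕ × ℕ) : Option (ℕ × T × Bool × Bool × Bool) :=
  (D.word[D.sliceAfter p]?).bind fun s =>
    (s.crossed (!(D.dir p)) p.2).map fun x => (D.sliceAfter p, x)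

/-- `l` lists the points of one component, in the order of a walk along the component from a
starting point back to it. -/
def IsTour (D : PlaneDiagram T) (l : List (ℕ × ℕ)) : Prop :=
  l ≠ [] ∧ l.Nodup ∧ l.map D.next = l.rotate 1

/-- `ls` consists of one walk along each component of the diagram. -/
def IsTraversal (D : PlaneDiagram T) (ls : List (List (ℕ × ℕ))) : Prop :=
  (∀ l ∈ ls, D.IsTour l) ∧ ls.flatten.Nodup ∧ ∀ p, p ∈ ls.flatten ↔ D.IsPoint p

end PlaneDiagram

/-! ### Gauss codes -/

/-- A Gauss code: one sequence of crossing labels for each component. -/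
abbrev GaussCode : Type := List (List ℕ)

/-- A letter such as `O3-` of a signed Gauss code: a crossing label, whether the crossing is passed
as an overcrossing, and whether the sign of the crossing is positive. -/
structure SignedLetter : Type where
  label : ℕ
  isOver : Bool
  positive : Bool

/-- An oriented (signed) Gauss code. -/
abbrev SignedGaussCode : Type := List (List SignedLetter)

/-- The underlying Gauss code, without signs and without over/under specifications. -/
def SignedGaussCode.underlying (g : SignedGaussCode) : GaussCode :=
  g.map fun c => c.map SignedLetter.label

/-- A passage through a crossing of a shadow, with the local orientation of the crossing: `counter`
says that the direction of this passage is turned counterclockwise, through an angle less than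
`π`, to the direction of the other passage through the same crossing. -/
structure LocalLetter : Type where
  label : ℕ
  counter : Bool

/-- A Gauss code with a local orientation at every passage. -/
abbrev LocalGaussCode : Type := List (List LocalLetter)

/-- A planar shadow, with a direction on each of its components: a plane diagram whose double
points carry no further structure. -/
abbrev Shadow : Type := PlaneDiagram Unit

/-- Turning counterclockwise, through an angle less than `π`, leads from the direction of a passage
to the direction of the other passage through the same double point; here `a` and `b` are the
directions of the rising and of the falling strand, and `rising` tells which one is passed. -/
def turnsCounter (a b rising : Bool) : Bool := rising == (a == b)

/-- `h` is a Gauss code, with local orientations, of the shadow `S`, for some choice of starting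
points, of the order of the components and of the labels. -/
def Shadow.HasLocalCode (S : Shadow) (h : LocalGaussCode) : Prop :=
  ∃ ls : List (List (ℕ × ℕ)), S.IsTraversal ls ∧
    ∃ name : ℕ → ℕ, Function.Injective name ∧
      h = ls.map fun l => l.filterMap fun p =>
        (S.passage p).map fun x =>
          ⟨name x.1, turnsCounter x.2.2.1 x.2.2.2.1 x.2.2.2.2⟩

/-- `c` is a Gauss code of the shadow `S`. -/
def Shadow.HasCode (S : Shadow) (c : GaussCode) : Prop :=
  ∃ h : LocalGaussCode, S.HasLocalCode h ∧ c = h.map fun l => l.map LocalLetter.label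

/-- A Gauss code is planar if it is the Gauss code of a planar shadow. -/
def GaussCode.IsPlanar (c : GaussCode) : Prop := ∃ S : Shadow, S.HasCode c

/-- The sign of a crossing in a signed letter is the one forced by a local orientation of this
crossing: a crossing is positive if its overcrossing direction turns counterclockwise to its
undercrossing direction. -/
def SignedLetter.Fits (x : SignedLetter) (y : LocalLetter) : Prop :=
  x.label = y.label ∧ x.positive = (if x.isOver then y.counter else !y.counter)

/-- The signs of `g` are standard: they are determined, through the over/under specifications of
`g`, by the local orientations in a reconstruction of a planar shadow from its Gauss code. -/
def SignedGaussCode.IsStandard (g : SignedGaussCode) : Prop :=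
  ∃ S : Shadow, ∃ h : LocalGaussCode, S.HasLocalCode h ∧
    List.Forall₂ (List.Forall₂ SignedLetter.Fits) g h

/-! ### Virtual diagrams -/

/-- The double points of a virtual diagram: a classical crossing, for which `r` tells whether the
rising strand is the overcrossing one, or a virtual crossing. -/
inductive Crossing : Type
  | classical (r : Bool)
  | virtual
  deriving DecidableEq

/-- The name of the same crossing when the roles of the rising and the falling strand are
exchanged. -/
def Crossing.flip : Crossing → Crossing
  | .classical r => .classical (!r)
  | .virtual => .virtual

/-- An (oriented) virtual knot or link diagram. -/
abbrev VirtualDiagram : Type := PlaneDiagram Crossing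

/-- A classical diagram is one without virtual crossings. -/
def VirtualDiagram.IsClassical (K : VirtualDiagram) : Prop :=
  ∀ s ∈ K.word, ∀ a b : Bool, s.gen ≠ Gen.cross Crossing.virtual a b

/-- The letter contributed by a passage through a double point; none if it is virtual. -/
def signedLetter (name : ℕ → ℕ) : ℕ × Crossing × Bool × Bool × Bool → Option SignedLetter
  | (_, .virtual, _, _, _) => none
  | (i, .classical r, a, b, rising) =>
      some ⟨name i, rising == r, turnsCounter a b r⟩

/-- `g` is a signed Gauss code of the virtual diagram `K`, for some choice of starting points, of
the order of the components and of the labels. -/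
def VirtualDiagram.HasSignedCode (K : VirtualDiagram) (g : SignedGaussCode) : Prop :=
  ∃ ls : List (List (ℕ × ℕ)), K.IsTraversal ls ∧
    ∃ name : ℕ → ℕ, Function.Injective name ∧
      g = ls.map fun l => l.filterMap fun p => (K.passage p).bind (signedLetter name)

/-- The triangle moves that are allowed for three strands 1, 2, 3 (in the order of their lower
ends, each joining its lower end to the opposite position at the top), where `x`, `y`, `z` are
the crossings of 1 with 2, of 1 with 3 and of 2 with 3: either all crossings are classical and one
strand lies above the two others and one below, or at least two of the crossings are virtual. -/
def TriangleAllowed : Crossing → Crossing → Crossing → Prop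
  | .classical p, .classical q, .classical r => q = p ∨ q = r
  | .virtual, .virtual, _ => True
  | .virtual, _, .virtual => True
  | _, .virtual, .virtual => True
  | _, _, _ => False

/-- The local moves: planar isotopy (the first five) and the generalised Reidemeister moves
I, II and III, purely classical, purely virtual, and the triangle move for two virtual
crossings and one classical crossing. -/
inductive LocalMove : List (Slice Crossing) → List (Slice Crossing) → Prop
  /-- Two pieces that lie side by side exchange their heights. -/
  | exchange (g h : Gen Crossing) (M : List Bool) :
      LocalMove [⟨[], g, M ++ h.dom⟩, ⟨g.cod ++ M, h, []⟩]
        [⟨g.dom ++ M, h, []⟩, ⟨[], g, M ++ h.cod⟩]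
  /-- A maximum and a minimum on the same strand cancel. -/
  | zigzagRight (a : Bool) :
      LocalMove [⟨[a], .cup (!a), []⟩, ⟨[], .cap a, [a]⟩] []
  | zigzagLeft (a : Bool) :
      LocalMove [⟨[], .cup a, [a]⟩, ⟨[a], .cap (!a), []⟩] []
  /-- A crossing slides over a maximum or a minimum of one of its strands. -/
  | slideCap (t : Crossing) (a b : Bool) :
      LocalMove [⟨[], .cross t a b, [!a]⟩, ⟨[b], .cap a, []⟩]
        [⟨[a], .cross t.flip b (!a), []⟩, ⟨[], .cap a, [b]⟩]
  | slideCup (t : Crossing) (a b : Bool) :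
      LocalMove [⟨[b], .cup a, []⟩, ⟨[], .cross t b a, [!a]⟩]
        [⟨[], .cup a, [b]⟩, ⟨[a], .cross t.flip (!a) b, []⟩]
  /-- Moves of type I, classical or virtual. -/
  | curlCap (t : Crossing) (a : Bool) :
      LocalMove [⟨[], .cross t a (!a), []⟩, ⟨[], .cap (!a), []⟩] [⟨[], .cap a, []⟩]
  | curlCup (t : Crossing) (a : Bool) :
      LocalMove [⟨[], .cup a, []⟩, ⟨[], .cross t a (!a), []⟩] [⟨[], .cup (!a), []⟩]
  /-- Moves of type II, classical or virtual. -/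
  | bigon (t : Crossing) (a b : Bool) :
      LocalMove [⟨[], .cross t a b, []⟩, ⟨[], .cross t.flip b a, []⟩] []
  /-- Moves of type III, classical, virtual or mixed. -/
  | triangle (x y z : Crossing) (a b c : Bool) (h : TriangleAllowed x y z) :
      LocalMove
        [⟨[], .cross x a b, [c]⟩, ⟨[b], .cross y a c, []⟩, ⟨[], .cross z b c, [a]⟩]
        [⟨[a], .cross z b c, []⟩, ⟨[], .cross y a c, [b]⟩, ⟨[c], .cross x a b, []⟩]

/-- `K₂` is obtained from `K₁` by one local move inside the diagram. -/
def VirtualDiagram.Step (K₁ K₂ : VirtualDiagram) : Prop :=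
  ∃ (u v m₁ m₂ : List (Slice Crossing)) (L R : List Bool), LocalMove m₁ m₂ ∧
    K₁.word = u ++ m₁.map (Slice.pad L R) ++ v ∧
    K₂.word = u ++ m₂.map (Slice.pad L R) ++ v

/-- Virtual equivalence: the equivalence relation generated by planar isotopy and the generalised
Reidemeister moves. -/
def VirtualDiagram.Equivalent : VirtualDiagram → VirtualDiagram → Prop :=
  Relation.EqvGen VirtualDiagram.Step

end VirtualKnot

/-!
A signed Gauss code determines a virtual diagram up to equivalence
(`VirtualDiagram.HasSignedCode.equivalent`), and a code with standard signs is the code of a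
classical diagram (`SignedGaussCode.IsStandard.exists_classical`): in a shadow that induces the
signs, let the strand that the code calls the overcrossing one be the overcrossing one at every
double point. The classical diagram and the given virtual diagram have the same code, so they are
equivalent.

That the code determines the diagram is the usual observation that an arc between two classical
crossings may be rerouted in any way by the detour move. For slice diagrams this is organised as
follows. Colour every strand of the diagram by the arc of the Gauss code on which it lies
(`exists_coloured`, `IsArcDiagram`). Bend the ends of all classical crossings upwards and move the
crossings to the bottom, in an arbitrary order, dragging their ends through the rest of the diagram
by detour moves (`pull_boxes`, `front_perm`). What remains above is a tangle without classical
crossings. Its lower ends have pairwise distinct directed colours, because every arc leaves exactly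
one crossing and enters exactly one, so the colours tell which ends are joined. Pulling down one
strand after the other (`pull_strand`) shows that such a tangle depends only on the ends that are
joined, up to closed circles (`pure_unique`).
Hence two diagrams with the same code have normal forms that differ only in the number of circles
(`eqv_of_boxes`).

The circles correspond to the components without classical crossings. To see this without tracing
components through the moves, note that moves preserve the set of colours that occur
(`Eqv.hasColour_iff`), and that any finer colouring of a diagram can be carried along the moves
(`Eqv.lift`). Marking a single circle of the normal form and carrying the mark back to the
diagram produces a marking that is constant along each component and absent at all crossings, hence
marks one full component without crossings; therefore the circles have distinct colours, and they
are exactly those of the components without crossings (`circles_colours`).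
-/

namespace VirtualKnot

/-! ### Coloured tangles -/

/-- A strand of a coloured tangle: its direction and its colour. -/
abbrev Strand (E : Type) : Type := Bool × E

/-- The same strand, traversed in the opposite direction. -/
def dual {E : Type} (x : Strand E) : Strand E := (!x.1, x.2)

/-- The elementary pieces of a coloured tangle. Colours are constant along strands, except that
both strands may change their colours at a classical crossing: in `box r x y e f` the rising strand
has colour `e` and the falling strand has colour `f` at the top, and `r` tells whether the rising
strand is the overcrossing one. -/
inductive CGen (E : Type) : Type
  | cup (x : Strand E)
  | cap (x : Strand E)
  | virt (x y : Strand E)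
  | box (r : Bool) (x y : Strand E) (e f : E)

/-- A horizontal slice of a coloured tangle. -/
structure CSlice (E : Type) : Type where
  left : List (Strand E)
  gen : CGen E
  right : List (Strand E)

/-- Coloured tangles are words of slices, read from bottom to top. -/
abbrev CWord (E : Type) : Type := List (CSlice E)

variable {E : Type}

@[simp] theorem dual_dual (x : Strand E) : dual (dual x) = x := by simp [dual]

/-- The strands at the bottom of a piece. -/
def CGen.dom : CGen E → List (Strand E)
  | .cup _ => []
  | .cap x => [x, dual x]
  | .virt x y => [x, y]
  | .box _ x y _ _ => [x, y]

/-- The strands at the top of a piece. -/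
def CGen.cod : CGen E → List (Strand E)
  | .cup x => [x, dual x]
  | .cap _ => []
  | .virt x y => [y, x]
  | .box _ x y e f => [(y.1, f), (x.1, e)]

@[simp] theorem CGen.dom_cup (x : Strand E) : (CGen.cup x).dom = [] := rfl
@[simp] theorem CGen.dom_cap (x : Strand E) : (CGen.cap x).dom = [x, dual x] := rfl
@[simp] theorem CGen.dom_virt (x y : Strand E) : (CGen.virt x y).dom = [x, y] := rfl
@[simp] theorem CGen.dom_box (r : Bool) (x y : Strand E) (e f : E) :
    (CGen.box r x y e f).dom = [x, y] := rfl
@[simp] theorem CGen.cod_cup (x : Strand E) : (CGen.cup x).cod = [x, dual x] := rfl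
@[simp] theorem CGen.cod_cap (x : Strand E) : (CGen.cap x).cod = [] := rfl
@[simp] theorem CGen.cod_virt (x y : Strand E) : (CGen.virt x y).cod = [y, x] := rfl
@[simp] theorem CGen.cod_box (r : Bool) (x y : Strand E) (e f : E) :
    (CGen.box r x y e f).cod = [(y.1, f), (x.1, e)] := rfl

/-- The strands at the bottom of a slice. -/
def CSlice.dom (s : CSlice E) : List (Strand E) := s.left ++ (s.gen.dom ++ s.right)

/-- The strands at the top of a slice. -/
def CSlice.cod (s : CSlice E) : List (Strand E) := s.left ++ (s.gen.cod ++ s.right)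

@[simp] theorem CSlice.dom_mk (l : List (Strand E)) (g : CGen E) (r : List (Strand E)) :
    CSlice.dom ⟨l, g, r⟩ = l ++ (g.dom ++ r) := rfl

@[simp] theorem CSlice.cod_mk (l : List (Strand E)) (g : CGen E) (r : List (Strand E)) :
    CSlice.cod ⟨l, g, r⟩ = l ++ (g.cod ++ r) := rfl

/-- Add vertical strands on both sides of a slice. -/
def CSlice.pad (L R : List (Strand E)) (s : CSlice E) : CSlice E :=
  ⟨L ++ s.left, s.gen, s.right ++ R⟩

@[simp] theorem CSlice.pad_mk (L R l : List (Strand E)) (g : CGen E) (r : List (Strand E)) :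
    CSlice.pad L R ⟨l, g, r⟩ = ⟨L ++ l, g, r ++ R⟩ := rfl

@[simp] theorem CSlice.pad_gen (L R : List (Strand E)) (s : CSlice E) :
    (s.pad L R).gen = s.gen := rfl

/-- Add vertical strands on both sides of a tangle. -/
def pad (L R : List (Strand E)) (w : CWord E) : CWord E := w.map (CSlice.pad L R)

@[simp] theorem pad_nil (L R : List (Strand E)) : pad L R [] = [] := rfl

@[simp] theorem pad_cons (L R : List (Strand E)) (s : CSlice E) (w : CWord E) :
    pad L R (s :: w) = s.pad L R :: pad L R w := rfl

@[simp] theorem pad_append (L R : List (Strand E)) (u v : CWord E) :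
    pad L R (u ++ v) = pad L R u ++ pad L R v := by simp [pad]

@[simp] theorem pad_pad (L R L' R' : List (Strand E)) (w : CWord E) :
    pad L R (pad L' R' w) = pad (L ++ L') (R' ++ R) w := by
  simp [pad, CSlice.pad]

@[simp] theorem pad_nil_nil (w : CWord E) : pad [] [] w = w := by
  induction w with
  | nil => rfl
  | cons s w ih => simp [ih, CSlice.pad]

/-- The slices of `w` fit together to a tangle from `A` to `B`. -/
def Tangle (A : List (Strand E)) : CWord E → List (Strand E) → Prop
  | [], B => A = B
  | s :: w, B => A = s.dom ∧ Tangle s.cod w B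

@[simp] theorem tangle_nil {A B : List (Strand E)} : Tangle A [] B ↔ A = B := Iff.rfl

@[simp] theorem tangle_cons {A B : List (Strand E)} {s : CSlice E} {w : CWord E} :
    Tangle A (s :: w) B ↔ A = s.dom ∧ Tangle s.cod w B := Iff.rfl

theorem tangle_append {A B : List (Strand E)} {u v : CWord E} :
    Tangle A (u ++ v) B ↔ ∃ C, Tangle A u C ∧ Tangle C v B := by
  induction u generalizing A with
  | nil => simp
  | cons s u ih => simp [ih, and_assoc]

theorem Tangle.append {A B C : List (Strand E)} {u v : CWord E} (hu : Tangle A u B)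
    (hv : Tangle B v C) : Tangle A (u ++ v) C :=
  tangle_append.2 ⟨B, hu, hv⟩

theorem Tangle.padded {A B : List (Strand E)} {w : CWord E} (L R : List (Strand E))
    (h : Tangle A w B) : Tangle (L ++ (A ++ R)) (pad L R w) (L ++ (B ++ R)) := by
  induction w generalizing A with
  | nil => simpa using h
  | cons s w ih =>
    obtain ⟨rfl, h⟩ := h
    rw [pad_cons, tangle_cons]
    refine ⟨by simp [CSlice.dom, CSlice.pad], ?_⟩
    have := ih h
    rw [CSlice.cod] at this
    simpa only [CSlice.cod, CSlice.pad, List.append_assoc] using this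

theorem Tangle.det {A B C : List (Strand E)} {w : CWord E} (h : Tangle A w B)
    (h' : Tangle A w C) : B = C := by
  induction w generalizing A with
  | nil => simp_all
  | cons s w ih => exact ih h.2 h'.2

/-- Planar isotopies and generalised Reidemeister moves of coloured tangles; only those are listed
that are needed to redraw the virtual part of a diagram. In particular, no move creates or removes
classical crossings. The move `rotate` slides a classical crossing over a maximum, where its rising
strand becomes the falling one. -/
inductive CMove : CWord E → CWord E → Prop
  | exchange (g h : CGen E) (M : List (Strand E)) :
      CMove [⟨[], g, M ++ h.dom⟩, ⟨g.cod ++ M, h, []⟩] [⟨g.dom ++ M, h, []⟩, ⟨[], g, M ++ h.cod⟩]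
  | zigzagRight (x : Strand E) : CMove [⟨[x], .cup (dual x), []⟩, ⟨[], .cap x, [x]⟩] []
  | zigzagLeft (x : Strand E) : CMove [⟨[], .cup x, [x]⟩, ⟨[x], .cap (dual x), []⟩] []
  | slideCap (x y : Strand E) :
      CMove [⟨[], .virt x y, [dual x]⟩, ⟨[y], .cap x, []⟩]
        [⟨[x], .virt y (dual x), []⟩, ⟨[], .cap x, [y]⟩]
  | slideCup (x y : Strand E) :
      CMove [⟨[y], .cup x, []⟩, ⟨[], .virt y x, [dual x]⟩]
        [⟨[], .cup x, [y]⟩, ⟨[x], .virt (dual x) y, []⟩]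
  | rotate (r : Bool) (x y : Strand E) (e f : E) :
      CMove [⟨[], .box r x y e f, [(!x.1, e)]⟩, ⟨[(y.1, f)], .cap (x.1, e), []⟩]
        [⟨[x], .box (!r) y (!x.1, e) f x.2, []⟩, ⟨[], .cap x, [(y.1, f)]⟩]
  | curlCap (x : Strand E) :
      CMove [⟨[], .virt x (dual x), []⟩, ⟨[], .cap (dual x), []⟩] [⟨[], .cap x, []⟩]
  | curlCup (x : Strand E) :
      CMove [⟨[], .cup x, []⟩, ⟨[], .virt x (dual x), []⟩] [⟨[], .cup (dual x), []⟩]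
  | bigon (x y : Strand E) : CMove [⟨[], .virt x y, []⟩, ⟨[], .virt y x, []⟩] []
  | triangle (x y z : Strand E) :
      CMove [⟨[], .virt x y, [z]⟩, ⟨[y], .virt x z, []⟩, ⟨[], .virt y z, [x]⟩]
        [⟨[x], .virt y z, []⟩, ⟨[], .virt x z, [y]⟩, ⟨[z], .virt x y, []⟩]
  | triangleBox (x : Strand E) (r : Bool) (y z : Strand E) (e f : E) :
      CMove [⟨[], .virt x y, [z]⟩, ⟨[y], .virt x z, []⟩, ⟨[], .box r y z e f, [x]⟩]
        [⟨[x], .box r y z e f, []⟩, ⟨[], .virt x (z.1, f), [(y.1, e)]⟩,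
          ⟨[(z.1, f)], .virt x (y.1, e), []⟩]

/-- One move inside a tangle from `A` to `B`. -/
def CStep (A B : List (Strand E)) (w w' : CWord E) : Prop :=
  Tangle A w B ∧ Tangle A w' B ∧ ∃ (u v m₁ m₂ : CWord E) (L R : List (Strand E)),
    CMove m₁ m₂ ∧ w = u ++ pad L R m₁ ++ v ∧ w' = u ++ pad L R m₂ ++ v

/-- `w` and `w'` are tangles from `A` to `B` that are related by moves. -/
def Eqv (A B : List (Strand E)) (w w' : CWord E) : Prop :=
  Tangle A w B ∧ Tangle A w' B ∧ Relation.EqvGen (CStep A B) w w'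

section Eqv

variable {A B C D : List (Strand E)} {u u' v v' w w' w'' : CWord E}

theorem Eqv.right (h : Eqv A B w w') : Tangle A w' B := h.2.1

theorem Eqv.refl (h : Tangle A w B) : Eqv A B w w := ⟨h, h, .refl _⟩

theorem Eqv.symm (h : Eqv A B w w') : Eqv A B w' w := ⟨h.2.1, h.1, h.2.2.symm⟩

theorem Eqv.trans (h : Eqv A B w w') (h' : Eqv A B w' w'') : Eqv A B w w'' :=
  ⟨h.1, h'.2.1, h.2.2.trans _ _ _ h'.2.2⟩

theorem Eqv.of_move (h : CMove w w') (hw : Tangle A w B) (hw' : Tangle A w' B) :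
    Eqv A B w w' :=
  ⟨hw, hw', .rel _ _ ⟨hw, hw', [], [], w, w', [], [], h, by simp, by simp⟩⟩

theorem CStep.context (hu : Tangle A u B) (h : CStep B C w w') (hv : Tangle C v D) :
    CStep A D (u ++ w ++ v) (u ++ w' ++ v) := by
  obtain ⟨h1, h2, p, q, m, m', L, R, hm, rfl, rfl⟩ := h
  exact ⟨(hu.append h1).append hv, (hu.append h2).append hv, u ++ p, q ++ v, m, m', L, R, hm,
    by simp, by simp⟩

theorem CStep.padded (L R : List (Strand E)) (h : CStep A B w w') :
    CStep (L ++ (A ++ R)) (L ++ (B ++ R)) (pad L R w) (pad L R w') := by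
  obtain ⟨h1, h2, p, q, m, m', L', R', hm, rfl, rfl⟩ := h
  exact ⟨h1.padded L R, h2.padded L R, pad L R p, pad L R q, m, m', L ++ L',
    R' ++ R, hm, by simp, by simp⟩

theorem eqvGen_map {α β : Type} {r : α → α → Prop} {s : β → β → Prop} (f : α → β)
    (hf : ∀ a b, r a b → s (f a) (f b)) {a b : α} (h : Relation.EqvGen r a b) :
    Relation.EqvGen s (f a) (f b) := by
  induction h with
  | rel _ _ h => exact .rel _ _ (hf _ _ h)
  | refl => exact .refl _
  | symm _ _ _ ih => exact ih.symm
  | trans _ _ _ _ _ ih ih' => exact ih.trans _ _ _ ih'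

theorem Eqv.context (hu : Tangle A u B) (h : Eqv B C w w') (hv : Tangle C v D) :
    Eqv A D (u ++ w ++ v) (u ++ w' ++ v) :=
  ⟨(hu.append h.1).append hv, (hu.append h.2.1).append hv,
    eqvGen_map (fun w => u ++ w ++ v) (fun _ _ h => h.context hu hv) h.2.2⟩

theorem Eqv.padded (L R : List (Strand E)) (h : Eqv A B w w') :
    Eqv (L ++ (A ++ R)) (L ++ (B ++ R)) (pad L R w) (pad L R w') :=
  ⟨h.1.padded L R, h.2.1.padded L R, eqvGen_map (pad L R) (fun _ _ h => h.padded L R) h.2.2⟩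

theorem Eqv.append (h : Eqv A B u u') (h' : Eqv B C v v') : Eqv A C (u ++ v) (u' ++ v') := by
  have h1 := Eqv.context (u := []) (rfl : Tangle A [] A) h h'.1
  have h2 := Eqv.context (v := []) h.2.1 h' (rfl : Tangle C [] C)
  simp only [List.nil_append, List.append_nil] at h1 h2
  exact h1.trans h2

theorem Eqv.append_left (hu : Tangle A u B) (h : Eqv B C v v') : Eqv A C (u ++ v) (u ++ v') :=
  (Eqv.refl hu).append h

theorem Eqv.append_right (h : Eqv A B u u') (hv : Tangle B v C) : Eqv A C (u ++ v) (u' ++ v) :=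
  h.append (Eqv.refl hv)

end Eqv

/-! ### Tangles side by side -/

theorem exchange_slices (s t : CSlice E) :
    Eqv (s.dom ++ t.dom) (s.cod ++ t.cod) [s.pad [] t.dom, t.pad s.cod []]
      [t.pad s.dom [], s.pad [] t.cod] := by
  obtain ⟨l, g, r⟩ := s
  obtain ⟨l', h, r'⟩ := t
  have := (Eqv.of_move (A := g.dom ++ (r ++ l' ++ h.dom)) (B := g.cod ++ (r ++ l' ++ h.cod))
    (CMove.exchange g h (r ++ l')) (by simp) (by simp)).padded l r'
  simpa using this

/-- A slice may be moved past a tangle on its right. -/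
theorem exchange_slice_word {C D : List (Strand E)} {v : CWord E} (s : CSlice E)
    (hv : Tangle C v D) :
    Eqv (s.dom ++ C) (s.cod ++ D) (s.pad [] C :: pad s.cod [] v)
      (pad s.dom [] v ++ [s.pad [] D]) := by
  induction v generalizing C with
  | nil =>
    obtain rfl := hv
    exact Eqv.refl (by simp [CSlice.dom, CSlice.cod, CSlice.pad])
  | cons t v ih =>
    obtain ⟨rfl, hv⟩ := hv
    have h1 := (exchange_slices s t).append_right (by simpa using hv.padded s.cod [])
    have h2 := (ih hv).append_left (u := [t.pad s.dom []]) (A := s.dom ++ t.dom)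
      (by simp [CSlice.dom, CSlice.cod, CSlice.pad])
    simpa using h1.trans (by simpa using h2)

/-- Tangles that lie side by side may be moved past each other vertically. -/
theorem exchange_words {A B C D : List (Strand E)} {u v : CWord E} (hu : Tangle A u B)
    (hv : Tangle C v D) :
    Eqv (A ++ C) (B ++ D) (pad [] C u ++ pad B [] v) (pad A [] v ++ pad [] D u) := by
  induction u generalizing A with
  | nil =>
    obtain rfl := hu
    simpa using Eqv.refl (hv.padded A [])
  | cons s u ih =>
    obtain ⟨rfl, hu⟩ := hu
    have h1 := (ih hu).append_left (u := [s.pad [] C]) (A := s.dom ++ C)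
      (by simp [CSlice.dom, CSlice.cod, CSlice.pad])
    have h2 := (exchange_slice_word s hv).append_right (by simpa using hu.padded [] D)
    simpa using h1.trans (by simpa using h2)

/-! ### A strand crossing other strands virtually -/

/-- The strand `x` crosses the strands `L` virtually from left to right. -/
def fwd (x : Strand E) : List (Strand E) → CWord E
  | [] => []
  | y :: L => ⟨[], .virt x y, L⟩ :: pad [y] [] (fwd x L)

/-- The strand `x` crosses the strands `L` virtually from right to left. -/
def bwd (x : Strand E) : List (Strand E) → CWord E
  | [] => []
  | y :: L => pad [y] [] (bwd x L) ++ [⟨[], .virt y x, L⟩]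

@[simp] theorem fwd_nil (x : Strand E) : fwd x [] = [] := rfl

@[simp] theorem bwd_nil (x : Strand E) : bwd x [] = [] := rfl

theorem tangle_fwd (x : Strand E) (L : List (Strand E)) :
    Tangle (x :: L) (fwd x L) (L ++ [x]) := by
  induction L with
  | nil => simp
  | cons y L ih => exact ⟨by simp, by simpa using ih.padded [y] []⟩

theorem tangle_bwd (x : Strand E) (L : List (Strand E)) :
    Tangle (L ++ [x]) (bwd x L) (x :: L) := by
  induction L with
  | nil => simp
  | cons y L ih =>
    have := ih.padded [y] []
    exact Tangle.append (by simpa using this) (by simp)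

theorem fwd_append (x : Strand E) (L M : List (Strand E)) :
    fwd x (L ++ M) = pad [] M (fwd x L) ++ pad L [] (fwd x M) := by
  induction L with
  | nil => simp
  | cons y L ih => simp [fwd, ih]

theorem bwd_append (x : Strand E) (L M : List (Strand E)) :
    bwd x (L ++ M) = pad L [] (bwd x M) ++ pad [] M (bwd x L) := by
  induction L with
  | nil => simp
  | cons y L ih => simp [bwd, ih]

theorem bigon_eqv (x y : Strand E) :
    Eqv [x, y] [x, y] [⟨[], .virt x y, []⟩, ⟨[], .virt y x, []⟩] [] :=
  Eqv.of_move (.bigon x y) (by simp) (by simp)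

theorem fwd_bwd (x : Strand E) (L : List (Strand E)) :
    Eqv (x :: L) (x :: L) (fwd x L ++ bwd x L) [] := by
  induction L with
  | nil => exact Eqv.refl (by simp)
  | cons y L ih =>
    have h1 := Eqv.context (u := [⟨[], .virt x y, L⟩]) (v := [⟨[], .virt y x, L⟩])
      (A := x :: y :: L) (B := y :: x :: L) (C := y :: x :: L) (D := x :: y :: L)
      (by simp) (by simpa using ih.padded [y] []) (by simp)
    have h2 := (bigon_eqv x y).padded [] L
    simpa [fwd, bwd] using h1.trans (by simpa using h2)

theorem bwd_fwd (x : Strand E) (L : List (Strand E)) :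
    Eqv (L ++ [x]) (L ++ [x]) (bwd x L ++ fwd x L) [] := by
  induction L with
  | nil => exact Eqv.refl (by simp)
  | cons y L ih =>
    have h1 := Eqv.context (u := pad [y] [] (bwd x L)) (v := pad [y] [] (fwd x L))
      (A := y :: (L ++ [x])) (D := y :: (L ++ [x]))
      (by simpa using (tangle_bwd x L).padded [y] []) (by simpa using (bigon_eqv y x).padded [] L)
      (by simpa using (tangle_fwd x L).padded [y] [])
    have h2 := ih.padded [y] []
    simpa [fwd, bwd] using h1.trans (by simpa using h2)

/-- A strand may be moved virtually over an elementary piece. For minima, maxima and virtual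
crossings this uses virtual moves only, for a classical crossing the mixed triangle move. -/
theorem fwd_natural_gen (x : Strand E) (g : CGen E) :
    Eqv (x :: g.dom) (g.cod ++ [x]) (fwd x g.dom ++ [⟨[], g, [x]⟩])
      (⟨[x], g, []⟩ :: fwd x g.cod) := by
  cases g with
  | cup y =>
    have h1 := (Eqv.of_move (A := [x]) (B := [y, x, dual y]) (CMove.slideCup y x) (by simp)
      (by simp)).append_right (v := [⟨[y], .virt x (dual y), []⟩]) (C := [y, dual y, x]) (by simp)
    have h2 := ((bigon_eqv (dual y) x).padded [y] []).append_left (u := [⟨[], .cup y, [x]⟩])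
      (A := [x]) (by simp)
    exact (h1.trans (by simpa using h2)).symm
  | cap y =>
    have h1 := (Eqv.of_move (A := [y, x, dual y]) (B := [x]) (CMove.slideCap y x) (by simp)
      (by simp)).symm.append_left (u := [⟨[], .virt x y, [dual y]⟩]) (A := [x, y, dual y]) (by simp)
    have h2 := ((bigon_eqv x y).padded [] [dual y]).append_right (v := [⟨[x], .cap y, []⟩])
      (C := [x]) (by simp)
    exact h1.trans (by simpa using h2)
  | virt y z => exact Eqv.of_move (.triangle x y z) (by simp [fwd]) (by simp [fwd])
  | box r y z e f => exact Eqv.of_move (.triangleBox x r y z e f) (by simp [fwd]) (by simp [fwd])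

theorem fwd_natural_slice (x : Strand E) (s : CSlice E) :
    Eqv (x :: s.dom) (s.cod ++ [x]) (fwd x s.dom ++ [s.pad [] [x]])
      (s.pad [x] [] :: fwd x s.cod) := by
  obtain ⟨l, g, r⟩ := s
  simp only [CSlice.dom_mk, CSlice.cod_mk, fwd_append, CSlice.pad_mk, List.nil_append,
    List.append_nil, pad_append, pad_pad]
  -- the strand crosses `l`, then `g`, then `r`
  have t1 : Tangle (x :: (l ++ (g.dom ++ r))) (pad [] (g.dom ++ r) (fwd x l))
      (l ++ (x :: g.dom ++ r)) := by simpa using (tangle_fwd x l).padded [] (g.dom ++ r)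
  have t2 : Tangle (x :: (l ++ (g.cod ++ r))) (pad [] (g.cod ++ r) (fwd x l))
      (l ++ (x :: g.cod ++ r)) := by simpa using (tangle_fwd x l).padded [] (g.cod ++ r)
  have t3 : Tangle (l ++ (x :: g.dom ++ r)) (pad l r (fwd x g.dom)) (l ++ (g.dom ++ x :: r)) := by
    simpa using (tangle_fwd x g.dom).padded l r
  have t4 : Tangle (l ++ (g.cod ++ x :: r)) (pad (l ++ g.cod) [] (fwd x r))
      (l ++ (g.cod ++ (r ++ [x]))) := by simpa using (tangle_fwd x r).padded (l ++ g.cod) []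
  have e1 : Eqv (l ++ (g.dom ++ x :: r)) (l ++ (g.cod ++ (r ++ [x])))
      (pad (l ++ g.dom) [] (fwd x r) ++ [⟨l, g, r ++ [x]⟩])
      ([⟨l, g, x :: r⟩] ++ pad (l ++ g.cod) [] (fwd x r)) := by
    have := (exchange_slice_word ⟨l, g, []⟩ (tangle_fwd x r)).symm
    simpa using this
  have e2 : Eqv (l ++ (x :: g.dom ++ r)) (l ++ (g.cod ++ x :: r))
      (pad l r (fwd x g.dom) ++ [⟨l, g, x :: r⟩])
      ([⟨l ++ [x], g, r⟩] ++ pad l r (fwd x g.cod)) := by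
    simpa using (fwd_natural_gen x g).padded l r
  have e3 : Eqv (x :: (l ++ (g.dom ++ r))) (l ++ (x :: g.cod ++ r))
      (pad [] (g.dom ++ r) (fwd x l) ++ [⟨l ++ [x], g, r⟩])
      ([⟨x :: l, g, r⟩] ++ pad [] (g.cod ++ r) (fwd x l)) := by
    have := exchange_words (tangle_fwd x l) (v := [⟨[], g, r⟩]) (C := g.dom ++ r)
      (D := g.cod ++ r) (by simp)
    simpa using this
  have f1 := e1.append_left (t1.append t3)
  have f2 := Eqv.context t1 e2 t4
  have f3 := e3.append_right (v := pad l r (fwd x g.cod) ++ pad (l ++ g.cod) [] (fwd x r))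
    ((by simpa using (tangle_fwd x g.cod).padded l r :
      Tangle (l ++ (x :: g.cod ++ r)) _ (l ++ (g.cod ++ x :: r))).append t4)
  simp only [List.append_assoc, List.cons_append, List.nil_append] at f1 f2 f3 ⊢
  exact f1.trans (f2.trans f3)

/-- A strand may be moved virtually over a whole tangle (the detour move). -/
theorem fwd_natural (x : Strand E) {A B : List (Strand E)} {w : CWord E} (h : Tangle A w B) :
    Eqv (x :: A) (B ++ [x]) (fwd x A ++ pad [] [x] w) (pad [x] [] w ++ fwd x B) := by
  induction w generalizing A with
  | nil =>
    obtain rfl := h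
    simpa using Eqv.refl (tangle_fwd x A)
  | cons s w ih =>
    obtain ⟨rfl, h⟩ := h
    have h1 := (fwd_natural_slice x s).append_right (by simpa using h.padded [] [x])
    have h2 := (ih h).append_left (u := [s.pad [x] []]) (A := x :: s.dom)
      (by simp [CSlice.dom, CSlice.cod, CSlice.pad])
    simpa using h1.trans (by simpa using h2)

/-- The detour move for a strand that runs from right to left; it follows from `fwd_natural`, as
`fwd` and `bwd` are inverse to each other. -/
theorem bwd_natural (x : Strand E) {A B : List (Strand E)} {w : CWord E} (h : Tangle A w B) :
    Eqv (A ++ [x]) (x :: B) (bwd x A ++ pad [x] [] w) (pad [] [x] w ++ bwd x B) := by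
  have tx : Tangle (x :: A) (pad [x] [] w) (x :: B) := by simpa using h.padded [x] []
  have ty : Tangle (A ++ [x]) (pad [] [x] w) (B ++ [x]) := by simpa using h.padded [] [x]
  have h1 := (fwd_bwd x B).symm.append_left ((tangle_bwd x A).append tx)
  have h2 := Eqv.context (tangle_bwd x A) (fwd_natural x h).symm (tangle_bwd x B)
  have h3 := (bwd_fwd x A).append_right (ty.append (tangle_bwd x B))
  simp only [List.append_assoc, List.append_nil, List.nil_append] at h1 h2 h3
  exact h1.trans (h2.trans h3)

/-- A minimum to the right of `L` whose left branch crosses `L` is the same as a minimum to the left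
of `L` whose right branch crosses `L`. -/
theorem cup_bwd (y : Strand E) (L : List (Strand E)) :
    Eqv L (y :: (L ++ [dual y])) (⟨L, .cup y, []⟩ :: pad [] [dual y] (bwd y L))
      (⟨[], .cup y, L⟩ :: pad [y] [] (fwd (dual y) L)) := by
  induction L with
  | nil => exact Eqv.refl (by simp)
  | cons z L ih =>
    have h1 := (ih.padded [z] []).append_right (v := [⟨[], .virt z y, L ++ [dual y]⟩])
      (C := y :: z :: (L ++ [dual y])) (by simp)
    have h2 := (exchange_words (u := [⟨[], .virt z y, []⟩]) (A := [z, y]) (B := [y, z]) (by simp)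
      (tangle_fwd (dual y) L)).symm.append_left (u := [⟨[z], .cup y, L⟩]) (A := z :: L) (by simp)
    have h3 := ((Eqv.of_move (A := [z]) (B := [y, z, dual y]) (CMove.slideCup y z) (by simp)
      (by simp)).padded [] L).append_right (v := pad [y, z] [] (fwd (dual y) L))
      (C := y :: z :: (L ++ [dual y])) (by simpa using (tangle_fwd (dual y) L).padded [y, z] [])
    simp [bwd, fwd] at h1 h2 h3 ⊢
    exact h1.trans (h2.trans h3)

/-- A maximum to the right of `L` whose left branch crosses `L` is the same as a maximum to the left
of `L` whose right branch crosses `L`. -/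
theorem fwd_cap (x : Strand E) (L : List (Strand E)) :
    Eqv (x :: (L ++ [dual x])) L (pad [] [dual x] (fwd x L) ++ [⟨L, .cap x, []⟩])
      (pad [x] [] (bwd (dual x) L) ++ [⟨[], .cap x, L⟩]) := by
  induction L with
  | nil => exact Eqv.refl (by simp)
  | cons z L ih =>
    have h1 := (ih.padded [z] []).append_left (u := [⟨[], .virt x z, L ++ [dual x]⟩])
      (A := x :: z :: (L ++ [dual x])) (by simp)
    have h2 := (exchange_words (u := [⟨[], .virt x z, []⟩]) (A := [x, z]) (B := [z, x]) (by simp)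
      (tangle_bwd (dual x) L)).append_right (v := [⟨[z], .cap x, L⟩]) (C := z :: L) (by simp)
    have h3 := ((Eqv.of_move (A := [x, z, dual x]) (B := [z]) (CMove.slideCap x z) (by simp)
      (by simp)).padded [] L).append_left (u := pad [x, z] [] (bwd (dual x) L))
      (A := x :: z :: (L ++ [dual x])) (by simpa using (tangle_bwd (dual x) L).padded [x, z] [])
    simp [bwd, fwd] at h1 h2 h3 ⊢
    exact h1.trans (h2.trans h3)

/-! ### Tangles without classical crossings -/

/-- The piece is not a classical crossing. -/
def CGen.IsPure : CGen E → Prop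
  | .box .. => False
  | _ => True

@[simp] theorem CGen.isPure_cup (x : Strand E) : (CGen.cup x).IsPure := trivial
@[simp] theorem CGen.isPure_cap (x : Strand E) : (CGen.cap x).IsPure := trivial
@[simp] theorem CGen.isPure_virt (x y : Strand E) : (CGen.virt x y).IsPure := trivial
@[simp] theorem CGen.not_isPure_box (r : Bool) (x y : Strand E) (e f : E) :
    ¬ (CGen.box r x y e f).IsPure := id

/-- The tangle has no classical crossings. -/
def Pure (w : CWord E) : Prop := ∀ s ∈ w, s.gen.IsPure

@[simp] theorem pure_nil : Pure ([] : CWord E) := by simp [Pure]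

@[simp] theorem pure_cons {s : CSlice E} {w : CWord E} :
    Pure (s :: w) ↔ s.gen.IsPure ∧ Pure w := by simp [Pure]

@[simp] theorem pure_append {u v : CWord E} : Pure (u ++ v) ↔ Pure u ∧ Pure v := by
  simp [Pure, or_imp, forall_and]

@[simp] theorem pure_pad {L R : List (Strand E)} {w : CWord E} : Pure (pad L R w) ↔ Pure w := by
  induction w with
  | nil => simp
  | cons s w ih => simp [ih]

@[simp] theorem pure_fwd (x : Strand E) (L : List (Strand E)) : Pure (fwd x L) := by
  induction L with
  | nil => simp
  | cons y L ih => simp [fwd, ih]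

@[simp] theorem pure_bwd (x : Strand E) (L : List (Strand E)) : Pure (bwd x L) := by
  induction L with
  | nil => simp
  | cons y L ih => simp [bwd, ih]

/-- The number of maxima of an elementary piece. -/
def CGen.caps : CGen E → ℕ
  | .cap _ => 1
  | _ => 0

@[simp] theorem CGen.caps_cup (x : Strand E) : (CGen.cup x).caps = 0 := rfl
@[simp] theorem CGen.caps_cap (x : Strand E) : (CGen.cap x).caps = 1 := rfl
@[simp] theorem CGen.caps_virt (x y : Strand E) : (CGen.virt x y).caps = 0 := rfl

/-- The number of maxima of a tangle. -/
def caps : CWord E → ℕ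
  | [] => 0
  | s :: w => s.gen.caps + caps w

@[simp] theorem caps_nil : caps ([] : CWord E) = 0 := rfl

@[simp] theorem caps_cons (s : CSlice E) (w : CWord E) : caps (s :: w) = s.gen.caps + caps w := rfl

@[simp] theorem caps_append (u v : CWord E) : caps (u ++ v) = caps u + caps v := by
  induction u with
  | nil => simp
  | cons s u ih => simp [ih, add_assoc]

@[simp] theorem caps_pad (L R : List (Strand E)) (w : CWord E) : caps (pad L R w) = caps w := by
  induction w with
  | nil => simp
  | cons s w ih => simp [ih]

@[simp] theorem caps_fwd (x : Strand E) (L : List (Strand E)) : caps (fwd x L) = 0 := by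
  induction L with
  | nil => simp
  | cons y L ih => simp [fwd, ih]

theorem append_eq_append_cons {α : Type} {l X Q R : List α} {y : α} (h : l ++ X = Q ++ y :: R) :
    (∃ m, l = Q ++ y :: m ∧ R = m ++ X) ∨ ∃ Q', Q = l ++ Q' ∧ X = Q' ++ y :: R := by
  rcases List.append_eq_append_iff.1 h with ⟨m, h1, h2⟩ | ⟨m, h1, h2⟩
  · exact .inr ⟨m, h1, h2⟩
  · cases m with
    | nil => exact .inr ⟨[], by simpa using h1.symm, by simpa using h2.symm⟩
    | cons z m =>
      simp only [List.cons_append, List.cons.injEq] at h2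
      exact .inl ⟨m, by rw [h1, h2.1], h2.2⟩

theorem pair_eq_append_cons {α : Type} {a b y : α} {Q R : List α} (h : [a, b] = Q ++ y :: R) :
    (Q = [] ∧ y = a ∧ R = [b]) ∨ (Q = [a] ∧ y = b ∧ R = []) := by
  rcases Q with _ | ⟨c, _ | ⟨d, Q⟩⟩ <;> simp_all

theorem eqv_of_eq {A B : List (Strand E)} {w w' : CWord E} (h : Tangle A w B) (e : w = w') :
    Eqv A B w w' := e ▸ Eqv.refl h

/-- Following a strand downwards through a slice: either it comes from below, or it starts at a
minimum. In both cases the strand may be moved to the far left. -/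
theorem trace_bwd {s : CSlice E} (hs : s.gen.IsPure) {y : Strand E} {Q R : List (Strand E)}
    (h : s.cod = Q ++ y :: R) :
    (∃ Q' R' t, s.dom = Q' ++ y :: R' ∧ Tangle (Q' ++ R') t (Q ++ R) ∧ Pure t ∧
      caps t = s.gen.caps ∧ Eqv s.dom (y :: (Q ++ R)) (s :: pad [] R (bwd y Q))
        (pad [] R' (bwd y Q') ++ pad [y] [] t)) ∨
    ∃ P, Pure P ∧ caps P = 0 ∧ Tangle (dual y :: s.dom) P (Q ++ R) ∧
      Eqv s.dom (y :: (Q ++ R)) (s :: pad [] R (bwd y Q))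
        (⟨[], .cup y, s.dom⟩ :: pad [y] [] P) := by
  obtain ⟨l, g, r⟩ := s
  simp only [CSlice.cod_mk, CSlice.dom_mk] at h hs ⊢
  rcases append_eq_append_cons h with ⟨m, rfl, rfl⟩ | ⟨Q', rfl, h'⟩
  · refine .inl ⟨Q, m ++ (g.dom ++ r), [⟨Q ++ m, g, r⟩], by simp, by simp, by simpa, by simp, ?_⟩
    have := (exchange_words (tangle_bwd y Q) (v := [⟨m, g, r⟩]) (C := m ++ (g.dom ++ r))
      (D := m ++ (g.cod ++ r)) (by simp)).symm
    simpa using this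
  clear h
  rcases append_eq_append_cons h' with ⟨m, h, rfl⟩ | ⟨m, rfl, rfl⟩
  · cases g with
    | cup z =>
      right
      rcases pair_eq_append_cons h with ⟨rfl, rfl, rfl⟩ | ⟨rfl, rfl, rfl⟩
      · refine ⟨pad [] r (fwd (dual y) l), by simp, by simp,
          by simpa using (tangle_fwd (dual y) l).padded [] r, ?_⟩
        simpa using (cup_bwd y l).padded [] r
      · refine ⟨pad [] r (fwd z l), by simp, by simp,
          by simpa using (tangle_fwd z l).padded [] r, ?_⟩
        have h1 := ((Eqv.of_move (A := []) (B := [dual z, z]) (CMove.curlCup z) (by simp)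
          (by simp)).padded l r).append_right (v := pad [] (z :: r) (bwd (dual z) l))
          (C := dual z :: (l ++ z :: r))
          (by simpa using (tangle_bwd (dual z) l).padded [] (z :: r))
        have h2 := (cup_bwd (dual z) l).padded [] r
        simp [bwd_append, bwd] at h1 h2 ⊢
        exact h1.trans h2
    | cap z => simp at h
    | virt a b =>
      left
      rcases pair_eq_append_cons h with ⟨rfl, rfl, rfl⟩ | ⟨rfl, rfl, rfl⟩
      · refine ⟨l ++ [a], r, [], by simp, by simp, by simp, by simp, ?_⟩
        refine eqv_of_eq ?_ (by simp [bwd_append, bwd])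
        simpa using (tangle_bwd y l).padded [] (a :: r)
      · refine ⟨l, b :: r, [], by simp, by simp, by simp, by simp, ?_⟩
        have := ((bigon_eqv y b).padded l r).append_right (v := pad [] (b :: r) (bwd y l))
          (C := y :: (l ++ (b :: r))) (by simpa using (tangle_bwd y l).padded [] (b :: r))
        simpa [bwd_append, bwd] using this
    | box => simp at hs
  · refine .inl ⟨l ++ (g.dom ++ m), R, [⟨l, g, m ++ R⟩], by simp, by simp, by simpa, by simp, ?_⟩
    have := (bwd_natural y (w := [⟨l, g, m⟩]) (A := l ++ (g.dom ++ m)) (B := l ++ (g.cod ++ m))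
      (by simp)).symm.padded [] R
    simpa using this

/-- Join the leftmost strand `x` to the strand `dual x` between `Q` and `R` by a maximum. -/
def join (x : Strand E) (Q R : List (Strand E)) : CWord E :=
  pad [x] R (bwd (dual x) Q) ++ [⟨[], .cap x, Q ++ R⟩]

theorem tangle_join (x : Strand E) (Q R : List (Strand E)) :
    Tangle (x :: (Q ++ dual x :: R)) (join x Q R) (Q ++ R) :=
  Tangle.append (by simpa using (tangle_bwd (dual x) Q).padded [x] R) (by simp)

/-- Following a strand upwards through a slice: either it continues above, or it ends at a
maximum. -/
theorem trace_fwd {s : CSlice E} (hs : s.gen.IsPure) {x : Strand E} {P A : List (Strand E)}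
    (h : s.dom = P ++ x :: A) :
    (∃ P' A' t, s.cod = P' ++ x :: A' ∧ Tangle (P ++ A) t (P' ++ A') ∧ Pure t ∧
      caps t = s.gen.caps ∧ t.length ≤ 1 ∧ Eqv (x :: (P ++ A)) s.cod (pad [] A (fwd x P) ++ [s])
        (pad [x] [] t ++ pad [] A' (fwd x P'))) ∨
    (s.gen.caps = 1 ∧ ∃ Q R, P ++ A = Q ++ dual x :: R ∧ s.cod = Q ++ R ∧
      Eqv (x :: (P ++ A)) (Q ++ R) (pad [] A (fwd x P) ++ [s]) (join x Q R)) := by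
  obtain ⟨l, g, r⟩ := s
  simp only [CSlice.cod_mk, CSlice.dom_mk] at h hs ⊢
  rcases append_eq_append_cons h with ⟨m, rfl, rfl⟩ | ⟨Q', rfl, h'⟩
  · refine .inl ⟨P, m ++ (g.cod ++ r), [⟨P ++ m, g, r⟩], by simp, by simp, by simpa, by simp,
      by simp, ?_⟩
    have := exchange_words (tangle_fwd x P) (v := [⟨m, g, r⟩]) (C := m ++ (g.dom ++ r))
      (D := m ++ (g.cod ++ r)) (by simp)
    simpa using this
  clear h
  rcases append_eq_append_cons h' with ⟨m, h, rfl⟩ | ⟨m, rfl, rfl⟩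
  · cases g with
    | cup z => simp at h
    | cap z =>
      refine .inr ⟨rfl, ?_⟩
      rcases pair_eq_append_cons h with ⟨rfl, rfl, rfl⟩ | ⟨rfl, rfl, rfl⟩
      · refine ⟨l, r, by simp, by simp, ?_⟩
        simpa [join] using (fwd_cap x l).padded [] r
      · refine ⟨l, r, by simp, by simp, ?_⟩
        have h1 := ((Eqv.of_move (A := [dual z, z]) (B := []) (CMove.curlCap (dual z)) (by simp)
          (by simp)).padded l r).append_left (u := pad [] (z :: r) (fwd (dual z) l))
          (A := dual z :: (l ++ z :: r))
          (by simpa using (tangle_fwd (dual z) l).padded [] (z :: r))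
        have h2 := (fwd_cap (dual z) l).padded [] r
        simp [fwd_append, fwd, join] at h1 h2 ⊢
        exact h1.trans h2
    | virt a b =>
      left
      rcases pair_eq_append_cons h with ⟨rfl, rfl, rfl⟩ | ⟨rfl, rfl, rfl⟩
      · refine ⟨l ++ [b], r, [], by simp, by simp, by simp, by simp, by simp, ?_⟩
        refine eqv_of_eq (Tangle.append (B := l ++ x :: b :: r) ?_ (by simp))
          (by simp [fwd_append, fwd])
        simpa using (tangle_fwd x l).padded [] (b :: r)
      · refine ⟨l, a :: r, [], by simp, by simp, by simp, by simp, by simp, ?_⟩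
        have := ((bigon_eqv x a).padded l r).append_left (u := pad [] (a :: r) (fwd x l))
          (A := x :: (l ++ (a :: r))) (by simpa using (tangle_fwd x l).padded [] (a :: r))
        simpa [fwd_append, fwd] using this
    | box => simp at hs
  · refine .inl ⟨l ++ (g.cod ++ m), A, [⟨l, g, m ++ A⟩], by simp, by simp, by simpa, by simp,
      by simp, ?_⟩
    have := (fwd_natural x (w := [⟨l, g, m⟩]) (A := l ++ (g.dom ++ m)) (B := l ++ (g.cod ++ m))
      (by simp)).padded [] A
    simpa using this

/-- `trace_bwd` for a tangle of at most one slice, as it arises from `trace_fwd`. -/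
theorem trace_bwd_word {t : CWord E} (ht : Pure t) (hl : t.length ≤ 1) {y : Strand E}
    {A Q R : List (Strand E)} (h : Tangle A t (Q ++ y :: R)) :
    (∃ Q' R' t', A = Q' ++ y :: R' ∧ Tangle (Q' ++ R') t' (Q ++ R) ∧ Pure t' ∧
      caps t' = caps t ∧ Eqv A (y :: (Q ++ R)) (t ++ pad [] R (bwd y Q))
        (pad [] R' (bwd y Q') ++ pad [y] [] t')) ∨
    ∃ P, Pure P ∧ caps P = 0 ∧ Tangle (dual y :: A) P (Q ++ R) ∧
      Eqv A (y :: (Q ++ R)) (t ++ pad [] R (bwd y Q)) (⟨[], .cup y, A⟩ :: pad [y] [] P) := by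
  match t, hl with
  | [], _ =>
    obtain rfl := h
    exact .inl ⟨Q, R, [], rfl, rfl, by simp, rfl,
      eqv_of_eq (by simpa using (tangle_bwd y Q).padded [] R) (by simp)⟩
  | [s], _ =>
    obtain ⟨rfl, h⟩ := h
    simpa using trace_bwd (by simpa using ht) h

/-- Every strand of a tangle without classical crossings and without upper ends may be pulled
down: the end `x`, moved to the far left, is joined to the end `dual x` of the same strand below all
other slices. The strand is followed upwards slice by slice and, after it has turned, downwards
again; maxima are counted because a turn at a minimum starts the process anew, with one maximum
less. -/
theorem pull_strand (n : ℕ) : ∀ M : CWord E, caps M ≤ n → Pure M →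
    ∀ (P : List (Strand E)) (x : Strand E) (A : List (Strand E)), Tangle (P ++ x :: A) M [] →
      ∃ Q R M', P ++ A = Q ++ dual x :: R ∧ Tangle (Q ++ R) M' [] ∧ Pure M' ∧ caps M' < caps M ∧
        Eqv (x :: (P ++ A)) [] (pad [] A (fwd x P) ++ M) (join x Q R ++ M') := by
  induction n using Nat.strong_induction_on with
  | _ n IH =>
  intro M
  induction M with
  | nil => intro _ _ P x A h; simp at h
  | cons s M ih =>
    intro hc hp P x A h
    obtain ⟨h1, hM⟩ := h
    simp only [pure_cons, caps_cons] at hp hc ⊢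
    rcases trace_fwd hp.1 h1.symm with ⟨P', A', t, h2, ht, htp, htc, htl, e⟩ | ⟨hs, Q, R, h2, h3, e⟩
    · rw [h2] at hM
      obtain ⟨Q, R, M', h3, hM', hM'p, hM'c, e'⟩ := ih (by omega) hp.2 P' x A' hM
      rw [h3] at ht
      -- the word is equivalent to `t`, followed by the joining maximum and `M'`
      have e1 : Eqv (x :: (P ++ A)) [] (pad [] A (fwd x P) ++ s :: M)
          (pad [x] [] t ++ (join x Q R ++ M')) := by
        have a1 := e.append_right (h2 ▸ hM)
        have a2 := e'.append_left (u := pad [x] [] t) (A := x :: (P ++ A))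
          (by simpa [h3] using ht.padded [x] [])
        simp only [List.append_assoc, List.singleton_append] at a1 a2
        exact a1.trans a2
      rcases trace_bwd_word htp htl ht with
        ⟨Q', R', t', h4, ht', ht'p, ht'c, e2⟩ | ⟨P0, hP0, hP0c, hP0t, e2⟩
      · refine ⟨Q', R', t' ++ M', h4, ht'.append hM', by simp [*],
          by rw [caps_append]; omega, e1.trans ?_⟩
        have a1 := (e2.padded [x] []).append_right (v := ⟨[], .cap x, Q ++ R⟩ :: M') (C := [])
          (by simpa using hM')
        have a2 := Eqv.context (A := x :: (P ++ A)) (u := pad [x] R' (bwd (dual x) Q'))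
          (by simpa [h4] using (tangle_bwd (dual x) Q').padded [x] R')
          (exchange_slice_word ⟨[], .cap x, []⟩ ht').symm (v := M') (D := []) (by simpa using hM')
        simp [join] at a1 a2 ⊢
        exact a1.trans a2
      · -- the two strands meet in a minimum, which cancels the joining maximum
        simp only [dual_dual] at hP0t
        have a1 := (e2.padded [x] []).append_right (v := ⟨[], .cap x, Q ++ R⟩ :: M') (C := [])
          (by simpa using hM')
        have a2 := Eqv.context (A := x :: (P ++ A)) (u := [⟨[x], .cup (dual x), P ++ A⟩])
          (by simp) (exchange_slice_word ⟨[], .cap x, []⟩ hP0t).symm (v := M') (D := [])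
          (by simpa using hM')
        have a3 := ((Eqv.of_move (A := [x]) (B := [x]) (CMove.zigzagRight x) (by simp)
          (by simp)).padded [] (P ++ A)).append_right (by simpa using hP0t.append hM')
        have a4 : Eqv (x :: (P ++ A)) [] (pad [] A (fwd x P) ++ s :: M) (P0 ++ M') := by
          refine e1.trans ?_
          simp [join] at a1 a2 a3 ⊢
          exact a1.trans (a2.trans a3)
        obtain ⟨Q'', R'', M'', h5, h6, h7, h8, h9⟩ := IH (caps (P0 ++ M')) (by simp; omega)
          (P0 ++ M') le_rfl (by simp [*]) [] x (P ++ A) (hP0t.append hM')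
        refine ⟨Q'', R'', M'', h5, h6, h7, ?_, a4.trans (by simpa using h9)⟩
        simp at h8
        omega
    · rw [h3] at hM
      exact ⟨Q, R, M, h2, hM, hp.2, by omega, by simpa using e.append_right hM⟩

/-- Pull down the leftmost strand. -/
theorem pull_first {M : CWord E} (hp : Pure M) {x : Strand E} {A : List (Strand E)}
    (h : Tangle (x :: A) M []) :
    ∃ Q R M', A = Q ++ dual x :: R ∧ Tangle (Q ++ R) M' [] ∧ Pure M' ∧ caps M' < caps M ∧
      Eqv (x :: A) [] M (join x Q R ++ M') := by
  simpa using pull_strand (caps M) M le_rfl hp [] x A h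

/-- Closed circles, each below the next one. -/
def circles (l : List (Strand E)) : CWord E :=
  l.flatMap fun x => [⟨[], .cup x, []⟩, ⟨[], .cap x, []⟩]

@[simp] theorem circles_nil : circles ([] : List (Strand E)) = [] := rfl

@[simp] theorem circles_cons (x : Strand E) (l : List (Strand E)) :
    circles (x :: l) = ⟨[], .cup x, []⟩ :: ⟨[], .cap x, []⟩ :: circles l := rfl

theorem tangle_circles (l : List (Strand E)) : Tangle [] (circles l) [] := by
  induction l with
  | nil => simp
  | cons x l ih => simpa using ih

/-- A closed tangle without classical crossings is a union of circles. -/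
theorem closed_pure (n : ℕ) : ∀ M : CWord E, caps M ≤ n → Pure M → Tangle [] M [] →
    ∃ l, Eqv [] [] M (circles l) := by
  induction n with
  | zero =>
    intro M hc hp h
    cases M with
    | nil => exact ⟨[], Eqv.refl h⟩
    | cons s M =>
      obtain ⟨l, g, r⟩ := s
      obtain ⟨h1, h2⟩ := h
      cases g <;> simp_all
      obtain ⟨-, -, M', -, -, -, h3, -⟩ := pull_first hp h2
      omega
  | succ n ih =>
    intro M hc hp h
    cases M with
    | nil => exact ⟨[], Eqv.refl h⟩
    | cons s M =>
      obtain ⟨l, g, r⟩ := s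
      obtain ⟨h1, h2⟩ := h
      cases g with
      | cup x =>
        simp only [CSlice.dom_mk, CGen.dom, List.nil_append, List.nil_eq_append_iff] at h1
        obtain ⟨rfl, rfl⟩ := h1
        simp at h2 hp hc
        obtain ⟨Q, R, M', h3, h4, h5, h6, e⟩ := pull_first hp h2
        obtain ⟨rfl, -, rfl⟩ : Q = [] ∧ dual x = dual x ∧ R = [] := by
          rcases Q with _ | ⟨a, Q⟩ <;> simp_all
        obtain ⟨m, e'⟩ := ih M' (by omega) h5 (by simpa using h4)
        refine ⟨x :: m, ?_⟩
        have a1 := e.append_left (u := [⟨[], .cup x, []⟩]) (A := []) (by simp)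
        have a2 := e'.append_left (u := [⟨[], .cup x, []⟩, ⟨[], .cap x, []⟩]) (A := []) (by simp)
        simp [join] at a1 a2 ⊢
        exact a1.trans a2
      | cap => simp at h1
      | virt => simp at h1
      | box => simp at h1

/-- The colour `e` occurs in a list of strands. -/
def Occurs (e : E) (L : List (Strand E)) : Prop := ∃ x ∈ L, x.2 = e

@[simp] theorem occurs_nil (e : E) : ¬ Occurs e [] := by simp [Occurs]

@[simp] theorem occurs_cons {e : E} {x : Strand E} {L : List (Strand E)} :
    Occurs e (x :: L) ↔ x.2 = e ∨ Occurs e L := by simp [Occurs]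

@[simp] theorem occurs_append {e : E} {L M : List (Strand E)} :
    Occurs e (L ++ M) ↔ Occurs e L ∨ Occurs e M := by
  simp [Occurs, or_and_right, exists_or]

/-- The colour `e` occurs on one of the horizontal lines of a tangle that starts from `A`. -/
def HasColour (A : List (Strand E)) (w : CWord E) (e : E) : Prop :=
  Occurs e A ∨ ∃ s ∈ w, Occurs e s.cod

/-- The piece is a maximum or a virtual crossing. -/
def CGen.IsCupless : CGen E → Prop
  | .virt .. => True
  | .cap _ => True
  | _ => False

theorem HasColour.of_cupless {A B : List (Strand E)} {w : CWord E} {e : E}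
    (hw : ∀ s ∈ w, s.gen.IsCupless) (h : Tangle A w B) (he : HasColour A w e) :
    Occurs e A := by
  induction w generalizing A with
  | nil => simpa [HasColour] using he
  | cons s w ih =>
    obtain ⟨rfl, h⟩ := h
    have key : Occurs e s.cod → Occurs e s.dom := by
      obtain ⟨l, g, r⟩ := s
      have := hw ⟨l, g, r⟩ (by simp)
      cases g <;> simp [CGen.IsCupless] at this ⊢ <;> tauto
    rcases he with he | ⟨t, ht, he⟩
    · exact he
    · rcases List.mem_cons.1 ht with rfl | ht
      · exact key he
      · exact key (ih (fun s hs => hw s (by simp [hs])) h (.inr ⟨t, ht, he⟩))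

theorem isCupless_of_mem_pad {L R : List (Strand E)} {w : CWord E}
    (h : ∀ s ∈ w, s.gen.IsCupless) : ∀ s ∈ pad L R w, s.gen.IsCupless := by
  intro s hs
  obtain ⟨t, ht, rfl⟩ := List.mem_map.1 hs
  exact h t ht

theorem isCupless_of_mem_bwd (x : Strand E) (L : List (Strand E)) :
    ∀ s ∈ bwd x L, s.gen.IsCupless := by
  induction L with
  | nil => simp
  | cons y L ih =>
    intro s hs
    rcases List.mem_append.1 hs with hs | hs
    · exact isCupless_of_mem_pad ih s hs
    · simp at hs
      simp [hs, CGen.IsCupless]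

/-- Tangles without classical crossings and without upper ends are determined, up to closed
circles, by the strands at their lower ends if these are distinct. -/
theorem pure_unique (n : ℕ) : ∀ (A : List (Strand E)), A.length ≤ n → A.Nodup →
    ∀ M₁ M₂ : CWord E, Pure M₁ → Pure M₂ → Tangle A M₁ [] → Tangle A M₂ [] →
      ∃ N l₁ l₂, (∀ s ∈ N, s.gen.IsCupless) ∧
        Eqv A [] M₁ (N ++ circles l₁) ∧ Eqv A [] M₂ (N ++ circles l₂) := by
  induction n with
  | zero =>
    intro A hA _ M₁ M₂ p₁ p₂ h₁ h₂
    obtain rfl : A = [] := by simpa using hA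
    obtain ⟨l₁, e₁⟩ := closed_pure _ M₁ le_rfl p₁ h₁
    obtain ⟨l₂, e₂⟩ := closed_pure _ M₂ le_rfl p₂ h₂
    exact ⟨[], l₁, l₂, by simp, e₁, e₂⟩
  | succ n ih =>
    intro A hA hd M₁ M₂ p₁ p₂ h₁ h₂
    cases A with
    | nil => exact ih [] (by simp) hd M₁ M₂ p₁ p₂ h₁ h₂
    | cons x A =>
      obtain ⟨Q, R, M₁', rfl, t₁, p₁', -, e₁⟩ := pull_first p₁ h₁
      obtain ⟨Q', R', M₂', hQ, t₂, p₂', -, e₂⟩ := pull_first p₂ h₂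
      have hd' : (dual x :: (Q ++ R)).Nodup := List.nodup_middle.1 (List.nodup_cons.1 hd).2
      have hd'' : (dual x :: (Q' ++ R')).Nodup :=
        List.nodup_middle.1 (hQ ▸ (List.nodup_cons.1 hd).2)
      obtain ⟨rfl, -, rfl⟩ : Q = Q' ∧ dual x = dual x ∧ R = R' := by
        refine (List.append_cons_inj_of_notMem ?_ ?_).1 hQ
        · simp at hd'
          tauto
        · simp at hd'
          tauto
      obtain ⟨N, l₁, l₂, hN, f₁, f₂⟩ := ih (Q ++ R) (by simp at hA ⊢; omega)
        (List.nodup_cons.1 hd').2 M₁' M₂' p₁' p₂' t₁ t₂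
      refine ⟨join x Q R ++ N, l₁, l₂, ?_, ?_, ?_⟩
      · intro s hs
        rcases List.mem_append.1 hs with hs | hs
        · rcases List.mem_append.1 hs with hs | hs
          · exact isCupless_of_mem_pad (isCupless_of_mem_bwd _ _) s hs
          · simp at hs
            simp [hs, CGen.IsCupless]
        · exact hN s hs
      · simpa using e₁.trans (f₁.append_left (tangle_join x Q R))
      · simpa using e₂.trans (f₂.append_left (tangle_join x Q R))

/-! ### Moving the classical crossings to the bottom -/

/-- A classical crossing up to rotation: its sign, and the colours of the incoming and of the
outgoing ends of its two strands. -/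
structure Box (E : Type) : Type where
  positive : Bool
  overIn : E
  overOut : E
  underIn : E
  underOut : E

namespace Box

variable (b : Box E)

/-- The incoming colour of the rising strand when both strands are directed upwards. -/
def in₁ : E := if b.positive then b.overIn else b.underIn
/-- The incoming colour of the falling strand when both strands are directed upwards. -/
def in₂ : E := if b.positive then b.underIn else b.overIn
/-- The outgoing colour of the rising strand when both strands are directed upwards. -/
def out₁ : E := if b.positive then b.overOut else b.underOut
/-- The outgoing colour of the falling strand when both strands are directed upwards. -/
def out₂ : E := if b.positive then b.underOut else b.overOut

/-- The crossing with both strands directed upwards. -/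
def gen : CGen E := .box b.positive (true, b.in₁) (true, b.in₂) b.out₁ b.out₂

/-- The ends of a crossing all of whose ends have been bent upwards. -/
def ends : List (Strand E) := [(true, b.out₂), (true, b.out₁), (false, b.in₂), (false, b.in₁)]

/-- The crossing with all its ends bent upwards. -/
def state : CWord E :=
  [⟨[], .cup (true, b.in₁), []⟩, ⟨[(true, b.in₁)], .cup (true, b.in₂), [(false, b.in₁)]⟩,
    ⟨[], b.gen, [(false, b.in₂), (false, b.in₁)]⟩]

theorem tangle_state : Tangle [] b.state b.ends := by
  simp [state, ends, gen, dual]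

end Box

/-- The crossing, up to rotation, of an elementary piece. -/
def CGen.toBox : CGen E → Option (Box E)
  | .box r x y e f =>
    let rin := if x.1 then x.2 else e
    let rout := if x.1 then e else x.2
    let fin := if y.1 then y.2 else f
    let fout := if y.1 then f else y.2
    some ⟨turnsCounter x.1 y.1 r, if r then rin else fin, if r then rout else fout,
      if r then fin else rin, if r then fout else rout⟩
  | _ => none

/-- The classical crossings of a tangle, from bottom to top. -/
def boxes (w : CWord E) : List (Box E) := w.filterMap fun s => s.gen.toBox

@[simp] theorem boxes_nil : boxes ([] : CWord E) = [] := rfl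

/-- The crossing does not change if its diagram is rotated by a quarter turn, which exchanges the
rising and the falling strand. -/
theorem toBox_rotate (r : Bool) (x y : Strand E) (e f : E) :
    (CGen.box (!r) y (!x.1, e) f x.2).toBox = (CGen.box r x y e f).toBox := by
  obtain ⟨a, x⟩ := x
  obtain ⟨b, y⟩ := y
  cases r <;> cases a <;> cases b <;> simp [CGen.toBox, turnsCounter]

/-- The crossing `b` may be moved to the bottom left of the piece `g`, with all its ends bent
upwards. -/
def Pulls (g : CGen E) (b : Box E) : Prop :=
  ∃ M, Pure M ∧ Tangle (b.ends ++ g.dom) M g.cod ∧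
    Eqv g.dom g.cod [⟨[], g, []⟩] (pad [] g.dom b.state ++ M)

theorem Box.pulls_gen (b : Box E) : Pulls b.gen b := by
  obtain ⟨x, hx⟩ : ∃ x, x = ((true, b.in₁) : Strand E) := ⟨_, rfl⟩
  obtain ⟨y, hy⟩ : ∃ y, y = ((true, b.in₂) : Strand E) := ⟨_, rfl⟩
  have hg : b.gen = .box b.positive x y b.out₁ b.out₂ := by simp [Box.gen, hx, hy]
  have hd : b.gen.dom = [x, y] := by simp [hg]
  have hc : b.gen.cod = [(true, b.out₂), (true, b.out₁)] := by simp [hg, hx, hy]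
  have hx' : (false, b.in₁) = dual x := by simp [hx, dual]
  have hy' : (false, b.in₂) = dual y := by simp [hy, dual]
  have he : b.ends = b.gen.cod ++ [dual y, dual x] := by simp [Box.ends, hc, hx', hy']
  have hs : b.state = [⟨[], .cup x, []⟩, ⟨[x], .cup y, [dual x]⟩,
      ⟨[], b.gen, [dual y, dual x]⟩] := by simp [Box.state, hx', hy', ← hx, ← hy]
  refine ⟨[⟨b.gen.cod ++ [dual y], .cap (dual x), [y]⟩, ⟨b.gen.cod, .cap (dual y), []⟩], by simp,
    by simp [he, hd], ?_⟩
  rw [hs]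
  generalize b.gen = g at *
  simp only [hd]
  -- the maxima are moved below the crossing and cancel the minima
  have e1 := (exchange_words (u := [⟨[], g, []⟩]) (A := [x, y]) (B := g.cod) (by simp [hd])
    (v := [⟨[dual y], .cap (dual x), [y]⟩, ⟨[], .cap (dual y), []⟩]) (C := [dual y, dual x, x, y])
    (D := []) (by simp)).append_left (A := [x, y])
    (u := [⟨[], .cup x, [x, y]⟩, ⟨[x], .cup y, [dual x, x, y]⟩]) (by simp)
  have e2 := Eqv.context (A := [x, y]) (D := g.cod) (u := [⟨[], .cup x, [x, y]⟩]) (by simp)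
    (exchange_slices ⟨[x], .cup y, []⟩ ⟨[], .cap (dual x), [y]⟩)
    (v := [⟨[x, y], .cap (dual y), []⟩, ⟨[], g, []⟩]) (by simp [hd])
  have e3 := ((Eqv.of_move (A := [x]) (B := [x]) (CMove.zigzagLeft x) (by simp)
    (by simp)).padded [] [y]).append_right (C := g.cod)
    (v := [⟨[x], .cup y, [y]⟩, ⟨[x, y], .cap (dual y), []⟩, ⟨[], g, []⟩]) (by simp [hd])
  have e4 := ((Eqv.of_move (A := [y]) (B := [y]) (CMove.zigzagLeft y) (by simp)
    (by simp)).padded [x] []).append_right (C := g.cod) (v := [⟨[], g, []⟩]) (by simp [hd])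
  simp at e1 e2 e3 e4 ⊢
  exact (e1.trans (e2.trans (e3.trans e4))).symm

/-- A piece may be replaced by the same crossing rotated by a quarter turn. -/
theorem Pulls.rotate {r : Bool} {x y : Strand E} {e f : E} {b : Box E}
    (h : Pulls (.box (!r) y (!x.1, e) f x.2) b) : Pulls (.box r x y e f) b := by
  obtain ⟨M, hp, ht, hM⟩ := h
  obtain ⟨z, hz⟩ : ∃ z, z = ((x.1, e) : Strand E) := ⟨_, rfl⟩
  obtain ⟨v, hv⟩ : ∃ v, v = ((y.1, f) : Strand E) := ⟨_, rfl⟩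
  have hz' : (!x.1, e) = dual z := by simp [hz, dual]
  have hd : (CGen.box r x y e f).dom = [x, y] := rfl
  have hc : (CGen.box r x y e f).cod = [v, z] := by simp [hv, hz]
  have hd' : (CGen.box (!r) y (!x.1, e) f x.2).dom = [y, dual z] := by simp [hz']
  have hc' : (CGen.box (!r) y (!x.1, e) f x.2).cod = [dual x, v] := by simp [hv, dual]
  have hr := CMove.rotate r x y e f
  rw [← hv, ← hz, hz'] at hr
  rw [hz'] at hM ht hd' hc'
  generalize CGen.box r x y e f = g at *
  generalize CGen.box (!r) y (dual z) f x.2 = g' at *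
  rw [hd', hc'] at hM ht
  refine ⟨pad [] [y] (bwd x b.ends) ++ (⟨x :: (b.ends ++ [y]), .cup (dual z), []⟩ ::
    (pad [x] [z] M ++ [⟨[], .cap x, [v, z]⟩])), by simp [hp], ?_, ?_⟩
  · rw [hd, hc]
    refine Tangle.append (B := x :: (b.ends ++ [y]))
      (by simpa using (tangle_bwd x b.ends).padded [] [y]) ⟨by simp, ?_⟩
    refine Tangle.append (B := [x, dual x, v, z]) (by simpa using ht.padded [x] [z]) (by simp)
  rw [hd, hc]
  have e1 := ((Eqv.of_move (A := [z]) (B := [z]) (CMove.zigzagRight z) (by simp)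
    (by simp)).padded [v] []).symm.append_left (A := [x, y]) (u := [⟨[], g, []⟩]) (by simp [hd, hc])
  have e2 := (exchange_slices ⟨[], g, []⟩ ⟨[], .cup (dual z), []⟩).append_right (C := [v, z])
    (v := [⟨[v], .cap z, [z]⟩]) (by simp [hc])
  have e3 := ((Eqv.of_move (A := [x, y, dual z]) (B := [v]) hr (by simp [hd, hc])
    (by simp [hd', hc'])).padded [] [z]).append_left (A := [x, y])
    (u := [⟨[x, y], .cup (dual z), []⟩]) (by simp)
  have e4 := Eqv.context (A := [x, y]) (u := [⟨[x, y], .cup (dual z), []⟩]) (by simp)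
    (hM.padded [x] [z]) (v := [⟨[], .cap x, [v, z]⟩]) (D := [v, z]) (by simp)
  have e5 := (exchange_words (b.tangle_state.padded [x] [y]) (v := [⟨[], .cup (dual z), []⟩])
    (C := []) (D := [dual z, z]) (by simp)).symm.append_right (C := [v, z])
    (v := pad [x] [z] M ++ [⟨[], .cap x, [v, z]⟩])
    (Tangle.append (B := [x, dual x, v, z]) (by simpa using ht.padded [x] [z]) (by simp))
  have e6 := ((bwd_natural x b.tangle_state).padded [] [y]).append_right (C := [v, z])
    (v := ⟨x :: (b.ends ++ [y]), .cup (dual z), []⟩ ::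
      (pad [x] [z] M ++ [⟨[], .cap x, [v, z]⟩])) ⟨by simp, by
        refine Tangle.append (B := [x, dual x, v, z]) (by simpa using ht.padded [x] [z]) (by simp)⟩
  simp [hd, hc] at e1 e2 e3 e4 e5 e6 ⊢
  exact e1.trans (e2.trans (e3.trans (e4.trans (e5.trans e6))))

/-- Every classical crossing may be moved to the bottom: after at most three quarter turns both of
its strands are directed upwards. -/
theorem pulls_of_toBox {g : CGen E} {b : Box E} (h : g.toBox = some b) : Pulls g b := by
  cases g with
  | box r x y e f =>
    have up : ∀ (r : Bool) (x y e f : E),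
        (CGen.box r (true, x) (true, y) e f).toBox = some b →
        Pulls (.box r (true, x) (true, y) e f) b := by
      intro r x y e f h
      have := b.pulls_gen
      convert this
      simp only [CGen.toBox, Option.some.injEq] at h
      subst h
      cases r <;> simp [Box.gen, Box.in₁, Box.in₂, Box.out₁, Box.out₂, turnsCounter]
    obtain ⟨a, x⟩ := x
    obtain ⟨c, y⟩ := y
    cases a <;> cases c
    · refine Pulls.rotate (Pulls.rotate (up _ _ _ _ _ ?_))
      rw [← h]
      cases r <;> simp [CGen.toBox, turnsCounter]
    · refine Pulls.rotate (up _ _ _ _ _ ?_)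
      rw [← h]
      cases r <;> simp [CGen.toBox, turnsCounter]
    · refine Pulls.rotate (Pulls.rotate (Pulls.rotate (up _ _ _ _ _ ?_)))
      rw [← h]
      cases r <;> simp [CGen.toBox, turnsCounter]
    · exact up _ _ _ _ _ h
  | _ => simp [CGen.toBox] at h

/-- A tangle without lower ends may be moved from the left of the strands `L` to their right. -/
theorem move_right {S : List (Strand E)} {w : CWord E} (hw : Tangle [] w S)
    (L : List (Strand E)) :
    ∃ P, Pure P ∧ Tangle (S ++ L) P (L ++ S) ∧ Eqv L (L ++ S) (pad [] L w ++ P) (pad L [] w) := by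
  induction L with
  | nil => exact ⟨[], by simp, by simp, by simpa using Eqv.refl hw⟩
  | cons x L ih =>
    obtain ⟨P, hp, ht, e⟩ := ih
    have t1 : Tangle (S ++ x :: L) (pad [] L (bwd x S)) (x :: (S ++ L)) := by
      simpa using (tangle_bwd x S).padded [] L
    have t2 : Tangle (x :: (S ++ L)) (pad [x] [] P) (x :: (L ++ S)) := by
      simpa using ht.padded [x] []
    refine ⟨pad [] L (bwd x S) ++ pad [x] [] P, by simp [hp], t1.append t2, ?_⟩
    have e1 := ((bwd_natural x hw).symm.padded [] L).append_right (by simpa using t2)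
    have e2 := e.padded [x] []
    simp at e1 e2 ⊢
    exact e1.trans e2

/-- The ends of the crossings `bs`, lined up from right to left. -/
def boxEnds : List (Box E) → List (Strand E)
  | [] => []
  | b :: bs => boxEnds bs ++ b.ends

/-- The crossings `bs`, lined up from right to left, with their ends bent upwards. -/
def front : List (Box E) → CWord E
  | [] => []
  | b :: bs => b.state ++ pad [] b.ends (front bs)

theorem tangle_front (bs : List (Box E)) : Tangle [] (front bs) (boxEnds bs) := by
  induction bs with
  | nil => simp [front, boxEnds]
  | cons b bs ih => exact b.tangle_state.append (by simpa [boxEnds] using ih.padded [] b.ends)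

/-- The classical crossings of a tangle may be moved to the bottom. -/
theorem pull_boxes {A B : List (Strand E)} {w : CWord E} (h : Tangle A w B) :
    ∃ M, Pure M ∧ Tangle (boxEnds (boxes w) ++ A) M B ∧
      Eqv A B w (pad [] A (front (boxes w)) ++ M) := by
  induction w generalizing A with
  | nil => exact ⟨[], by simp, h, by simpa [front] using Eqv.refl h⟩
  | cons s w ih =>
    obtain ⟨rfl, h⟩ := h
    obtain ⟨M, hp, ht, e⟩ := ih h
    have e0 := e.append_left (u := [s]) (A := s.dom) (by simp)
    cases hb : s.gen.toBox with
    | none =>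
      have hs : s.gen.IsPure := by
        cases hg : s.gen <;> simp_all [CGen.toBox]
      have hb' : boxes (s :: w) = boxes w := by simp [boxes, hb]
      rw [hb']
      have e1 := (exchange_words (tangle_front (boxes w)) (v := [s]) (C := s.dom) (D := s.cod)
        (by simp)).symm.append_right ht
      refine ⟨s.pad (boxEnds (boxes w)) [] :: M, by simp [hp, hs],
        ⟨by simp [CSlice.dom, CSlice.pad],
        by simpa [CSlice.cod, CSlice.pad] using ht⟩, ?_⟩
      have h0 : s.pad [] [] = s := by simp [CSlice.pad]
      simp [h0] at e0 e1 ⊢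
      exact e0.trans e1
    | some b =>
      have hb' : boxes (s :: w) = b :: boxes w := by simp [boxes, hb]
      rw [hb']
      obtain ⟨P, hP, tP, eP⟩ := pulls_of_toBox hb
      obtain ⟨P', hP', tP', eP'⟩ := move_right b.tangle_state s.left
      obtain ⟨l, g, r⟩ := s
      simp only [CSlice.dom_mk, CSlice.cod_mk] at *
      -- the part of the slice above the crossing
      obtain ⟨Q, hQ⟩ : ∃ Q, Q = pad [] (g.dom ++ r) P' ++ pad l r P := ⟨_, rfl⟩
      have tQ : Tangle (b.ends ++ (l ++ (g.dom ++ r))) Q (l ++ (g.cod ++ r)) := by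
        rw [hQ]
        exact Tangle.append (by simpa using tP'.padded [] (g.dom ++ r))
          (by simpa using tP.padded l r)
      have e1 : Eqv (l ++ (g.dom ++ r)) (l ++ (g.cod ++ r)) [⟨l, g, r⟩]
          (pad [] (l ++ (g.dom ++ r)) b.state ++ Q) := by
        have a1 := eP.padded l r
        have a2 := (eP'.padded [] (g.dom ++ r)).symm.append_right (v := pad l r P)
          (C := l ++ (g.cod ++ r)) (by simpa using tP.padded l r)
        simp [hQ] at a1 a2 ⊢
        exact a1.trans a2
      have e2 := e1.append_right (by simpa using e.right)
      have e3 := Eqv.context (A := l ++ (g.dom ++ r)) (u := pad [] (l ++ (g.dom ++ r)) b.state)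
        (by simpa using b.tangle_state.padded [] (l ++ (g.dom ++ r)))
        (exchange_words (tangle_front (boxes w)) tQ).symm ht
      have tM : Tangle (boxEnds (boxes w) ++ (b.ends ++ (l ++ (g.dom ++ r))))
          (pad (boxEnds (boxes w)) [] Q) (boxEnds (boxes w) ++ (l ++ (g.cod ++ r))) := by
        simpa using tQ.padded (boxEnds (boxes w)) []
      refine ⟨pad (boxEnds (boxes w)) [] Q ++ M, by simp [hQ, hP, hP', hp],
        by simpa [boxEnds] using tM.append ht, ?_⟩
      simp [front] at e0 e2 e3 ⊢
      exact e0.trans (e2.trans e3)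

/-- The crossings at the bottom may be put into any order. -/
theorem front_perm {bs cs : List (Box E)} (h : bs.Perm cs) :
    ∃ P, Pure P ∧ Tangle (boxEnds bs) P (boxEnds cs) ∧
      Eqv [] (boxEnds cs) (front bs ++ P) (front cs) := by
  induction h with
  | nil => exact ⟨[], by simp, by simp, Eqv.refl (by simp [front, boxEnds])⟩
  | @cons b bs cs _ ih =>
    obtain ⟨P, hp, ht, e⟩ := ih
    refine ⟨pad [] b.ends P, by simpa, by simpa [boxEnds] using ht.padded [] b.ends, ?_⟩
    simpa [front, boxEnds] using (e.padded [] b.ends).append_left b.tangle_state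
  | swap b c bs =>
    obtain ⟨P, hp, ht, e⟩ := move_right b.tangle_state c.ends
    have tF : Tangle (c.ends ++ b.ends) (pad [] (c.ends ++ b.ends) (front bs))
        (boxEnds bs ++ (c.ends ++ b.ends)) := by
      simpa using (tangle_front bs).padded [] (c.ends ++ b.ends)
    refine ⟨pad (boxEnds bs) [] P, by simpa, by simpa [boxEnds] using ht.padded (boxEnds bs) [], ?_⟩
    have e1 := (exchange_words (tangle_front bs) ht).append_left (A := [])
      (u := c.state ++ pad [] c.ends b.state)
      (c.tangle_state.append (by simpa using b.tangle_state.padded [] c.ends))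
    have e2 := Eqv.context c.tangle_state e tF
    have e3 := (exchange_words c.tangle_state b.tangle_state).append_right tF
    simp [front, boxEnds] at e1 e2 e3 ⊢
    exact e1.trans (e2.trans e3)
  | trans _ _ ih ih' =>
    obtain ⟨P, hp, ht, e⟩ := ih
    obtain ⟨P', hp', ht', e'⟩ := ih'
    refine ⟨P ++ P', by simp [hp, hp'], ht.append ht', ?_⟩
    simpa using (List.append_assoc _ _ _ ▸ e.append_right ht').trans e'

/-- Two coloured link diagrams with the same classical crossings, all of whose ends are distinct,
differ only by closed circles. -/
theorem eqv_of_boxes {w₁ w₂ : CWord E} (h₁ : Tangle [] w₁ []) (h₂ : Tangle [] w₂ [])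
    (hp : (boxes w₁).Perm (boxes w₂)) (hd : (boxEnds (boxes w₁)).Nodup) :
    ∃ N l₁ l₂, (∀ s ∈ N, s.gen.IsCupless) ∧
      Eqv [] [] w₁ (front (boxes w₁) ++ N ++ circles l₁) ∧
      Eqv [] [] w₂ (front (boxes w₁) ++ N ++ circles l₂) := by
  obtain ⟨M₁, p₁, t₁, e₁⟩ := pull_boxes h₁
  obtain ⟨M₂, p₂, t₂, e₂⟩ := pull_boxes h₂
  obtain ⟨P, p, t, e⟩ := front_perm hp
  simp only [List.append_nil, pad_nil_nil] at t₁ t₂ e₁ e₂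
  obtain ⟨N, l₁, l₂, hN, f₁, f₂⟩ := pure_unique _ _ le_rfl hd M₁ (P ++ M₂) p₁ (by simp [p, p₂]) t₁
    (t.append t₂)
  refine ⟨N, l₁, l₂, hN, ?_, ?_⟩
  · simpa using e₁.trans (f₁.append_left (tangle_front _))
  · have := (e.append_right t₂).symm
    simp only [List.append_assoc] at this ⊢
    exact e₂.trans (this.trans (f₂.append_left (tangle_front _)))

variable {F : Type}

/-! ### Invariants of moves: crossings, colours and recolourings -/

@[simp] theorem boxes_append (u v : CWord E) : boxes (u ++ v) = boxes u ++ boxes v := by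
  simp [boxes]

@[simp] theorem boxes_pad (L R : List (Strand E)) (w : CWord E) : boxes (pad L R w) = boxes w := by
  simp [boxes, pad, List.filterMap_map, Function.comp_def]

theorem CMove.boxes_perm {m m' : CWord E} (h : CMove m m') : (boxes m).Perm (boxes m') := by
  cases h with
  | exchange g h M =>
    simp only [boxes, List.filterMap_cons, List.filterMap_nil]
    cases g.toBox <;> cases h.toBox <;> simp
    exact .swap _ _ _
  | rotate r x y e f =>
    have := toBox_rotate r x y e f
    simp only [boxes, List.filterMap_cons, List.filterMap_nil, this]
    simp [CGen.toBox]
  | _ => simp [boxes, CGen.toBox]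

/-- Moves do not change the classical crossings, as `CMove` contains no move in which classical
crossings appear or vanish. -/
theorem Eqv.boxes_perm {A B : List (Strand E)} {w w' : CWord E} (h : Eqv A B w w') :
    (boxes w).Perm (boxes w') := by
  obtain ⟨-, -, h⟩ := h
  induction h with
  | rel _ _ h =>
    obtain ⟨-, -, u, v, m, m', L, R, hm, rfl, rfl⟩ := h
    simpa using (hm.boxes_perm.append_left (boxes u)).append_right (boxes v)
  | refl => exact .refl _
  | symm _ _ _ ih => exact ih.symm
  | trans _ _ _ _ _ ih ih' => exact ih.trans ih'

theorem HasColour.append_iff {A B : List (Strand E)} {u v : CWord E} {e : E} (h : Tangle A u B) :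
    HasColour A (u ++ v) e ↔ HasColour A u e ∨ HasColour B v e := by
  induction u generalizing A with
  | nil =>
    obtain rfl := h
    simp only [List.nil_append, HasColour]
    simp
  | cons s u ih =>
    obtain ⟨rfl, h⟩ := h
    have := ih h
    have key : ∀ w : CWord E, HasColour s.dom (s :: w) e ↔
        Occurs e s.dom ∨ HasColour s.cod w e := by
      intro w
      simp [HasColour]
    rw [List.cons_append, key, key, this, or_assoc]

theorem HasColour.pad_iff {A L R : List (Strand E)} {w : CWord E} {e : E} :
    HasColour (L ++ (A ++ R)) (pad L R w) e ↔ Occurs e L ∨ Occurs e R ∨ HasColour A w e := by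
  have key : ∀ s : CSlice E, Occurs e (s.pad L R).cod ↔
      Occurs e L ∨ Occurs e R ∨ Occurs e s.cod := by
    intro s
    simp only [CSlice.cod, CSlice.pad, occurs_append]
    tauto
  simp only [HasColour, pad, List.mem_map, exists_exists_and_eq_and, key, occurs_append]
  constructor
  · rintro ((h | h | h) | ⟨s, hs, h | h | h⟩)
    · exact .inl h
    · exact .inr (.inr (.inl h))
    · exact .inr (.inl h)
    · exact .inl h
    · exact .inr (.inl h)
    · exact .inr (.inr (.inr ⟨s, hs, h⟩))
  · rintro (h | h | h | ⟨s, hs, h⟩)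
    · exact .inl (.inl h)
    · exact .inl (.inr (.inr h))
    · exact .inl (.inr (.inl h))
    · exact .inr ⟨s, hs, .inr (.inr h)⟩

theorem CMove.exists_tangle {m m' : CWord E} (h : CMove m m') :
    m ≠ [] ∧ ∃ A B, Tangle A m B ∧ Tangle A m' B := by
  refine ⟨by cases h <;> simp, ?_⟩
  cases h with
  | exchange g h M => exact ⟨g.dom ++ (M ++ h.dom), g.cod ++ (M ++ h.cod), by simp, by simp⟩
  | zigzagRight x => exact ⟨[x], [x], by simp, by simp⟩
  | zigzagLeft x => exact ⟨[x], [x], by simp, by simp⟩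
  | slideCap x y => exact ⟨[x, y, dual x], [y], by simp, by simp⟩
  | slideCup x y => exact ⟨[y], [x, y, dual x], by simp, by simp⟩
  | rotate r x y e f =>
    exact ⟨[x, y, (!x.1, e)], [(y.1, f)], by simp [dual], by simp [dual]⟩
  | curlCap x => exact ⟨[x, dual x], [], by simp, by simp⟩
  | curlCup x => exact ⟨[], [dual x, x], by simp, by simp⟩
  | bigon x y => exact ⟨[x, y], [x, y], by simp, by simp⟩
  | triangle x y z => exact ⟨[x, y, z], [z, y, x], by simp, by simp⟩
  | triangleBox x r y z e f => exact ⟨[x, y, z], [(z.1, f), (y.1, e), x], by simp, by simp⟩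

theorem Tangle.dom_unique {A B C D : List (Strand E)} {w : CWord E} (hw : w ≠ [])
    (h : Tangle A w B) (h' : Tangle C w D) : A = C := by
  cases w with
  | nil => exact absurd rfl hw
  | cons s w => exact h.1.trans h'.1.symm

theorem CMove.hasColour_iff {m m' : CWord E} (h : CMove m m') {A B : List (Strand E)} {e : E}
    (hm : Tangle A m B) : HasColour A m e ↔ HasColour A m' e := by
  cases h <;>
    (obtain ⟨rfl, -⟩ := hm
     simp [HasColour, dual]
     try tauto)

/-- The lower and upper ends between which a move takes place inside a tangle. -/
theorem CStep.exists_ends {A B : List (Strand E)} {w w' : CWord E} (h : CStep A B w w') :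
    ∃ (u v m m' : CWord E) (L R C D : List (Strand E)), CMove m m' ∧ w = u ++ (pad L R m ++ v) ∧
      w' = u ++ (pad L R m' ++ v) ∧ Tangle A u (L ++ (C ++ R)) ∧ Tangle C m D ∧ Tangle C m' D ∧
      Tangle (L ++ (D ++ R)) v B := by
  obtain ⟨hw, -, u, v, m, m', L, R, hm, rfl, rfl⟩ := h
  obtain ⟨hn, C, D, h1, h2⟩ := hm.exists_tangle
  obtain ⟨C', t1, t2⟩ := tangle_append.1 (List.append_assoc u _ v ▸ hw)
  obtain ⟨D', t2, t3⟩ := tangle_append.1 t2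
  obtain rfl := Tangle.dom_unique (by simpa [pad] using hn) t2 (h1.padded L R)
  obtain rfl := Tangle.det t2 (h1.padded L R)
  exact ⟨u, v, m, m', L, R, C, D, hm, by simp, by simp, t1, h1, h2, t3⟩

/-- Moves do not change the set of colours that occur in a tangle. -/
theorem Eqv.hasColour_iff {A B : List (Strand E)} {w w' : CWord E} (h : Eqv A B w w') (e : E) :
    HasColour A w e ↔ HasColour A w' e := by
  obtain ⟨-, -, h⟩ := h
  induction h with
  | rel _ _ h =>
    obtain ⟨u, v, m, m', L, R, C, D, hm, rfl, rfl, t1, t2, t3, t4⟩ := h.exists_ends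
    rw [HasColour.append_iff t1, HasColour.append_iff t1, HasColour.append_iff (t2.padded L R),
      HasColour.append_iff (t3.padded L R), HasColour.pad_iff, HasColour.pad_iff,
      hm.hasColour_iff t2]
  | refl => exact .rfl
  | symm _ _ _ ih => exact ih.symm
  | trans _ _ _ _ _ ih ih' => exact ih.trans ih'

/-! ### Changing colours -/

/-- Apply a map of colours to a strand. -/
def Strand.map (φ : F → E) (x : Strand F) : Strand E := (x.1, φ x.2)

theorem Strand.map_dual (φ : F → E) (x : Strand F) :
    Strand.map φ (dual x) = dual (Strand.map φ x) := rfl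

/-- Apply a map of colours to a piece. -/
def CGen.map (φ : F → E) : CGen F → CGen E
  | .cup x => .cup (Strand.map φ x)
  | .cap x => .cap (Strand.map φ x)
  | .virt x y => .virt (Strand.map φ x) (Strand.map φ y)
  | .box r x y e f => .box r (Strand.map φ x) (Strand.map φ y) (φ e) (φ f)

/-- Apply a map of colours to a slice. -/
def CSlice.map (φ : F → E) (s : CSlice F) : CSlice E :=
  ⟨s.left.map (Strand.map φ), s.gen.map φ, s.right.map (Strand.map φ)⟩

/-- Apply a map of colours to a tangle. -/
def recolour (φ : F → E) (w : CWord F) : CWord E := w.map (CSlice.map φ)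

section map
variable (φ : F → E)

theorem CGen.map_dom (g : CGen F) : (g.map φ).dom = g.dom.map (Strand.map φ) := by
  cases g <;> simp [CGen.map, Strand.map_dual]

theorem CGen.map_cod (g : CGen F) : (g.map φ).cod = g.cod.map (Strand.map φ) := by
  cases g <;> simp [CGen.map, Strand.map_dual]
  simp [Strand.map]

theorem CSlice.map_dom (s : CSlice F) : (s.map φ).dom = s.dom.map (Strand.map φ) := by
  simp [CSlice.dom, CSlice.map, CGen.map_dom]

theorem CSlice.map_cod (s : CSlice F) : (s.map φ).cod = s.cod.map (Strand.map φ) := by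
  simp [CSlice.cod, CSlice.map, CGen.map_cod]

theorem Tangle.recolour {A B : List (Strand F)} {w : CWord F} (h : Tangle A w B) :
    Tangle (A.map (Strand.map φ)) (recolour φ w) (B.map (Strand.map φ)) := by
  induction w generalizing A with
  | nil => exact congrArg _ h
  | cons s w ih =>
    obtain ⟨rfl, h⟩ := h
    exact ⟨(CSlice.map_dom φ s).symm, by rw [CSlice.map_cod]; exact ih h⟩

theorem recolour_append (u v : CWord F) : recolour φ (u ++ v) = recolour φ u ++ recolour φ v := by
  simp [recolour]

theorem recolour_pad (L R : List (Strand F)) (w : CWord F) :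
    recolour φ (pad L R w) = pad (L.map (Strand.map φ)) (R.map (Strand.map φ)) (recolour φ w) := by
  simp [recolour, pad, CSlice.map, CSlice.pad]

variable {φ}

theorem recolour_eq_cons {w : CWord F} {s : CSlice E} {v : CWord E} (h : recolour φ w = s :: v) :
    ∃ l g r w', w = ⟨l, g, r⟩ :: w' ∧ l.map (Strand.map φ) = s.left ∧ g.map φ = s.gen ∧
      r.map (Strand.map φ) = s.right ∧ recolour φ w' = v := by
  cases w with
  | nil => simp [recolour] at h
  | cons t w =>
    obtain ⟨l, g, r⟩ := t
    simp only [recolour, List.map_cons, List.cons.injEq] at h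
    exact ⟨l, g, r, w, rfl, by rw [← h.1]; rfl, by rw [← h.1]; rfl, by rw [← h.1]; rfl, h.2⟩

theorem recolour_eq_nil {w : CWord F} (h : recolour φ w = []) : w = [] := by
  simpa [recolour] using h

variable {w : CWord F} {v : CWord E} {L R : List (Strand E)} {x y : Strand E} {e f : E}

theorem recolour_eq_cup (h : recolour φ w = ⟨L, .cup x, R⟩ :: v) :
    ∃ l x' r w', w = ⟨l, .cup x', r⟩ :: w' ∧ l.map (Strand.map φ) = L ∧
      r.map (Strand.map φ) = R ∧ Strand.map φ x' = x ∧ recolour φ w' = v := by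
  obtain ⟨l, g, r, w', rfl, h1, h2, h3, h4⟩ := recolour_eq_cons h
  cases g <;> simp only [CGen.map, CGen.cup.injEq, reduceCtorEq] at h2
  exact ⟨_, _, _, _, rfl, h1, h3, h2, h4⟩

theorem recolour_eq_cap (h : recolour φ w = ⟨L, .cap x, R⟩ :: v) :
    ∃ l x' r w', w = ⟨l, .cap x', r⟩ :: w' ∧ l.map (Strand.map φ) = L ∧
      r.map (Strand.map φ) = R ∧ Strand.map φ x' = x ∧ recolour φ w' = v := by
  obtain ⟨l, g, r, w', rfl, h1, h2, h3, h4⟩ := recolour_eq_cons h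
  cases g <;> simp only [CGen.map, CGen.cap.injEq, reduceCtorEq] at h2
  exact ⟨_, _, _, _, rfl, h1, h3, h2, h4⟩

theorem recolour_eq_virt (h : recolour φ w = ⟨L, .virt x y, R⟩ :: v) :
    ∃ l x' y' r w', w = ⟨l, .virt x' y', r⟩ :: w' ∧ l.map (Strand.map φ) = L ∧
      r.map (Strand.map φ) = R ∧ Strand.map φ x' = x ∧ Strand.map φ y' = y ∧
      recolour φ w' = v := by
  obtain ⟨l, g, r, w', rfl, h1, h2, h3, h4⟩ := recolour_eq_cons h
  cases g <;> simp only [CGen.map, CGen.virt.injEq, reduceCtorEq] at h2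
  exact ⟨_, _, _, _, _, rfl, h1, h3, h2.1, h2.2, h4⟩

theorem recolour_eq_box {b : Bool} (h : recolour φ w = ⟨L, .box b x y e f, R⟩ :: v) :
    ∃ l x' y' e' f' r w', w = ⟨l, .box b x' y' e' f', r⟩ :: w' ∧ l.map (Strand.map φ) = L ∧
      r.map (Strand.map φ) = R ∧ Strand.map φ x' = x ∧ Strand.map φ y' = y ∧ φ e' = e ∧
      φ f' = f ∧ recolour φ w' = v := by
  obtain ⟨l, g, r, w', rfl, h1, h2, h3, h4⟩ := recolour_eq_cons h
  cases g <;> simp only [CGen.map, CGen.box.injEq, reduceCtorEq] at h2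
  obtain ⟨rfl, h2⟩ := h2
  exact ⟨_, _, _, _, _, _, _, rfl, h1, h3, h2.1, h2.2.1, h2.2.2.1, h2.2.2.2, h4⟩

theorem map_eq_singleton {l : List (Strand F)} (h : l.map (Strand.map φ) = [x]) :
    ∃ x', l = [x'] ∧ Strand.map φ x' = x := by
  obtain ⟨x', l, rfl, h1, h2⟩ := List.map_eq_cons_iff.1 h
  exact ⟨x', by simpa using h2, h1⟩

theorem map_eq_nil {l : List (Strand F)} (h : l.map (Strand.map φ) = []) : l = [] := by
  simpa using h

end map

/-- Colourings of one side of a move can be carried over to the other side: every coloured tangle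
`M` that becomes `m` under `φ` is related by a move to one that becomes `m'`. -/
def Lifts (φ : F → E) (m m' : CWord E) (A : List (Strand E)) : Prop :=
  ∀ A' B' M, recolour φ M = m → A'.map (Strand.map φ) = A → Tangle A' M B' →
    ∃ M', recolour φ M' = m' ∧ Tangle A' M' B' ∧ (CMove M M' ∨ CMove M' M)

theorem CMove.lifts (φ : F → E) {m m' : CWord E} (h : CMove m m') {A B : List (Strand E)}
    (hm : Tangle A m B) : Lifts φ m m' A ∧ Lifts φ m' m A := by
  cases h with
  | exchange g h N =>
    constructor
    · intro A' B' M hM hA hT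
      obtain ⟨l, g', r, M, rfl, hl, rfl, hr, hM⟩ := recolour_eq_cons hM
      obtain ⟨l', h', r', M, rfl, hl', rfl, hr', hM⟩ := recolour_eq_cons hM
      obtain rfl := recolour_eq_nil hM
      obtain rfl := map_eq_nil hl
      obtain rfl := map_eq_nil hr'
      obtain ⟨X, Y, rfl, rfl, hY⟩ := List.map_eq_append_iff.1 hr
      simp only [tangle_cons, tangle_nil, CSlice.dom_mk, CSlice.cod_mk, List.nil_append,
        List.append_nil] at hT
      obtain ⟨rfl, hT, rfl⟩ := hT
      rw [← List.append_assoc] at hT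
      obtain ⟨rfl, rfl⟩ := List.append_inj' hT
        (by simpa [CGen.map_dom] using congrArg List.length hY)
      exact ⟨_, by simp [recolour, CSlice.map, CGen.map_dom, CGen.map_cod], by simp,
        .inl (.exchange g' h' X)⟩
    · intro A' B' M hM hA hT
      obtain ⟨l, h', r, M, rfl, hl, rfl, hr, hM⟩ := recolour_eq_cons hM
      obtain ⟨l', g', r', M, rfl, hl', rfl, hr', hM⟩ := recolour_eq_cons hM
      obtain rfl := recolour_eq_nil hM
      obtain rfl := map_eq_nil hl'
      obtain rfl := map_eq_nil hr
      obtain ⟨X, Y, rfl, rfl, hY⟩ := List.map_eq_append_iff.1 hr'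
      simp only [tangle_cons, tangle_nil, CSlice.dom_mk, CSlice.cod_mk, List.nil_append,
        List.append_nil] at hT
      obtain ⟨rfl, hT, rfl⟩ := hT
      rw [← List.append_assoc] at hT
      obtain ⟨rfl, rfl⟩ := List.append_inj' hT
        (by simpa [CGen.map_cod] using (congrArg List.length hY).symm)
      exact ⟨_, by simp [recolour, CSlice.map, CGen.map_dom, CGen.map_cod], by simp,
        .inr (.exchange g' h' X)⟩
  | zigzagRight x =>
    constructor
    · intro A' B' M hM hA hT
      obtain ⟨l0, x0, r0, M, rfl, hl0, hr0, p0, hM⟩ := recolour_eq_cup hM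
      obtain ⟨l1, x1, r1, M, rfl, hl1, hr1, p1, hM⟩ := recolour_eq_cap hM
      obtain rfl := recolour_eq_nil hM
      obtain ⟨l0, rfl, ul0⟩ := map_eq_singleton hl0
      obtain rfl := map_eq_nil hr0
      obtain rfl := map_eq_nil hl1
      obtain ⟨r1, rfl, ur1⟩ := map_eq_singleton hr1
      simp at hT
      casesm* _ ∧ _
      subst_vars
      simp only [dual_dual]
      exact ⟨_, by simp [recolour, *], by simp, .inl (.zigzagRight _)⟩
    · intro A' B' M hM hA hT
      obtain rfl := recolour_eq_nil hM
      obtain rfl := hT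
      obtain rfl := hm.1
      obtain ⟨x', rfl, rfl⟩ := map_eq_singleton hA
      exact ⟨_, by simp [recolour, CSlice.map, CGen.map, Strand.map_dual], by simp,
        .inr (.zigzagRight x')⟩
  | zigzagLeft x =>
    constructor
    · intro A' B' M hM hA hT
      obtain ⟨l0, x0, r0, M, rfl, hl0, hr0, p0, hM⟩ := recolour_eq_cup hM
      obtain ⟨l1, x1, r1, M, rfl, hl1, hr1, p1, hM⟩ := recolour_eq_cap hM
      obtain rfl := recolour_eq_nil hM
      obtain rfl := map_eq_nil hl0
      obtain ⟨r0, rfl, ur0⟩ := map_eq_singleton hr0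
      obtain ⟨l1, rfl, ul1⟩ := map_eq_singleton hl1
      obtain rfl := map_eq_nil hr1
      simp at hT
      casesm* _ ∧ _
      subst_vars
      simp only [dual_dual]
      exact ⟨_, by simp [recolour, *], by simp, .inl (.zigzagLeft _)⟩
    · intro A' B' M hM hA hT
      obtain rfl := recolour_eq_nil hM
      obtain rfl := hT
      obtain rfl := hm.1
      obtain ⟨x', rfl, rfl⟩ := map_eq_singleton hA
      exact ⟨_, by simp [recolour, CSlice.map, CGen.map, Strand.map_dual], by simp,
        .inr (.zigzagLeft x')⟩
  | slideCap x y =>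
    constructor
    · intro A' B' M hM hA hT
      obtain ⟨l0, x0, y0, r0, M, rfl, hl0, hr0, p0, q0, hM⟩ := recolour_eq_virt hM
      obtain ⟨l1, x1, r1, M, rfl, hl1, hr1, p1, hM⟩ := recolour_eq_cap hM
      obtain rfl := recolour_eq_nil hM
      obtain rfl := map_eq_nil hl0
      obtain ⟨r0, rfl, ur0⟩ := map_eq_singleton hr0
      obtain ⟨l1, rfl, ul1⟩ := map_eq_singleton hl1
      obtain rfl := map_eq_nil hr1
      simp at hT
      casesm* _ ∧ _
      subst_vars
      exact ⟨_, by simp [recolour, CSlice.map, CGen.map, *], by simp, .inl (.slideCap ..)⟩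
    · intro A' B' M hM hA hT
      obtain ⟨l0, x0, y0, r0, M, rfl, hl0, hr0, p0, q0, hM⟩ := recolour_eq_virt hM
      obtain ⟨l1, x1, r1, M, rfl, hl1, hr1, p1, hM⟩ := recolour_eq_cap hM
      obtain rfl := recolour_eq_nil hM
      obtain ⟨l0, rfl, ul0⟩ := map_eq_singleton hl0
      obtain rfl := map_eq_nil hr0
      obtain rfl := map_eq_nil hl1
      obtain ⟨r1, rfl, ur1⟩ := map_eq_singleton hr1
      simp at hT
      casesm* _ ∧ _
      subst_vars
      exact ⟨_, by simp [recolour, CSlice.map, CGen.map, *], by simp, .inr (.slideCap ..)⟩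
  | slideCup x y =>
    constructor
    · intro A' B' M hM hA hT
      obtain ⟨l0, x0, r0, M, rfl, hl0, hr0, p0, hM⟩ := recolour_eq_cup hM
      obtain ⟨l1, x1, y1, r1, M, rfl, hl1, hr1, p1, q1, hM⟩ := recolour_eq_virt hM
      obtain rfl := recolour_eq_nil hM
      obtain ⟨l0, rfl, ul0⟩ := map_eq_singleton hl0
      obtain rfl := map_eq_nil hr0
      obtain rfl := map_eq_nil hl1
      obtain ⟨r1, rfl, ur1⟩ := map_eq_singleton hr1
      simp at hT
      casesm* _ ∧ _
      subst_vars
      exact ⟨_, by simp [recolour, CSlice.map, CGen.map, *], by simp, .inl (.slideCup ..)⟩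
    · intro A' B' M hM hA hT
      obtain ⟨l0, x0, r0, M, rfl, hl0, hr0, p0, hM⟩ := recolour_eq_cup hM
      obtain ⟨l1, x1, y1, r1, M, rfl, hl1, hr1, p1, q1, hM⟩ := recolour_eq_virt hM
      obtain rfl := recolour_eq_nil hM
      obtain rfl := map_eq_nil hl0
      obtain ⟨r0, rfl, ur0⟩ := map_eq_singleton hr0
      obtain ⟨l1, rfl, ul1⟩ := map_eq_singleton hl1
      obtain rfl := map_eq_nil hr1
      simp at hT
      casesm* _ ∧ _
      subst_vars
      exact ⟨_, by simp [recolour, CSlice.map, CGen.map, *], by simp, .inr (.slideCup ..)⟩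
  | rotate r x y e f =>
    constructor
    · intro A' B' M hM hA hT
      obtain ⟨l0, x0, y0, e0, f0, r0, M, rfl, hl0, hr0, p0, q0, s0, t0, hM⟩ := recolour_eq_box hM
      obtain ⟨l1, x1, r1, M, rfl, hl1, hr1, p1, hM⟩ := recolour_eq_cap hM
      obtain rfl := recolour_eq_nil hM
      obtain rfl := map_eq_nil hl0
      obtain ⟨r0, rfl, ur0⟩ := map_eq_singleton hr0
      obtain ⟨l1, rfl, ul1⟩ := map_eq_singleton hl1
      obtain rfl := map_eq_nil hr1
      simp at hT
      casesm* _ ∧ _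
      subst_vars
      exact ⟨_, by simp [recolour, CSlice.map, CGen.map, Strand.map], by simp [dual],
        .inl (.rotate ..)⟩
    · intro A' B' M hM hA hT
      obtain ⟨l0, x0, y0, e0, f0, r0, M, rfl, hl0, hr0, p0, q0, s0, t0, hM⟩ := recolour_eq_box hM
      obtain ⟨l1, x1, r1, M, rfl, hl1, hr1, p1, hM⟩ := recolour_eq_cap hM
      obtain rfl := recolour_eq_nil hM
      obtain ⟨l0, rfl, ul0⟩ := map_eq_singleton hl0
      obtain rfl := map_eq_nil hr0
      obtain rfl := map_eq_nil hl1
      obtain ⟨r1, rfl, ur1⟩ := map_eq_singleton hr1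
      simp at hT
      casesm* _ ∧ _
      subst_vars
      have hb : (y0.1, f0) = dual l0 := by assumption
      obtain ⟨a, c⟩ := l0
      obtain ⟨b, d⟩ := y0
      obtain ⟨rfl, rfl⟩ := Prod.mk.inj hb
      obtain rfl : φ d = e := congrArg Prod.snd q0
      exact ⟨_, by simp [recolour, CSlice.map, CGen.map, Strand.map], by simp [dual],
        .inr (.rotate r (a, f0) x0 d e0)⟩
  | curlCap x =>
    constructor
    · intro A' B' M hM hA hT
      obtain ⟨l0, x0, y0, r0, M, rfl, hl0, hr0, p0, q0, hM⟩ := recolour_eq_virt hM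
      obtain ⟨l1, x1, r1, M, rfl, hl1, hr1, p1, hM⟩ := recolour_eq_cap hM
      obtain rfl := recolour_eq_nil hM
      obtain rfl := map_eq_nil hl0
      obtain rfl := map_eq_nil hr0
      obtain rfl := map_eq_nil hl1
      obtain rfl := map_eq_nil hr1
      simp at hT
      casesm* _ ∧ _
      subst_vars
      exact ⟨[⟨[], .cap (dual x1), []⟩], by simp [recolour, CSlice.map, CGen.map, Strand.map_dual],
        by simp, .inl (by simpa using CMove.curlCap (dual x1))⟩
    · intro A' B' M hM hA hT
      obtain ⟨l0, x0, r0, M, rfl, hl0, hr0, p0, hM⟩ := recolour_eq_cap hM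
      obtain rfl := recolour_eq_nil hM
      obtain rfl := map_eq_nil hl0
      obtain rfl := map_eq_nil hr0
      simp at hT
      casesm* _ ∧ _
      subst_vars
      exact ⟨_, by simp [recolour, CSlice.map, CGen.map, Strand.map_dual, *], by simp,
        .inr (.curlCap _)⟩
  | curlCup x =>
    constructor
    · intro A' B' M hM hA hT
      obtain ⟨l0, x0, r0, M, rfl, hl0, hr0, p0, hM⟩ := recolour_eq_cup hM
      obtain ⟨l1, x1, y1, r1, M, rfl, hl1, hr1, p1, q1, hM⟩ := recolour_eq_virt hM
      obtain rfl := recolour_eq_nil hM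
      obtain rfl := map_eq_nil hl0
      obtain rfl := map_eq_nil hr0
      obtain rfl := map_eq_nil hl1
      obtain rfl := map_eq_nil hr1
      simp at hT
      casesm* _ ∧ _
      subst_vars
      exact ⟨_, by simp [recolour, CSlice.map, CGen.map, *], by simp, .inl (.curlCup _)⟩
    · intro A' B' M hM hA hT
      obtain ⟨l0, x0, r0, M, rfl, hl0, hr0, p0, hM⟩ := recolour_eq_cup hM
      obtain rfl := recolour_eq_nil hM
      obtain rfl := map_eq_nil hl0
      obtain rfl := map_eq_nil hr0
      simp at hT
      casesm* _ ∧ _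
      subst_vars
      obtain rfl : Strand.map φ (dual x0) = x := by rw [Strand.map_dual, p0, dual_dual]
      exact ⟨[⟨[], .cup (dual x0), []⟩, ⟨[], .virt (dual x0) x0, []⟩],
        by simp [recolour, CSlice.map, CGen.map, Strand.map_dual], by simp,
        .inr (by simpa using CMove.curlCup (dual x0))⟩
  | bigon x y =>
    constructor
    · intro A' B' M hM hA hT
      obtain ⟨l0, x0, y0, r0, M, rfl, hl0, hr0, p0, q0, hM⟩ := recolour_eq_virt hM
      obtain ⟨l1, x1, y1, r1, M, rfl, hl1, hr1, p1, q1, hM⟩ := recolour_eq_virt hM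
      obtain rfl := recolour_eq_nil hM
      obtain rfl := map_eq_nil hl0
      obtain rfl := map_eq_nil hr0
      obtain rfl := map_eq_nil hl1
      obtain rfl := map_eq_nil hr1
      simp at hT
      casesm* _ ∧ _
      subst_vars
      exact ⟨_, by simp [recolour, *], by simp, .inl (.bigon ..)⟩
    · intro A' B' M hM hA hT
      obtain rfl := recolour_eq_nil hM
      obtain rfl := hT
      obtain rfl := hm.1
      obtain ⟨x', l, rfl, rfl, hl⟩ := List.map_eq_cons_iff.1 hA
      obtain ⟨y', rfl, rfl⟩ := map_eq_singleton hl
      exact ⟨_, by simp [recolour, CSlice.map, CGen.map], by simp, .inr (.bigon x' y')⟩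
  | triangle x y z =>
    constructor
    · intro A' B' M hM hA hT
      obtain ⟨l0, x0, y0, r0, M, rfl, hl0, hr0, p0, q0, hM⟩ := recolour_eq_virt hM
      obtain ⟨l1, x1, y1, r1, M, rfl, hl1, hr1, p1, q1, hM⟩ := recolour_eq_virt hM
      obtain ⟨l2, x2, y2, r2, M, rfl, hl2, hr2, p2, q2, hM⟩ := recolour_eq_virt hM
      obtain rfl := recolour_eq_nil hM
      obtain rfl := map_eq_nil hl0
      obtain ⟨r0, rfl, ur0⟩ := map_eq_singleton hr0
      obtain ⟨l1, rfl, ul1⟩ := map_eq_singleton hl1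
      obtain rfl := map_eq_nil hr1
      obtain rfl := map_eq_nil hl2
      obtain ⟨r2, rfl, ur2⟩ := map_eq_singleton hr2
      simp at hT
      casesm* _ ∧ _
      subst_vars
      exact ⟨_, by simp [recolour, CSlice.map, CGen.map, *], by simp, .inl (.triangle ..)⟩
    · intro A' B' M hM hA hT
      obtain ⟨l0, x0, y0, r0, M, rfl, hl0, hr0, p0, q0, hM⟩ := recolour_eq_virt hM
      obtain ⟨l1, x1, y1, r1, M, rfl, hl1, hr1, p1, q1, hM⟩ := recolour_eq_virt hM
      obtain ⟨l2, x2, y2, r2, M, rfl, hl2, hr2, p2, q2, hM⟩ := recolour_eq_virt hM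
      obtain rfl := recolour_eq_nil hM
      obtain ⟨l0, rfl, ul0⟩ := map_eq_singleton hl0
      obtain rfl := map_eq_nil hr0
      obtain rfl := map_eq_nil hl1
      obtain ⟨r1, rfl, ur1⟩ := map_eq_singleton hr1
      obtain ⟨l2, rfl, ul2⟩ := map_eq_singleton hl2
      obtain rfl := map_eq_nil hr2
      simp at hT
      casesm* _ ∧ _
      subst_vars
      exact ⟨_, by simp [recolour, CSlice.map, CGen.map, *], by simp, .inr (.triangle ..)⟩
  | triangleBox x r y z e f =>
    constructor
    · intro A' B' M hM hA hT
      obtain ⟨l0, x0, y0, r0, M, rfl, hl0, hr0, p0, q0, hM⟩ := recolour_eq_virt hM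
      obtain ⟨l1, x1, y1, r1, M, rfl, hl1, hr1, p1, q1, hM⟩ := recolour_eq_virt hM
      obtain ⟨l2, x2, y2, e2, f2, r2, M, rfl, hl2, hr2, p2, q2, s2, t2, hM⟩ := recolour_eq_box hM
      obtain rfl := recolour_eq_nil hM
      obtain rfl := map_eq_nil hl0
      obtain ⟨r0, rfl, ur0⟩ := map_eq_singleton hr0
      obtain ⟨l1, rfl, ul1⟩ := map_eq_singleton hl1
      obtain rfl := map_eq_nil hr1
      obtain rfl := map_eq_nil hl2
      obtain ⟨r2, rfl, ur2⟩ := map_eq_singleton hr2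
      simp at hT
      casesm* _ ∧ _
      subst_vars
      exact ⟨_, by simp [recolour, CSlice.map, CGen.map, Strand.map], by simp,
        .inl (.triangleBox ..)⟩
    · intro A' B' M hM hA hT
      obtain ⟨l0, x0, y0, e0, f0, r0, M, rfl, hl0, hr0, p0, q0, s0, t0, hM⟩ := recolour_eq_box hM
      obtain ⟨l1, x1, y1, r1, M, rfl, hl1, hr1, p1, q1, hM⟩ := recolour_eq_virt hM
      obtain ⟨l2, x2, y2, r2, M, rfl, hl2, hr2, p2, q2, hM⟩ := recolour_eq_virt hM
      obtain rfl := recolour_eq_nil hM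
      obtain ⟨l0, rfl, ul0⟩ := map_eq_singleton hl0
      obtain rfl := map_eq_nil hr0
      obtain rfl := map_eq_nil hl1
      obtain ⟨r1, rfl, ur1⟩ := map_eq_singleton hr1
      obtain ⟨l2, rfl, ul2⟩ := map_eq_singleton hl2
      obtain rfl := map_eq_nil hr2
      simp at hT
      casesm* _ ∧ _
      subst_vars
      exact ⟨_, by simp [recolour, CSlice.map, CGen.map, Strand.map], by simp,
        .inr (.triangleBox ..)⟩

/-- If a coloured tangle becomes a tangle between vertical strands under `φ`, then it is itself a
tangle between vertical strands. -/
theorem unpad {φ : F → E} {L' R' : List (Strand F)} {m : CWord E} :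
    ∀ {M : CWord F} {A B : List (Strand F)},
      recolour φ M = pad (L'.map (Strand.map φ)) (R'.map (Strand.map φ)) m →
      Tangle (L' ++ (A ++ R')) M B →
      ∃ M' C, M = pad L' R' M' ∧ B = L' ++ (C ++ R') ∧ recolour φ M' = m ∧ Tangle A M' C := by
  induction m with
  | nil =>
    intro M A B h hT
    obtain rfl := recolour_eq_nil h
    exact ⟨[], A, rfl, hT.symm, rfl, rfl⟩
  | cons s m ih =>
    intro M A B h hT
    obtain ⟨l, g, r, M, rfl, hl, hg, hr, hM⟩ := recolour_eq_cons h
    obtain ⟨l₁, l₂, rfl, hl₁, hl₂⟩ := List.map_eq_append_iff.1 hl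
    obtain ⟨r₂, r₁, rfl, hr₂, hr₁⟩ := List.map_eq_append_iff.1 hr
    obtain ⟨h1, h2⟩ := hT
    simp only [CSlice.dom_mk, CSlice.cod_mk, List.append_assoc] at h1 h2
    obtain ⟨rfl, h3⟩ := List.append_inj h1 (by simpa using (congrArg List.length hl₁).symm)
    simp only [← List.append_assoc] at h3
    obtain ⟨rfl, rfl⟩ := List.append_inj' h3 (by simpa using (congrArg List.length hr₁).symm)
    obtain ⟨M', C, rfl, rfl, h4, h5⟩ := ih (A := l₂ ++ (g.cod ++ r₂)) hM (by simpa using h2)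
    refine ⟨⟨l₂, g, r₂⟩ :: M', C, by simp, rfl, ?_, by simp, h5⟩
    obtain ⟨sl, sg, sr⟩ := s
    simp only [recolour, List.map_cons, CSlice.map, List.cons.injEq] at h4 hl₂ hr₂ hg ⊢
    exact ⟨by rw [hl₂, hr₂, hg]; rfl, h4⟩

theorem Lifts.step {φ : F → E} {u v m m' : CWord E} {L R C : List (Strand E)}
    (h : Lifts φ m m' C) (hu : Tangle [] u (L ++ (C ++ R))) {W : CWord F}
    (hW : recolour φ W = u ++ (pad L R m ++ v)) (hT : Tangle [] W []) :
    ∃ W', recolour φ W' = u ++ (pad L R m' ++ v) ∧ Eqv [] [] W W' := by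
  obtain ⟨U, W, rfl, hU, hW⟩ := List.map_eq_append_iff.1 hW
  obtain ⟨M, V, rfl, hM, hV⟩ := List.map_eq_append_iff.1 hW
  obtain ⟨A, t1, t2⟩ := tangle_append.1 hT
  obtain ⟨B, t2, t3⟩ := tangle_append.1 t2
  have hA : A.map (Strand.map φ) = L ++ (C ++ R) := by
    have := t1.recolour φ
    rw [recolour, hU] at this
    exact this.det hu
  obtain ⟨L', A', rfl, rfl, hA'⟩ := List.map_eq_append_iff.1 hA
  obtain ⟨A, R', rfl, hA'', rfl⟩ := List.map_eq_append_iff.1 hA'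
  obtain ⟨M', D, rfl, rfl, h1, h2⟩ := unpad hM t2
  obtain ⟨M'', h3, h4, h5⟩ := h A D M' h1 hA'' h2
  refine ⟨U ++ (pad L' R' M'' ++ V), ?_, ?_⟩
  · rw [recolour_append, recolour_append, recolour_pad, h3]
    simp [recolour, hU, hV]
  · have : Eqv A D M' M'' := by
      rcases h5 with h5 | h5
      · exact .of_move h5 h2 h4
      · exact (Eqv.of_move h5 h4 h2).symm
    exact ((this.padded L' R').append_right t3).append_left t1

/-- Colourings can be carried over along a sequence of moves. -/
theorem Eqv.lift {φ : F → E} {w w' : CWord E} (h : Eqv [] [] w w') {W : CWord F}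
    (hW : recolour φ W = w) (hT : Tangle [] W []) :
    ∃ W', recolour φ W' = w' ∧ Eqv [] [] W W' := by
  obtain ⟨-, -, h⟩ := h
  suffices H : (∀ W, recolour φ W = w → Tangle [] W [] → ∃ W', recolour φ W' = w' ∧
      Eqv [] [] W W') ∧ (∀ W, recolour φ W = w' → Tangle [] W [] → ∃ W', recolour φ W' = w ∧
      Eqv [] [] W W') from H.1 W hW hT
  clear hW hT W
  induction h with
  | rel _ _ h =>
    obtain ⟨u, v, m, m', L, R, C, D, hm, rfl, rfl, t1, t2, t3, t4⟩ := h.exists_ends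
    exact ⟨fun W hW hT => (hm.lifts φ t2).1.step t1 hW hT,
      fun W hW hT => (hm.lifts φ t2).2.step t1 hW hT⟩
  | refl =>
    exact ⟨fun W hW hT => ⟨W, hW, Eqv.refl hT⟩, fun W hW hT => ⟨W, hW, Eqv.refl hT⟩⟩
  | symm _ _ _ ih => exact ⟨ih.2, ih.1⟩
  | trans _ _ _ _ _ ih ih' =>
    constructor
    · intro W hW hT
      obtain ⟨W', h1, h2⟩ := ih.1 W hW hT
      obtain ⟨W'', h3, h4⟩ := ih'.1 W' h1 h2.right
      exact ⟨W'', h3, h2.trans h4⟩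
    · intro W hW hT
      obtain ⟨W', h1, h2⟩ := ih'.2 W hW hT
      obtain ⟨W'', h3, h4⟩ := ih.2 W' h1 h2.right
      exact ⟨W'', h3, h2.trans h4⟩

/-! ### Arcs of a Gauss code -/

section Arcs

variable {α β : Type} (letter : α → Option β)

/-- The number of letters that are met before the `k`-th point of a tour. -/
def lettersBefore (l : List α) (k : ℕ) : ℕ := ((l.take k).filterMap letter).length

theorem lettersBefore_succ {l : List α} {k : ℕ} {p : α} (h : l[k]? = some p) :
    lettersBefore letter l (k + 1) = lettersBefore letter l k + (letter p).toList.length := by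
  rw [lettersBefore, lettersBefore, List.take_add_one, h]
  cases hp : letter p <;> simp [hp]

theorem lettersBefore_mono {l : List α} {k k' : ℕ} (h : k ≤ k') :
    lettersBefore letter l k ≤ lettersBefore letter l k' := by
  have : l.take k = (l.take k').take k := by rw [List.take_take, min_eq_left h]
  rw [lettersBefore, lettersBefore, this]
  exact ((List.take_sublist _ _).filterMap _).length_le

theorem getElem?_lettersBefore {l : List α} {k : ℕ} {p : α} {x : β} (h : l[k]? = some p)
    (hx : letter p = some x) : (l.filterMap letter)[lettersBefore letter l k]? = some x := by
  obtain ⟨hk, rfl⟩ := List.getElem?_eq_some_iff.1 h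
  have e : l.filterMap letter =
      (l.take k).filterMap letter ++ x :: (l.drop (k + 1)).filterMap letter := by
    rw [← List.filterMap_cons_some hx, ← List.filterMap_append, ← List.drop_eq_getElem_cons hk,
      List.take_append_drop]
  rw [e, List.getElem?_append_right (by simp [lettersBefore]), lettersBefore, Nat.sub_self]
  simp

theorem exists_of_getElem?_filterMap {l : List α} {m : ℕ} {x : β}
    (h : (l.filterMap letter)[m]? = some x) :
    ∃ k p, l[k]? = some p ∧ letter p = some x ∧ lettersBefore letter l k = m := by
  induction l generalizing m with
  | nil => simp at h
  | cons p l ih =>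
    cases hp : letter p with
    | none =>
      rw [List.filterMap_cons_none hp] at h
      obtain ⟨k, q, h1, h2, h3⟩ := ih h
      exact ⟨k + 1, q, by simpa, h2, by simpa [lettersBefore, hp] using h3⟩
    | some y =>
      rw [List.filterMap_cons_some hp] at h
      cases m with
      | zero => exact ⟨0, p, by simp, by simpa [hp] using h, by simp [lettersBefore]⟩
      | succ m =>
        obtain ⟨k, q, h1, h2, h3⟩ := ih (by simpa using h)
        exact ⟨k + 1, q, by simpa, h2, by simpa [lettersBefore, hp] using h3⟩

/-- Different points that contribute letters contribute letters at different places. -/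
theorem lettersBefore_inj {l : List α} {k k' : ℕ} {p p' : α} (h : l[k]? = some p)
    (h' : l[k']? = some p') (hp : (letter p).isSome) (hp' : (letter p').isSome)
    (e : lettersBefore letter l k = lettersBefore letter l k') : k = k' := by
  have key : ∀ {k k' : ℕ} {p : α}, l[k]? = some p → (letter p).isSome → k < k' →
      lettersBefore letter l k < lettersBefore letter l k' := by
    intro k k' p h hp hk
    obtain ⟨x, hx⟩ := Option.isSome_iff_exists.1 hp
    have h1 := lettersBefore_succ letter h
    have h2 := lettersBefore_mono letter (l := l) hk
    simp [hx] at h1 h2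
    omega
  rcases lt_trichotomy k k' with hk | hk | hk
  · have := key h hp hk
    omega
  · exact hk
  · have := key h' hp' hk
    omega

theorem lettersBefore_lt {l : List α} {k : ℕ} {p : α} (h : l[k]? = some p)
    (hp : (letter p).isSome) : lettersBefore letter l k < (l.filterMap letter).length := by
  obtain ⟨x, hx⟩ := Option.isSome_iff_exists.1 hp
  exact (List.getElem?_eq_some_iff.1 (getElem?_lettersBefore letter h hx)).1

/-- The letter `x` stands at the place `e = (number of the sequence, number of the letter)`. -/
def LetterAt (g : List (List β)) (e : ℕ × ℕ) (x : β) : Prop :=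
  ∃ w, g[e.1]? = some w ∧ w[e.2]? = some x

theorem LetterAt.unique {g : List (List β)} {e : ℕ × ℕ} {x y : β} (h : LetterAt g e x)
    (h' : LetterAt g e y) : x = y := by
  obtain ⟨w, h1, h2⟩ := h
  obtain ⟨w', h3, h4⟩ := h'
  obtain rfl : w = w' := by simpa [h1] using h3
  simpa [h2] using h4

/-- The arc that follows the letter at the place `e`, in cyclic order. Arcs are numbered like the
letters to which they lead. -/
def arcAfter (g : List (List β)) (e : ℕ × ℕ) : ℕ × ℕ :=
  (e.1, (e.2 + 1) % ((g[e.1]?).getD []).length)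

theorem arcAfter_inj {g : List (List β)} {e f : ℕ × ℕ} {x y : β} (h : LetterAt g e x)
    (h' : LetterAt g f y) (hef : arcAfter g e = arcAfter g f) : e = f := by
  obtain ⟨c, m⟩ := e
  obtain ⟨c', m'⟩ := f
  obtain ⟨w, h1, h2⟩ := h
  obtain ⟨w', h3, h4⟩ := h'
  simp only [arcAfter, Prod.mk.injEq] at h1 h2 h3 h4 hef
  obtain ⟨rfl, hef⟩ := hef
  obtain rfl : w = w' := by simpa [h1] using h3
  rw [h1] at hef
  simp only [Option.getD_some] at hef
  have hm := (List.getElem?_eq_some_iff.1 h2).1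
  have hm' := (List.getElem?_eq_some_iff.1 h4).1
  have key : ∀ m, m < w.length → (m + 1) % w.length = if m + 1 = w.length then 0 else m + 1 := by
    intro m hm
    split_ifs with h
    · simp [h]
    · exact Nat.mod_eq_of_lt (by omega)
  rw [key m hm, key m' hm'] at hef
  simp only [Prod.mk.injEq, true_and]
  split_ifs at hef <;> omega

variable {letter} {ls : List (List α)} {next : α → α}

/-- `col` assigns to every point of the tours `ls` the arc of the Gauss code on which it lies: the
number of the tour and the number of the next letter. The remainder makes the points behind the last
letter belong to the arc that leads to the first one, and it does nothing (`k % 0 = k`) in a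
tour without letters, where the number of letters before a point is zero anyway. -/
def IsArcColouring (letter : α → Option β) (ls : List (List α)) (col : α → ℕ × ℕ) : Prop :=
  ∀ (c : ℕ) (l : List α) (k : ℕ) (p : α), ls[c]? = some l → l[k]? = some p →
    col p = (c, lettersBefore letter l k % (l.filterMap letter).length)

theorem exists_isArcColouring (letter : α → Option β) (hn : ls.flatten.Nodup) :
    ∃ col, IsArcColouring letter ls col := by
  have : ∀ p, ∃ e : ℕ × ℕ, ∀ (c : ℕ) (l : List α) (k : ℕ), ls[c]? = some l → l[k]? = some p →
      e = (c, lettersBefore letter l k % (l.filterMap letter).length) := by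
    intro p
    by_cases h : ∃ (c : ℕ) (l : List α) (k : ℕ), ls[c]? = some l ∧ l[k]? = some p
    · obtain ⟨c, l, k, h1, h2⟩ := h
      refine ⟨(c, lettersBefore letter l k % (l.filterMap letter).length),
        fun c' l' k' h1' h2' => ?_⟩
      · obtain ⟨hl, hd⟩ := List.nodup_flatten.1 hn
        obtain ⟨hc, rfl⟩ := List.getElem?_eq_some_iff.1 h1
        obtain ⟨hc', rfl⟩ := List.getElem?_eq_some_iff.1 h1'
        obtain ⟨hk, hkp⟩ := List.getElem?_eq_some_iff.1 h2
        obtain ⟨hk', hkp'⟩ := List.getElem?_eq_some_iff.1 h2'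
        have hcc : c = c' := by
          have h3 := List.pairwise_iff_getElem.1 hd
          have m1 : p ∈ ls[c] := List.mem_of_getElem? h2
          have m2 : p ∈ ls[c'] := List.mem_of_getElem? h2'
          rcases lt_trichotomy c c' with h | h | h
          · exact absurd m2 (h3 c c' hc hc' h m1)
          · exact h
          · exact absurd m1 (h3 c' c hc' hc h m2)
        subst hcc
        have hkk : k = k' :=
          (List.Nodup.getElem_inj_iff (hl _ (List.getElem_mem hc))).1 (hkp.trans hkp'.symm)
        rw [hkk]
    · exact ⟨(0, 0), fun c l k h1 h2 => absurd ⟨c, l, k, h1, h2⟩ h⟩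
  choose col hcol using this
  exact ⟨col, fun c l k p h1 h2 => hcol p c l k h1 h2⟩

theorem exists_getElem?_of_mem_flatten {p : α} (hp : p ∈ ls.flatten) :
    ∃ (c : ℕ) (l : List α) (k : ℕ), ls[c]? = some l ∧ l[k]? = some p := by
  obtain ⟨l, hl, hp⟩ := List.mem_flatten.1 hp
  obtain ⟨c, hc⟩ := List.mem_iff_getElem?.1 hl
  obtain ⟨k, hk⟩ := List.mem_iff_getElem?.1 hp
  exact ⟨c, l, k, hc, hk⟩

theorem mem_flatten_of_getElem? {c k : ℕ} {l : List α} {p : α} (h : ls[c]? = some l)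
    (h' : l[k]? = some p) : p ∈ ls.flatten :=
  List.mem_flatten.2 ⟨l, List.mem_of_getElem? h, List.mem_of_getElem? h'⟩

/-- The points of a tour follow each other cyclically. -/
theorem getElem?_next {l : List α} (h : l.map next = l.rotate 1) {k : ℕ} {p : α}
    (hk : l[k]? = some p) : l[(k + 1) % l.length]? = some (next p) := by
  have hl := (List.getElem?_eq_some_iff.1 hk).1
  have h1 : (l.map next)[k]? = some (next p) := by simp [hk]
  rwa [h, List.getElem?_rotate hl] at h1

variable {col : α → ℕ × ℕ}

theorem IsArcColouring.next_eq (hcol : IsArcColouring letter ls col)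
    (hnext : ∀ l ∈ ls, l.map next = l.rotate 1) {c k : ℕ} {l : List α}
    {p : α} (h : ls[c]? = some l) (h' : l[k]? = some p) :
    col (next p) = (c, (lettersBefore letter l k + (letter p).toList.length) %
      (l.filterMap letter).length) := by
  rw [hcol c l _ _ h (getElem?_next (hnext l (List.mem_of_getElem? h)) h'),
    ← lettersBefore_succ letter h']
  have hl := (List.getElem?_eq_some_iff.1 h').1
  rcases Nat.lt_or_ge (k + 1) l.length with hk | hk
  · rw [Nat.mod_eq_of_lt hk]
  · have hk' : k + 1 = l.length := by omega
    rw [hk', Nat.mod_self]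
    simp [lettersBefore]

theorem IsArcColouring.next_of_none (hcol : IsArcColouring letter ls col)
    (hnext : ∀ l ∈ ls, l.map next = l.rotate 1) {p : α}
    (hp : p ∈ ls.flatten) (h : letter p = none) : col (next p) = col p := by
  obtain ⟨c, l, k, h1, h2⟩ := exists_getElem?_of_mem_flatten hp
  rw [hcol.next_eq hnext h1 h2, hcol c l k p h1 h2]
  simp [h]

theorem IsArcColouring.letterAt (hcol : IsArcColouring letter ls col)
    {p : α} {x : β} (hp : p ∈ ls.flatten) (h : letter p = some x) :
    LetterAt (ls.map fun l => l.filterMap letter) (col p) x := by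
  obtain ⟨c, l, k, h1, h2⟩ := exists_getElem?_of_mem_flatten hp
  rw [hcol c l k p h1 h2]
  refine ⟨l.filterMap letter, by simp [h1], ?_⟩
  simp only
  rw [Nat.mod_eq_of_lt (lettersBefore_lt letter h2 (by simp [h]))]
  exact getElem?_lettersBefore letter h2 h

theorem IsArcColouring.next_of_some (hcol : IsArcColouring letter ls col)
    (hnext : ∀ l ∈ ls, l.map next = l.rotate 1) {p : α} {x : β}
    (hp : p ∈ ls.flatten) (h : letter p = some x) :
    col (next p) = arcAfter (ls.map fun l => l.filterMap letter) (col p) := by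
  obtain ⟨c, l, k, h1, h2⟩ := exists_getElem?_of_mem_flatten hp
  rw [hcol.next_eq hnext h1 h2, hcol c l k p h1 h2]
  simp [arcAfter, h, h1]

theorem IsArcColouring.exists_of_letterAt (hcol : IsArcColouring letter ls col)
    {e : ℕ × ℕ} {x : β}
    (h : LetterAt (ls.map fun l => l.filterMap letter) e x) :
    ∃ p ∈ ls.flatten, letter p = some x ∧ col p = e := by
  obtain ⟨c, m⟩ := e
  obtain ⟨w, h1, h2⟩ := h
  simp only [List.getElem?_map, Option.map_eq_some_iff] at h1 h2
  obtain ⟨l, h1, rfl⟩ := h1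
  obtain ⟨k, p, h3, h4, rfl⟩ := exists_of_getElem?_filterMap letter h2
  refine ⟨p, mem_flatten_of_getElem? h1 h3, h4, ?_⟩
  rw [hcol c l k p h1 h3, Nat.mod_eq_of_lt (lettersBefore_lt letter h3 (by simp [h4]))]

/-- Two points at which letters are read lie on different arcs. -/
theorem IsArcColouring.inj (hcol : IsArcColouring letter ls col)
    {p q : α} (hp : p ∈ ls.flatten) (hq : q ∈ ls.flatten)
    (hp' : (letter p).isSome) (hq' : (letter q).isSome) (h : col p = col q) : p = q := by
  obtain ⟨c, l, k, h1, h2⟩ := exists_getElem?_of_mem_flatten hp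
  obtain ⟨c', l', k', h1', h2'⟩ := exists_getElem?_of_mem_flatten hq
  rw [hcol c l k p h1 h2, hcol c' l' k' q h1' h2', Prod.mk.injEq] at h
  obtain ⟨rfl, h⟩ := h
  obtain rfl : l = l' := by simpa [h1] using h1'
  rw [Nat.mod_eq_of_lt (lettersBefore_lt letter h2 hp'),
    Nat.mod_eq_of_lt (lettersBefore_lt letter h2' hq')] at h
  obtain rfl := lettersBefore_inj letter h2 h2' hp' hq' h
  simpa [h2] using h2'

/-- A property that is passed on from each point of a tour to the next one holds on the whole
tour or nowhere on it. -/
theorem forall_mem_tour {l : List α} (h : l.map next = l.rotate 1) {S : α → Prop}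
    (hS : ∀ p ∈ l, S p → S (next p)) {p q : α} (hp : p ∈ l) (hq : q ∈ l) (hSp : S p) : S q := by
  obtain ⟨k, hk⟩ := List.mem_iff_getElem?.1 hp
  obtain ⟨m, hm⟩ := List.mem_iff_getElem?.1 hq
  have key : ∀ n p, l[(k + n) % l.length]? = some p → S p := by
    intro n
    induction n with
    | zero =>
      intro p' hp'
      rw [Nat.add_zero, Nat.mod_eq_of_lt (List.getElem?_eq_some_iff.1 hk).1, hk] at hp'
      obtain rfl : p = p' := by simpa using hp'
      exact hSp
    | succ n ih =>
      intro p' hp'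
      have hlt : (k + n) % l.length < l.length :=
        Nat.mod_lt _ (by have := (List.getElem?_eq_some_iff.1 hk).1; omega)
      have h1 := getElem?_next h (List.getElem?_eq_getElem hlt)
      have h2 : ((k + n) % l.length + 1) % l.length = (k + (n + 1)) % l.length := by
        rw [Nat.mod_add_mod, Nat.add_assoc]
      rw [h2, hp'] at h1
      obtain rfl : p' = _ := by simpa using h1
      exact hS _ (List.getElem_mem hlt) (ih _ (List.getElem?_eq_getElem hlt))
  have hk' := (List.getElem?_eq_some_iff.1 hk).1
  have hm' := (List.getElem?_eq_some_iff.1 hm).1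
  refine key (l.length - k + m) q ?_
  rw [show k + (l.length - k + m) = m + l.length by omega, Nat.add_mod_right,
    Nat.mod_eq_of_lt hm', hm]

end Arcs

variable {T : Type}

/-! ### Walking along a plane diagram -/

/-- The strands on the lower (`false`) or upper (`true`) side of a slice. -/
def Slice.strands (s : Slice T) (side : Bool) : List Bool := if side then s.cod else s.dom

namespace PlaneDiagram

theorem level_eq_dom_aux {s : Slice T} {B : List Bool} :
    ∀ {w : List (Slice T)} {A : List Bool}, IsTangle A w B → ∀ {i : ℕ}, w[i]? = some s →
      (if i = 0 then A else (w[i - 1]?.map Slice.cod).getD []) = s.dom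
  | [], _, _, i, hi => by simp at hi
  | t :: w, A, h, 0, hi => by
    obtain rfl : t = s := by simpa using hi
    simpa using h.1
  | t :: w, A, h, 1, hi => by
    have := level_eq_dom_aux h.2 (i := 0) (by simpa using hi)
    simpa using this
  | t :: w, A, h, i + 2, hi => by
    have := level_eq_dom_aux h.2 (i := i + 1) (by simpa using hi)
    simpa using this

theorem level_eq_nil_aux {B : List Bool} :
    ∀ {w : List (Slice T)} {A : List Bool}, IsTangle A w B →
      (if w.length = 0 then A else (w[w.length - 1]?.map Slice.cod).getD []) = B
  | [], _, h => by simpa [IsTangle] using h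
  | [t], A, h => by simpa [IsTangle] using h.2
  | t :: t' :: w, A, h => by
    have := level_eq_nil_aux h.2
    simpa using this

variable (D : PlaneDiagram T)

theorem level_eq_dom {i : ℕ} {s : Slice T} (h : D.word[i]? = some s) : D.level i = s.dom := by
  rw [← level_eq_dom_aux D.closed h]
  cases i <;> simp [level]

theorem level_eq_cod {i : ℕ} {s : Slice T} (h : D.word[i]? = some s) :
    D.level (i + 1) = s.cod := by simp [level, h]

theorem level_length : D.level D.word.length = [] := by
  have := level_eq_nil_aux D.closed
  cases h : D.word.length <;> simp_all [level]

theorem level_eq_strands {i : ℕ} {s : Slice T} (h : D.word[i]? = some s) (side : Bool) :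
    D.level (i + side.toNat) = s.strands side := by
  cases side
  · simpa [Slice.strands] using D.level_eq_dom h
  · simpa [Slice.strands] using D.level_eq_cod h

/-- From every point one enters a slice. -/
theorem exists_slice {p : ℕ × ℕ} (hp : D.IsPoint p) :
    ∃ s, D.word[D.sliceAfter p]? = some s ∧ p.1 = D.sliceAfter p + (!D.dir p).toNat := by
  obtain ⟨i, j⟩ := p
  simp only [IsPoint] at hp
  cases hd : D.dir (i, j) with
  | true =>
    have hi : i < D.word.length := by
      rcases lt_trichotomy i D.word.length with h | rfl | h
      · exact h
      · simp [level_length] at hp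
      · obtain ⟨i, rfl⟩ : ∃ k, i = k + 1 := ⟨i - 1, by omega⟩
        simp [level, List.getElem?_eq_none (show D.word.length ≤ i by omega)] at hp
    exact ⟨D.word[i], by simp [sliceAfter, hd, hi], by simp [sliceAfter, hd]⟩
  | false =>
    cases i with
    | zero => simp [level] at hp
    | succ i =>
      cases h : D.word[i]? with
      | none => simp [level, h] at hp
      | some s => exact ⟨s, by simp [sliceAfter, hd, h], by simp [sliceAfter, hd]⟩

theorem dir_eq {i j : ℕ} {a : Bool} (h : (D.level i)[j]? = some a) : D.dir (i, j) = a := by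
  simp [dir, List.getD, h]

theorem sliceAfter_eq {i j : ℕ} {side : Bool} (h : D.dir (i + side.toNat, j) = !side) :
    D.sliceAfter (i + side.toNat, j) = i := by
  cases side <;> simp_all [sliceAfter]

theorem next_eq {i j : ℕ} {side : Bool} (h : D.dir (i + side.toNat, j) = !side) {s : Slice T}
    (hs : D.word[i]? = some s) :
    D.next (i + side.toNat, j) = (i + (s.through side j).1.toNat, (s.through side j).2) := by
  simp only [next, D.sliceAfter_eq h, h, hs, Bool.not_not]

theorem passage_eq {i j : ℕ} {side : Bool} (h : D.dir (i + side.toNat, j) = !side) {s : Slice T}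
    (hs : D.word[i]? = some s) :
    D.passage (i + side.toNat, j) = (s.crossed side j).map fun x => (i, x) := by
  simp only [passage, D.sliceAfter_eq h, h, hs, Bool.not_not, Option.bind_some]

/-- Every point is the `j`-th point on the lower or upper side of the slice that is entered from
it. -/
theorem exists_entry {p : ℕ × ℕ} (hp : D.IsPoint p) :
    ∃ i j side s, p = (i + side.toNat, j) ∧ D.word[i]? = some s ∧
      (s.strands side)[j]? = some (!side) ∧ D.dir p = !side := by
  obtain ⟨s, hs, h⟩ := D.exists_slice hp
  have e : p = (D.sliceAfter p + (!D.dir p).toNat, p.2) := by rw [← h]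
  refine ⟨D.sliceAfter p, p.2, !D.dir p, s, e, hs, ?_, by simp⟩
  have hl := D.level_eq_strands hs (!D.dir p)
  rw [← h] at hl
  rw [← hl, Bool.not_not, dir, List.getD, List.getElem?_eq_getElem hp, Option.getD_some]

theorem isPoint_of_entry {i j : ℕ} {side : Bool} {s : Slice T} (hs : D.word[i]? = some s)
    {a : Bool} (h : (s.strands side)[j]? = some a) :
    D.IsPoint (i + side.toNat, j) ∧ D.dir (i + side.toNat, j) = a := by
  rw [← D.level_eq_strands hs] at h
  exact ⟨(List.getElem?_eq_some_iff.1 h).1, D.dir_eq h⟩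

end PlaneDiagram

/-- Both strands of a double point can be entered in their directions. -/
theorem Slice.exists_crossed {s : Slice T} {t : T} {a b : Bool} (h : s.gen = .cross t a b)
    (rising : Bool) : ∃ side j, (s.strands side)[j]? = some (!side) ∧
      s.crossed side j = some (t, a, b, rising) := by
  obtain ⟨l, g, r⟩ := s
  subst h
  cases rising
  · refine ⟨!b, l.length + b.toNat, ?_, ?_⟩ <;> cases b <;>
      simp [Slice.strands, Slice.dom, Slice.cod, Gen.dom, Gen.cod, Slice.crossed]
  · refine ⟨!a, l.length + (!a).toNat, ?_, ?_⟩ <;> cases a <;>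
      simp [Slice.strands, Slice.dom, Slice.cod, Gen.dom, Gen.cod, Slice.crossed]

/-- Every double point is passed on both of its strands. -/
theorem PlaneDiagram.exists_passage (D : PlaneDiagram T) {i : ℕ} {s : Slice T} {t : T} {a b : Bool}
    (hs : D.word[i]? = some s) (h : s.gen = .cross t a b) (rising : Bool) :
    ∃ p, D.IsPoint p ∧ D.passage p = some (i, t, a, b, rising) := by
  obtain ⟨side, j, h1, h2⟩ := Slice.exists_crossed h rising
  obtain ⟨h3, h4⟩ := D.isPoint_of_entry hs h1
  exact ⟨_, h3, by rw [D.passage_eq h4 hs, h2]; rfl⟩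

/-! ### Forgetting colours -/

/-- The elementary piece of a virtual diagram that underlies a piece of a coloured tangle. -/
def CGen.forget : CGen E → Gen Crossing
  | .cup x => .cup x.1
  | .cap x => .cap x.1
  | .virt x y => .cross .virtual x.1 y.1
  | .box r x y _ _ => .cross (.classical r) x.1 y.1

/-- The slice of a virtual diagram that underlies a slice of a coloured tangle. -/
def CSlice.forget (s : CSlice E) : Slice Crossing :=
  ⟨s.left.map Prod.fst, s.gen.forget, s.right.map Prod.fst⟩

/-- The word of slices of a virtual diagram that underlies a coloured tangle. -/
def forget (w : CWord E) : List (Slice Crossing) := w.map CSlice.forget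

theorem CGen.forget_dom (g : CGen E) : g.forget.dom = g.dom.map Prod.fst := by
  cases g <;> simp [CGen.forget, Gen.dom, dual]

theorem CGen.forget_cod (g : CGen E) : g.forget.cod = g.cod.map Prod.fst := by
  cases g <;> simp [CGen.forget, Gen.cod, dual]

theorem CSlice.forget_dom (s : CSlice E) : s.forget.dom = s.dom.map Prod.fst := by
  simp [CSlice.forget, Slice.dom, CSlice.dom, CGen.forget_dom]

theorem CSlice.forget_cod (s : CSlice E) : s.forget.cod = s.cod.map Prod.fst := by
  simp [CSlice.forget, Slice.cod, CSlice.cod, CGen.forget_cod]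

theorem Tangle.forget {A B : List (Strand E)} {w : CWord E} (h : Tangle A w B) :
    IsTangle (A.map Prod.fst) (forget w) (B.map Prod.fst) := by
  induction w generalizing A with
  | nil => simpa [VirtualKnot.forget, IsTangle] using congrArg (List.map Prod.fst) h
  | cons s w ih =>
    obtain ⟨rfl, h⟩ := h
    exact ⟨(s.forget_dom).symm, by rw [s.forget_cod]; exact ih h⟩

/-- The coloured strands on the horizontal line below slice number `i`. -/
def strandsAt (W : CWord E) : ℕ → List (Strand E)
  | 0 => []
  | i + 1 => (W[i]?.map CSlice.cod).getD []

/-- The coloured diagram `W` has the strand `x` at the point `p`. -/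
def AtPoint (W : CWord E) (p : ℕ × ℕ) (x : Strand E) : Prop := (strandsAt W p.1)[p.2]? = some x

theorem AtPoint.unique {W : CWord E} {p : ℕ × ℕ} {x y : Strand E} (h : AtPoint W p x)
    (h' : AtPoint W p y) : x = y := by
  rw [AtPoint] at h h'
  simpa [h] using h'

theorem hasColour_iff_atPoint {W : CWord E} {e : E} :
    HasColour [] W e ↔ ∃ p x, AtPoint W p x ∧ x.2 = e := by
  constructor
  · rintro (h | ⟨s, hs, x, hx, rfl⟩)
    · simp at h
    · obtain ⟨i, hi⟩ := List.mem_iff_getElem?.1 hs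
      obtain ⟨j, hj⟩ := List.mem_iff_getElem?.1 hx
      exact ⟨(i + 1, j), x, by simpa [AtPoint, strandsAt, hi] using hj, rfl⟩
  · rintro ⟨⟨i, j⟩, x, h, rfl⟩
    cases i with
    | zero => simp [AtPoint, strandsAt] at h
    | succ i =>
      cases hs : W[i]? with
      | none => simp [AtPoint, strandsAt, hs] at h
      | some s =>
        exact .inr ⟨s, List.mem_of_getElem? hs, x,
          List.mem_of_getElem? (i := j) (by simpa [AtPoint, strandsAt, hs] using h), rfl⟩

/-- The coloured strands on the lower (`false`) or upper (`true`) side of a slice. -/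
def CSlice.strands (s : CSlice E) (side : Bool) : List (Strand E) := if side then s.cod else s.dom

theorem strandsAt_eq_dom_aux {s : CSlice E} {B : List (Strand E)} :
    ∀ {w : CWord E} {A : List (Strand E)}, Tangle A w B → ∀ {i : ℕ}, w[i]? = some s →
      (if i = 0 then A else (w[i - 1]?.map CSlice.cod).getD []) = s.dom
  | [], _, _, i, hi => by simp at hi
  | t :: w, A, h, 0, hi => by
    obtain rfl : t = s := by simpa using hi
    simpa using h.1
  | t :: w, A, h, 1, hi => by
    have := strandsAt_eq_dom_aux h.2 (i := 0) (by simpa using hi)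
    simpa using this
  | t :: w, A, h, i + 2, hi => by
    have := strandsAt_eq_dom_aux h.2 (i := i + 1) (by simpa using hi)
    simpa using this

theorem strandsAt_eq {W : CWord E} (hW : Tangle [] W []) {i : ℕ} {t : CSlice E}
    (h : W[i]? = some t) (side : Bool) : strandsAt W (i + side.toNat) = t.strands side := by
  cases side
  · simp only [Bool.toNat_false, Nat.add_zero, CSlice.strands, Bool.false_eq_true, if_false]
    rw [← strandsAt_eq_dom_aux hW h]
    cases i <;> simp [strandsAt]
  · simp [strandsAt, h, CSlice.strands]

/-- The coloured strands on the lower (`false`) or upper (`true`) side of a piece. -/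
def CGen.strands (g : CGen E) (side : Bool) : List (Strand E) := if side then g.cod else g.dom

theorem CSlice.strands_eq (t : CSlice E) (side : Bool) :
    t.strands side = t.left ++ (t.gen.strands side ++ t.right) := by
  cases side <;> rfl

theorem CGen.ends_forget (g : CGen E) (side : Bool) :
    g.forget.ends side = (g.strands side).length := by
  cases side <;> simp [Gen.ends, CGen.strands, CGen.forget_dom, CGen.forget_cod]

/-- Colours are constant along strands except at classical crossings, where they change as recorded
in the associated `Box`. -/
theorem CSlice.through_strands (t : CSlice E) {side : Bool} {j : ℕ} {e : E}
    (h : (t.strands side)[j]? = some (!side, e)) :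
    ∃ f, (t.strands (t.forget.through side j).1)[(t.forget.through side j).2]? =
        some ((t.forget.through side j).1, f) ∧
      (((∀ r a b rising, t.forget.crossed side j ≠ some (.classical r, a, b, rising)) ∧ e = f) ∨
        ∃ r a b rising bx, t.forget.crossed side j = some (.classical r, a, b, rising) ∧
          t.gen.toBox = some bx ∧ bx.positive = turnsCounter a b r ∧
          if rising == r then e = bx.overIn ∧ f = bx.overOut
          else e = bx.underIn ∧ f = bx.underOut) := by
  rw [t.strands_eq] at h
  rcases Nat.lt_or_ge j t.left.length with hj | hj
  · have e1 : t.forget.through side j = (!side, j) := by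
      simp [Slice.through, CSlice.forget, hj]
    rw [List.getElem?_append_left hj] at h
    refine ⟨e, ?_, .inl ⟨fun r a b rising => ?_, rfl⟩⟩
    · rw [e1, t.strands_eq, List.getElem?_append_left hj, h]
    · simp only [Slice.crossed, CSlice.forget]
      cases t.gen.forget <;> simp
      omega
  · obtain ⟨k, rfl⟩ := Nat.exists_eq_add_of_le hj
    rw [List.getElem?_append_right hj, Nat.add_sub_cancel_left] at h
    rcases Nat.lt_or_ge k (t.gen.strands side).length with hk | hk
    · have e1 : t.forget.through side (t.left.length + k) =
          ((t.gen.forget.through side k).1,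
            t.left.length + (t.gen.forget.through side k).2) := by
        simp [Slice.through, CSlice.forget, CGen.ends_forget, hk]
      rw [List.getElem?_append_left hk] at h
      have key : ∀ n : ℕ, ∀ side' x, (t.gen.strands side')[n]? = some x →
          (t.strands side')[t.left.length + n]? = some x := by
        intro n side' x hx
        rw [t.strands_eq, List.getElem?_append_right (by omega), Nat.add_sub_cancel_left,
          List.getElem?_append_left (List.getElem?_eq_some_iff.1 hx).1, hx]
      rw [e1]
      obtain ⟨l, g, r⟩ := t
      cases g with
      | cup x =>
        cases side
        · simp [CGen.strands] at hk
        · refine ⟨e, key _ _ _ ?_, .inl ⟨by simp [Slice.crossed, CSlice.forget, CGen.forget], rfl⟩⟩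
          match k, hk with
          | 0, _ => simp_all [CGen.strands, CGen.forget, Gen.through, dual]
          | 1, _ => simp_all [CGen.strands, CGen.forget, Gen.through, dual, Prod.ext_iff]
      | cap x =>
        cases side
        · refine ⟨e, key _ _ _ ?_, .inl ⟨by simp [Slice.crossed, CSlice.forget, CGen.forget], rfl⟩⟩
          match k, hk with
          | 0, _ => simp_all [CGen.strands, CGen.forget, Gen.through, dual]
          | 1, _ => simp_all [CGen.strands, CGen.forget, Gen.through, dual, Prod.ext_iff]
        · simp [CGen.strands] at hk
      | virt x y =>
        refine ⟨e, key _ _ _ ?_, .inl ⟨fun _ _ _ _ => ?_, rfl⟩⟩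
        · cases side <;> match k, hk with
          | 0, _ => simp_all [CGen.strands, CGen.forget, Gen.through]
          | 1, _ => simp_all [CGen.strands, CGen.forget, Gen.through]
        · simp [Slice.crossed, CSlice.forget, CGen.forget]
      | box q x y u v =>
        obtain ⟨a, x⟩ := x
        obtain ⟨b, y⟩ := y
        cases side <;> match k, hk with
          | 0, _ =>
            simp [CGen.strands] at h
            obtain ⟨rfl, rfl⟩ := h
            refine ⟨_, key _ _ _ rfl, .inr ⟨q, _, _, _, _, by
              simp [Slice.crossed, CSlice.forget, CGen.forget]; rfl,
              rfl, rfl, ?_⟩⟩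
            cases q <;> simp
          | 1, _ =>
            simp [CGen.strands] at h
            obtain ⟨rfl, rfl⟩ := h
            refine ⟨_, key _ _ _ rfl, .inr ⟨q, _, _, _, _, by
              simp [Slice.crossed, CSlice.forget, CGen.forget]; rfl,
              rfl, rfl, ?_⟩⟩
            cases q <;> simp
    · have e1 : t.forget.through side (t.left.length + k) =
          (!side, t.left.length + ((t.gen.strands (!side)).length +
            (k - (t.gen.strands side).length))) := by
        have : ¬ k < (t.gen.strands side).length := by omega
        simp only [Slice.through, CSlice.forget, CGen.ends_forget, List.length_map,
          Nat.add_lt_add_iff_left, this, if_false]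
        rw [if_neg (by omega)]
        simp only [Prod.mk.injEq, true_and]
        omega
      rw [List.getElem?_append_right hk] at h
      refine ⟨e, ?_, .inl ⟨fun r a b rising => ?_, rfl⟩⟩
      · rw [e1]
        dsimp only
        rw [t.strands_eq, List.getElem?_append_right (by omega), Nat.add_sub_cancel_left,
          List.getElem?_append_right (by omega), Nat.add_sub_cancel_left, h]
      · obtain ⟨l, g, r⟩ := t
        cases g <;> cases side <;>
          simp [Slice.crossed, CSlice.forget, CGen.forget, CGen.strands] at hk ⊢ <;> omega

/-! ### Coloured diagrams over a virtual diagram -/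

/-- The piece over `g` whose `k`-th end on the given side has the colour `c side k`. -/
def colourGen (c : Bool → ℕ → E) : Gen Crossing → CGen E
  | .cup a => .cup (a, c true 0)
  | .cap a => .cap (a, c false 0)
  | .cross .virtual a b => .virt (a, c false 0) (b, c false 1)
  | .cross (.classical r) a b => .box r (a, c false 0) (b, c false 1) (c true 1) (c true 0)

/-- The slice over `s` whose `j`-th end on the given side has the colour `c side j`. -/
def colourSlice (c : Bool → ℕ → E) (s : Slice Crossing) : CSlice E :=
  ⟨s.left.mapIdx fun j a => (a, c false j),
    colourGen (fun side k => c side (k + s.left.length)) s.gen,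
    s.right.mapIdx fun j a => (a, c false (j + (s.left ++ s.gen.dom).length))⟩

theorem map_fst_mapIdx (l : List Bool) (c : ℕ → E) :
    (l.mapIdx fun j a => (a, c j)).map Prod.fst = l := by
  apply List.ext_getElem?
  simp [Function.comp_def]

theorem forget_colourSlice (c : Bool → ℕ → E) (s : Slice Crossing) :
    (colourSlice c s).forget = s := by
  obtain ⟨l, g, r⟩ := s
  have : (colourGen (fun side k => c side (k + l.length)) g).forget = g := by
    cases g with
    | cross t a b => cases t <;> rfl
    | _ => rfl
  simp only [CSlice.forget, colourSlice, map_fst_mapIdx, this]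

theorem mapIdx_congr {l : List Bool} {c d : ℕ → E}
    (h : ∀ j a, l[j]? = some a → c j = d j) :
    (l.mapIdx fun j a => (a, c j)) = l.mapIdx fun j a => (a, d j) := by
  apply List.ext_getElem?
  intro j
  simp only [List.getElem?_mapIdx]
  cases hj : l[j]? with
  | none => rfl
  | some a => simp [h j a hj]

/-- If the colours `c` are constant along strands except at classical crossings, then the coloured
slice has these colours at all its ends. -/
theorem colourSlice_strands {c : Bool → ℕ → E} {s : Slice Crossing}
    (hc : ∀ side j, (s.strands side)[j]? = some (!side) →
      (∀ r a b rising, s.crossed side j ≠ some (.classical r, a, b, rising)) →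
      c (s.through side j).1 (s.through side j).2 = c side j) (side : Bool) :
    (colourSlice c s).strands side = (s.strands side).mapIdx fun j a => (a, c side j) := by
  obtain ⟨l, g, r⟩ := s
  have hl : ∀ j a, l[j]? = some a → c true j = c false j := by
    intro j a hj
    have hlt := (List.getElem?_eq_some_iff.1 hj).1
    have key := hc (!a) j (by cases a <;>
      simp [Slice.strands, Slice.dom, Slice.cod, List.getElem?_append_left, hlt, ← hj]) (by
        intro _ _ _ _
        simp only [Slice.crossed]
        cases g <;> simp
        omega)
    cases a <;> simpa [Slice.through, hlt, eq_comm] using key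
  have hr : ∀ j a, r[j]? = some a →
      c true (j + (l ++ g.cod).length) = c false (j + (l ++ g.dom).length) := by
    intro j a hj
    have hlt := (List.getElem?_eq_some_iff.1 hj).1
    cases a
    · have key := hc true (j + (l ++ g.cod).length) (by
        simp [Slice.strands, Slice.cod, List.getElem?_append_right, hj, Nat.add_assoc,
          Nat.add_comm j]) (by
        intro _ _ _ _
        simp only [Slice.crossed]
        cases g <;> simp [Gen.cod])
      have e : Slice.through ⟨l, g, r⟩ true (j + (l ++ g.cod).length) =
          (false, j + (l ++ g.dom).length) := by
        simp only [Slice.through, Gen.ends, List.length_append, if_true]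
        rw [if_neg (by omega), if_neg (by omega)]
        simp
        omega
      rw [e] at key
      exact key.symm
    · have key := hc false (j + (l ++ g.dom).length) (by
        simp [Slice.strands, Slice.dom, List.getElem?_append_right, hj, Nat.add_assoc,
          Nat.add_comm j]) (by
        intro _ _ _ _
        simp only [Slice.crossed]
        cases g <;> simp [Gen.dom])
      have e : Slice.through ⟨l, g, r⟩ false (j + (l ++ g.dom).length) =
          (true, j + (l ++ g.cod).length) := by
        simp only [Slice.through, Gen.ends, List.length_append]
        rw [if_neg (by omega), if_neg (by simp)]
        simp
        omega
      rw [e] at key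
      exact key
  have hg' : ∀ side k, (if side then g.cod else g.dom)[k]? = some (!side) →
      (∀ q a b, g ≠ .cross (.classical q) a b) →
      c (g.through side k).1 (l.length + (g.through side k).2) = c side (l.length + k) := by
    intro side k hk hq
    have hlt := (List.getElem?_eq_some_iff.1 hk).1
    have key := hc side (l.length + k) (by
      cases side <;> simp at hk hlt <;>
        simp [Slice.strands, Slice.dom, Slice.cod, List.getElem?_append_right,
          List.getElem?_append_left, hlt, ← hk]) (by
        intro q a b _ h
        cases g with
        | cup => simp [Slice.crossed] at h
        | cap => simp [Slice.crossed] at h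
        | cross t a' b' =>
          simp only [Slice.crossed] at h
          split_ifs at h
          simp only [Option.some.injEq, Prod.mk.injEq] at h
          exact hq q a' b' (by rw [h.1]))
    have e : Slice.through ⟨l, g, r⟩ side (l.length + k) =
        ((g.through side k).1, l.length + (g.through side k).2) := by
      have : k < g.ends side := by cases side <;> simpa [Gen.ends] using hlt
      simp [Slice.through, this]
    rwa [e] at key
  have hg : (colourGen (fun side k => c side (k + l.length)) g).strands side =
        (if side then g.cod else g.dom).mapIdx fun k a => (a, c side (k + l.length)) := by
    cases g with
    | cup a =>
      have h : c true (1 + l.length) = c true (0 + l.length) := by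
        have := hg' true a.toNat (by cases a <;> rfl) (by simp)
        cases a <;> simpa [Gen.through, Nat.add_comm, eq_comm] using this
      cases side
      · rfl
      · simp [colourGen, CGen.strands, Gen.cod, dual] at h ⊢
        exact h.symm
    | cap a =>
      have h : c false (1 + l.length) = c false (0 + l.length) := by
        have := hg' false (!a).toNat (by cases a <;> rfl) (by simp)
        cases a <;> simpa [Gen.through, Nat.add_comm, eq_comm] using this
      cases side
      · simp [colourGen, CGen.strands, Gen.dom, dual] at h ⊢
        exact h.symm
      · rfl
    | cross t a b =>
      cases t with
      | classical q => cases side <;> simp [colourGen, CGen.strands, Gen.dom, Gen.cod]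
      | virtual =>
        have h1 : c true (1 + l.length) = c false (0 + l.length) := by
          have := hg' (!a) (!a).toNat (by cases a <;> rfl) (by simp)
          cases a <;> simpa [Gen.through, Nat.add_comm, eq_comm] using this
        have h2 : c true (0 + l.length) = c false (1 + l.length) := by
          have := hg' (!b) b.toNat (by cases b <;> rfl) (by simp)
          cases b <;> simpa [Gen.through, Nat.add_comm, eq_comm] using this
        cases side
        · simp [colourGen, CGen.strands, Gen.dom]
        · simp [colourGen, CGen.strands, Gen.cod] at h1 h2 ⊢
          exact ⟨h2.symm, h1.symm⟩
  rw [CSlice.strands_eq]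
  cases side
  · simp only [Bool.false_eq_true, if_false] at hg
    simp only [Slice.strands, Bool.false_eq_true, if_false, Slice.dom]
    rw [List.mapIdx_append, List.mapIdx_append, ← hg, List.append_assoc]
    rfl
  · simp only [if_true] at hg
    simp only [Slice.strands, if_true, Slice.cod]
    rw [List.mapIdx_append, List.mapIdx_append, ← hg, mapIdx_congr hl, mapIdx_congr hr,
      List.append_assoc]
    rfl

theorem tangle_of_levels {w : CWord E} {L : ℕ → List (Strand E)}
    (h : ∀ i t, w[i]? = some t → t.dom = L i ∧ t.cod = L (i + 1)) :
    Tangle (L 0) w (L w.length) := by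
  induction w generalizing L with
  | nil => simp
  | cons s w ih =>
    obtain ⟨h1, h2⟩ := h 0 s (by simp)
    refine ⟨h1.symm, ?_⟩
    have := ih (L := fun i => L (i + 1)) fun i t ht => h (i + 1) t (by simpa using ht)
    simpa [h2] using this

/-- A colouring of the points of a virtual diagram that is constant along strands except at
classical crossings gives a coloured diagram. -/
theorem exists_coloured (K : VirtualDiagram) (col : ℕ × ℕ → E)
    (hcol : ∀ p, K.IsPoint p →
      (∀ i r a b rising, K.passage p ≠ some (i, .classical r, a, b, rising)) →
      col (K.next p) = col p) :
    ∃ W : CWord E, forget W = K.word ∧ Tangle [] W [] ∧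
      ∀ p x, AtPoint W p x → x.2 = col p := by
  set c : ℕ → Bool → ℕ → E := fun i side j => col (i + side.toNat, j) with hc
  set W : CWord E := K.word.mapIdx fun i s => colourSlice (c i) s with hW
  set L : ℕ → List (Strand E) := fun i => (K.level i).mapIdx fun j a => (a, col (i, j)) with hL
  have key : ∀ i t, W[i]? = some t → t.dom = L i ∧ t.cod = L (i + 1) := by
    intro i t ht
    simp only [hW, List.getElem?_mapIdx, Option.map_eq_some_iff] at ht
    obtain ⟨s, hs, rfl⟩ := ht
    have h1 := colourSlice_strands (c := c i) (s := s) (by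
      intro side j hj hn
      obtain ⟨h2, h3⟩ := K.isPoint_of_entry hs hj
      have h4 := hcol _ h2 (by
        intro i' r a b rising h
        rw [K.passage_eq h3 hs] at h
        simp only [Option.map_eq_some_iff, Prod.mk.injEq] at h
        obtain ⟨_, h, -, rfl⟩ := h
        exact hn _ _ _ _ h)
      rwa [K.next_eq h3 hs] at h4)
    have h2 := h1 false
    have h3 := h1 true
    simp only [Slice.strands, Bool.false_eq_true, if_false, if_true, CSlice.strands] at h2 h3
    rw [h2, h3]
    simp [hL, K.level_eq_dom hs, K.level_eq_cod hs, hc]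
  have hT : Tangle [] W [] := by
    have := tangle_of_levels key
    rwa [show L 0 = [] from rfl, show W.length = K.word.length by simp [hW],
      show L K.word.length = [] by simp [hL, K.level_length]] at this
  refine ⟨W, ?_, hT, ?_⟩
  · apply List.ext_getElem?
    intro i
    simp only [forget, hW, List.getElem?_map, List.getElem?_mapIdx, Option.map_map]
    cases K.word[i]? <;> simp [forget_colourSlice]
  · rintro ⟨i, j⟩ x hx
    have : strandsAt W i = [] ∨ strandsAt W i = L i := by
      cases i with
      | zero => exact .inl rfl
      | succ i =>
        cases h : W[i]? with
        | none => simp [strandsAt, h]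
        | some t => simp [strandsAt, h, (key i t h).2]
    rcases this with h | h
    · simp [AtPoint, h] at hx
    · simp only [AtPoint, h, hL, List.getElem?_mapIdx, Option.map_eq_some_iff] at hx
      obtain ⟨a, -, rfl⟩ := hx
      rfl

section Walk

variable {K : VirtualDiagram} {W : CWord E}

theorem getElem?_forget {i : ℕ} {s : Slice Crossing} (hK : forget W = K.word)
    (hs : K.word[i]? = some s) : ∃ t, W[i]? = some t ∧ t.forget = s := by
  rw [← hK] at hs
  simpa [forget] using hs

theorem getElem?_word {i : ℕ} {t : CSlice E} (hK : forget W = K.word)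
    (ht : W[i]? = some t) : K.word[i]? = some t.forget := by
  simp [← hK, forget, ht]

theorem map_strandsAt (hK : forget W = K.word) (i : ℕ) :
    (strandsAt W i).map Prod.fst = K.level i := by
  cases i with
  | zero => rfl
  | succ i =>
    simp only [strandsAt, PlaneDiagram.level, ← hK, forget, List.getElem?_map]
    cases W[i]? <;> simp [CSlice.forget_cod]

theorem AtPoint.dir {p : ℕ × ℕ} {x : Strand E} (h : AtPoint W p x) (hK : forget W = K.word) :
    K.IsPoint p ∧ K.dir p = x.1 := by
  have : (K.level p.1)[p.2]? = some x.1 := by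
    rw [← map_strandsAt hK, List.getElem?_map, h]
    rfl
  exact ⟨(List.getElem?_eq_some_iff.1 this).1, K.dir_eq this⟩

theorem exists_atPoint (hK : forget W = K.word) {p : ℕ × ℕ} (h : K.IsPoint p) :
    ∃ x, AtPoint W p x := by
  have : p.2 < (strandsAt W p.1).length := by
    rw [← List.length_map (f := Prod.fst), map_strandsAt hK]
    exact h
  exact ⟨_, List.getElem?_eq_getElem this⟩

/-- The colours that are met at consecutive points of a walk agree, unless a classical crossing lies
between them; then they are the colours of this crossing. -/
theorem AtPoint.next {p : ℕ × ℕ} {x : Strand E} (h : AtPoint W p x) (hK : forget W = K.word)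
    (hW : Tangle [] W []) (name : ℕ → ℕ) :
    ∃ y, AtPoint W (K.next p) y ∧
      (((∀ i r a b rising, K.passage p ≠ some (i, .classical r, a, b, rising)) ∧ x.2 = y.2) ∨
        ∃ i t bx o, W[i]? = some t ∧ t.gen.toBox = some bx ∧
          (K.passage p).bind (signedLetter name) = some ⟨name i, o, bx.positive⟩ ∧
          if o then x.2 = bx.overIn ∧ y.2 = bx.overOut
          else x.2 = bx.underIn ∧ y.2 = bx.underOut) := by
  obtain ⟨h1, h2⟩ := h.dir hK
  obtain ⟨i, j, side, s, rfl, hs, -, hd⟩ := K.exists_entry h1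
  obtain ⟨t, ht, rfl⟩ := getElem?_forget hK hs
  have h3 : (t.strands side)[j]? = some (!side, x.2) := by
    rw [AtPoint, strandsAt_eq hW ht] at h
    rw [h, ← hd, h2]
  obtain ⟨f, h4, h5⟩ := t.through_strands h3
  rw [K.next_eq hd hs, K.passage_eq hd hs]
  refine ⟨(_, f), by rw [AtPoint, strandsAt_eq hW ht]; exact h4, ?_⟩
  rcases h5 with ⟨h5, h6⟩ | ⟨r, a, b, rising, bx, h5, h6, h7, h8⟩
  · refine .inl ⟨?_, h6⟩
    intro i' r a b rising h
    simp only [Option.map_eq_some_iff, Prod.mk.injEq] at h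
    obtain ⟨_, h, -, rfl⟩ := h
    exact h5 _ _ _ _ h
  · exact .inr ⟨i, t, bx, rising == r, ht, h6, by simp [h5, signedLetter, h7], h8⟩

/-- A classical crossing of a coloured diagram is passed over and under. -/
theorem exists_atPoint_of_toBox (hK : forget W = K.word) (hW : Tangle [] W [])
    {name : ℕ → ℕ} (hname : Function.Injective name) {i : ℕ} {t : CSlice E} {bx : Box E}
    (ht : W[i]? = some t) (hb : t.gen.toBox = some bx) (o : Bool) :
    ∃ p x y, AtPoint W p x ∧ AtPoint W (K.next p) y ∧
      (K.passage p).bind (signedLetter name) = some ⟨name i, o, bx.positive⟩ ∧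
      if o then x.2 = bx.overIn ∧ y.2 = bx.overOut
      else x.2 = bx.underIn ∧ y.2 = bx.underOut := by
  obtain ⟨q, a, b, hg⟩ : ∃ q a b, t.forget.gen = .cross (.classical q) a b := by
    obtain ⟨l, g, r⟩ := t
    cases g with
    | box q x y => exact ⟨q, x.1, y.1, rfl⟩
    | _ => simp [CGen.toBox] at hb
  obtain ⟨p, hp, h⟩ := K.exists_passage (getElem?_word hK ht) hg (o == q)
  obtain ⟨x, hx⟩ := exists_atPoint hK hp
  obtain ⟨y, hy, h1⟩ := hx.next hK hW name
  refine ⟨p, x, y, hx, hy, ?_⟩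
  rcases h1 with ⟨h1, -⟩ | ⟨i', t', bx', o', ht', hb', h1, h2⟩
  · exact absurd h (h1 _ _ _ _ _)
  · have h3 := h1
    simp only [h, Option.bind_some, signedLetter, Option.some.injEq, SignedLetter.mk.injEq] at h3
    obtain rfl := hname h3.1
    obtain rfl : t = t' := by simpa [ht] using ht'
    obtain rfl : bx = bx' := by simpa [hb] using hb'
    obtain rfl : o = o' := by
      rw [← h3.2.1]
      cases o <;> cases q <;> rfl
    exact ⟨h1, h2⟩

end Walk

/-! ### The coloured diagram of a signed Gauss code -/

/-- The letter of the signed Gauss code that is read between the point `p` and the next one. -/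
def letter (K : VirtualDiagram) (name : ℕ → ℕ) (p : ℕ × ℕ) : Option SignedLetter :=
  (K.passage p).bind (signedLetter name)

/-- The signed Gauss code of `K` read along the walks `ls`, with crossing labels `name`. -/
def code (K : VirtualDiagram) (name : ℕ → ℕ) (ls : List (List (ℕ × ℕ))) : SignedGaussCode :=
  ls.map fun l => l.filterMap (letter K name)

/-- `W` is the coloured diagram over `K` whose colours are the arcs of the Gauss code of `K`; `col`
is the arc on which a point lies. -/
structure IsArcDiagram (K : VirtualDiagram) (name : ℕ → ℕ) (ls : List (List (ℕ × ℕ)))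
    (col : ℕ × ℕ → ℕ × ℕ) (W : CWord (ℕ × ℕ)) : Prop where
  traversal : K.IsTraversal ls
  name_injective : Function.Injective name
  colouring : IsArcColouring (letter K name) ls col
  forget_eq : forget W = K.word
  tangle : Tangle [] W []
  atPoint : ∀ p x, AtPoint W p x → x.2 = col p

/-- A label occurs at most once as the label of an overcrossing and at most once as the label of an
undercrossing. -/
def LettersDistinct (g : SignedGaussCode) : Prop :=
  ∀ e f x y, LetterAt g e x → LetterAt g f y → x.label = y.label → x.isOver = y.isOver → e = f

/-- The crossing `b` is recorded in the signed Gauss code `g`. -/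
def IsBox (g : SignedGaussCode) (b : Box (ℕ × ℕ)) : Prop :=
  ∃ n, LetterAt g b.overIn ⟨n, true, b.positive⟩ ∧ LetterAt g b.underIn ⟨n, false, b.positive⟩ ∧
    b.overOut = arcAfter g b.overIn ∧ b.underOut = arcAfter g b.underIn

/-- The only arc of a component without classical crossings. -/
def IsFree (g : SignedGaussCode) (e : ℕ × ℕ) : Prop := g[e.1]? = some [] ∧ e.2 = 0

theorem letter_eq_none {K : VirtualDiagram} {name : ℕ → ℕ} {p : ℕ × ℕ} :
    letter K name p = none ↔
      ∀ i r a b rising, K.passage p ≠ some (i, .classical r, a, b, rising) := by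
  rw [letter]
  constructor
  · intro h i r a b rising hp
    simp [hp, signedLetter] at h
  · intro h
    cases hp : K.passage p with
    | none => rfl
    | some x =>
      obtain ⟨i, t, a, b, rising⟩ := x
      cases t with
      | classical r => exact absurd hp (h _ _ _ _ _)
      | virtual => rfl

theorem exists_isArcDiagram {K : VirtualDiagram} {g : SignedGaussCode} (h : K.HasSignedCode g) :
    ∃ name ls col W, g = code K name ls ∧ IsArcDiagram K name ls col W := by
  obtain ⟨ls, ht, name, hn, rfl⟩ := h
  obtain ⟨col, hcol⟩ := exists_isArcColouring (letter K name) ht.2.1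
  obtain ⟨W, h1, h2, h3⟩ := exists_coloured K col fun p hp h =>
    hcol.next_of_none (fun l hl => (ht.1 l hl).2.2) ((ht.2.2 p).2 hp) (letter_eq_none.2 h)
  exact ⟨name, ls, col, W, rfl, ht, hn, hcol, h1, h2, h3⟩

theorem lettersBefore_eq_zero {α β : Type} {f : α → Option β} {l : List α}
    (h : l.filterMap f = []) (k : ℕ) : lettersBefore f l k = 0 := by
  rw [lettersBefore, List.length_eq_zero_iff, List.filterMap_eq_nil_iff]
  exact fun a ha => List.filterMap_eq_nil_iff.1 h a (List.mem_of_mem_take ha)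

namespace IsArcDiagram

variable {K : VirtualDiagram} {name : ℕ → ℕ} {ls : List (List (ℕ × ℕ))} {col : ℕ × ℕ → ℕ × ℕ}
  {W : CWord (ℕ × ℕ)} (h : IsArcDiagram K name ls col W)

include h

theorem map_next {l : List (ℕ × ℕ)} (hl : l ∈ ls) : l.map K.next = l.rotate 1 :=
  (h.traversal.1 l hl).2.2

theorem exists_atPoint {p : ℕ × ℕ} (hp : p ∈ ls.flatten) : ∃ x, AtPoint W p x :=
  VirtualKnot.exists_atPoint h.forget_eq ((h.traversal.2.2 p).1 hp)

theorem mem_flatten {p : ℕ × ℕ} {x : Strand (ℕ × ℕ)} (hp : AtPoint W p x) : p ∈ ls.flatten :=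
  (h.traversal.2.2 p).2 (hp.dir h.forget_eq).1

/-- The crossing that belongs to a letter. -/
theorem exists_box {p : ℕ × ℕ} {x : SignedLetter} (hp : p ∈ ls.flatten)
    (hx : letter K name p = some x) :
    ∃ i t bx, W[i]? = some t ∧ t.gen.toBox = some bx ∧ x = ⟨name i, x.isOver, bx.positive⟩ ∧
      if x.isOver then col p = bx.overIn ∧ col (K.next p) = bx.overOut
      else col p = bx.underIn ∧ col (K.next p) = bx.underOut := by
  obtain ⟨y, hy⟩ := h.exists_atPoint hp
  obtain ⟨z, hz, h1⟩ := hy.next h.forget_eq h.tangle name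
  rcases h1 with ⟨h1, -⟩ | ⟨i, t, bx, o, ht, hb, h1, h2⟩
  · rw [letter_eq_none.2 h1] at hx
    simp at hx
  · rw [letter, h1] at hx
    obtain rfl := Option.some.inj hx
    rw [h.atPoint _ _ hy, h.atPoint _ _ hz] at h2
    exact ⟨i, t, bx, ht, hb, rfl, h2⟩

/-- The letters that belong to a crossing. -/
theorem exists_letter {i : ℕ} {t : CSlice (ℕ × ℕ)} {bx : Box (ℕ × ℕ)} (ht : W[i]? = some t)
    (hb : t.gen.toBox = some bx) (o : Bool) :
    ∃ p ∈ ls.flatten, letter K name p = some ⟨name i, o, bx.positive⟩ ∧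
      if o then col p = bx.overIn ∧ col (K.next p) = bx.overOut
      else col p = bx.underIn ∧ col (K.next p) = bx.underOut := by
  obtain ⟨p, x, y, hx, hy, h1, h2⟩ :=
    exists_atPoint_of_toBox h.forget_eq h.tangle h.name_injective ht hb o
  rw [h.atPoint _ _ hx, h.atPoint _ _ hy] at h2
  exact ⟨p, h.mem_flatten hx, h1, h2⟩

/-- A crossing contributes only one letter as an overcrossing and one as an undercrossing. -/
theorem lettersDistinct : LettersDistinct (code K name ls) := by
  intro e f x y hx hy hl ho
  obtain ⟨p, hp, hpx, rfl⟩ := h.colouring.exists_of_letterAt hx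
  obtain ⟨q, hq, hqy, rfl⟩ := h.colouring.exists_of_letterAt hy
  obtain ⟨i, t, bx, ht, hb, h1, h2⟩ := h.exists_box hp hpx
  obtain ⟨i', t', bx', ht', hb', h1', h2'⟩ := h.exists_box hq hqy
  rw [h1, h1'] at hl
  obtain rfl := h.name_injective hl
  obtain rfl : t = t' := by simpa [ht] using ht'
  obtain rfl : bx = bx' := by simpa [hb] using hb'
  rw [← ho] at h2'
  split_ifs at h2 h2'
  · rw [h2.1, h2'.1]
  · rw [h2.1, h2'.1]

/-- The classical crossings of the coloured diagram can be read off from the code. -/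
theorem mem_boxes {b : Box (ℕ × ℕ)} : b ∈ boxes W ↔ IsBox (code K name ls) b := by
  constructor
  · intro hb
    obtain ⟨t, ht, hb⟩ := List.mem_filterMap.1 hb
    obtain ⟨i, ht⟩ := List.mem_iff_getElem?.1 ht
    obtain ⟨p, hp, h1, h2⟩ := h.exists_letter ht hb true
    obtain ⟨q, hq, h3, h4⟩ := h.exists_letter ht hb false
    simp only [if_true, Bool.false_eq_true, if_false] at h2 h4
    have hn : ∀ l ∈ ls, l.map K.next = l.rotate 1 := fun l hl => h.map_next hl
    refine ⟨name i, ?_, ?_, ?_, ?_⟩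
    · rw [← h2.1]
      exact h.colouring.letterAt hp h1
    · rw [← h4.1]
      exact h.colouring.letterAt hq h3
    · rw [← h2.1, ← h2.2]
      exact h.colouring.next_of_some hn hp h1
    · rw [← h4.1, ← h4.2]
      exact h.colouring.next_of_some hn hq h3
  · rintro ⟨n, h1, h2, h3, h4⟩
    obtain ⟨p, hp, hpx, hpe⟩ := h.colouring.exists_of_letterAt h1
    obtain ⟨q, hq, hqx, hqe⟩ := h.colouring.exists_of_letterAt h2
    obtain ⟨i, t, bx, ht, hb, h5, h6⟩ := h.exists_box hp hpx
    obtain ⟨i', t', bx', ht', hb', h7, h8⟩ := h.exists_box hq hqx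
    simp only [SignedLetter.mk.injEq, true_and] at h5 h7
    obtain rfl := h.name_injective (h5.1.symm.trans h7.1)
    obtain rfl : t = t' := by simpa [ht] using ht'
    obtain rfl : bx = bx' := by simpa [hb] using hb'
    simp only [if_true, Bool.false_eq_true, if_false] at h6 h8
    have hn : ∀ l ∈ ls, l.map K.next = l.rotate 1 := fun l hl => h.map_next hl
    have h9 := h.colouring.next_of_some hn hp hpx
    have h10 := h.colouring.next_of_some hn hq hqx
    have : b = bx := by
      obtain ⟨a, b1, b2, b3, b4⟩ := b
      obtain ⟨a', b1', b2', b3', b4'⟩ := bx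
      simp only [Box.mk.injEq] at *
      refine ⟨h5.2, hpe.symm.trans h6.1, ?_, hqe.symm.trans h8.1, ?_⟩
      · rw [h3, ← hpe, ← h6.2]
        exact h9.symm
      · rw [h4, ← hqe, ← h8.2]
        exact h10.symm
    exact List.mem_filterMap.2 ⟨t, List.mem_of_getElem? ht, this ▸ hb⟩

theorem nodup_boxes : (boxes W).Nodup := by
  rw [boxes, List.Nodup, List.pairwise_filterMap, List.pairwise_iff_getElem]
  rintro i j hi hj hij b hb _ hb' rfl
  obtain ⟨p, hp, h1, h2⟩ := h.exists_letter (List.getElem?_eq_getElem hi) hb true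
  obtain ⟨q, hq, h3, h4⟩ := h.exists_letter (List.getElem?_eq_getElem hj) hb' true
  simp only [if_true] at h2 h4
  obtain rfl := h.colouring.inj hp hq (by simp [h1]) (by simp [h3]) (h2.1.trans h4.1.symm)
  rw [h1] at h3
  have := h.name_injective (by simpa using h3)
  omega

/-- A component without classical crossings is not empty. -/
theorem hasColour_of_isFree {e : ℕ × ℕ} (he : IsFree (code K name ls) e) : HasColour [] W e := by
  obtain ⟨c, m⟩ := e
  obtain ⟨h1, rfl⟩ := he
  simp only [code, List.getElem?_map, Option.map_eq_some_iff] at h1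
  obtain ⟨l, hl, h1⟩ := h1
  obtain ⟨p, hp⟩ := List.exists_mem_of_ne_nil l (h.traversal.1 l (List.mem_of_getElem? hl)).1
  obtain ⟨k, hk⟩ := List.mem_iff_getElem?.1 hp
  obtain ⟨x, hx⟩ := h.exists_atPoint (mem_flatten_of_getElem? hl hk)
  refine hasColour_iff_atPoint.2 ⟨p, x, hx, ?_⟩
  rw [h.atPoint p x hx, h.colouring c l k p hl hk, lettersBefore_eq_zero h1, Nat.zero_mod]

/-- If the strands of `W` are marked in such a way that the mark can change at classical crossings
only, and if none of the strands at classical crossings is marked, then a marked strand belongs to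
a component without classical crossings, all of which is marked. -/
theorem isFree_of_marked {W' : CWord ((ℕ × ℕ) × Bool)} (h1 : recolour Prod.fst W' = W)
    (h2 : Tangle [] W' []) (h3 : ∀ b ∈ boxes W', b.overIn.2 = false ∧ b.underIn.2 = false)
    {e : ℕ × ℕ} (he : HasColour [] W' (e, true)) :
    IsFree (code K name ls) e ∧ ¬ HasColour [] W' (e, false) := by
  have hf : forget W' = K.word := by
    rw [← h.forget_eq, ← h1]
    simp only [forget, recolour, List.map_map]
    refine List.map_congr_left fun s _ => ?_
    obtain ⟨l, g, r⟩ := s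
    cases g <;>
      simp [CSlice.forget, CSlice.map, CGen.map, CGen.forget, Strand.map, Function.comp_def]
  have hat : ∀ p x, AtPoint W' p x → x.2.1 = col p := by
    intro p x hx
    have : strandsAt W p.1 = (strandsAt W' p.1).map (Strand.map Prod.fst) := by
      rw [← h1]
      cases p.1 with
      | zero => rfl
      | succ i =>
        simp only [strandsAt, recolour, List.getElem?_map]
        cases W'[i]? <;> simp [CSlice.map_cod]
    have h4 : AtPoint W p (Strand.map Prod.fst x) := by
      rw [AtPoint, this, List.getElem?_map, hx]
      rfl
    exact h.atPoint p _ h4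
  have hmem : ∀ {p x}, AtPoint W' p x → p ∈ ls.flatten := fun hp =>
    (h.traversal.2.2 _).2 (hp.dir hf).1
  set S : ℕ × ℕ → Prop := fun p => ∃ x, AtPoint W' p x ∧ x.2.2 = true with hS
  have hstep : ∀ p, S p → letter K name p = none ∧ S (K.next p) := by
    rintro p ⟨x, hx, hx'⟩
    obtain ⟨y, hy, h4⟩ := hx.next hf h2 name
    rcases h4 with ⟨h4, h5⟩ | ⟨i, t, bx, o, ht, hb, h4, h5⟩
    · exact ⟨letter_eq_none.2 h4, y, hy, h5 ▸ hx'⟩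
    · have h6 := h3 bx (List.mem_filterMap.2 ⟨t, List.mem_of_getElem? ht, hb⟩)
      exfalso
      cases o
      · simp only [Bool.false_eq_true, if_false] at h5
        rw [h5.1, h6.2] at hx'
        simp at hx'
      · simp only [if_true] at h5
        rw [h5.1, h6.1] at hx'
        simp at hx'
  obtain ⟨p, x, hx, hxe⟩ := hasColour_iff_atPoint.1 he
  obtain ⟨c, l, k, hl, hk⟩ := exists_getElem?_of_mem_flatten (hmem hx)
  have hall : ∀ q ∈ l, S q := fun q hq =>
    forall_mem_tour (h.map_next (List.mem_of_getElem? hl)) (fun p _ hp => (hstep p hp).2)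
      (List.mem_of_getElem? hk) hq ⟨x, hx, by rw [hxe]⟩
  have hnil : l.filterMap (letter K name) = [] :=
    List.filterMap_eq_nil_iff.2 fun q hq => (hstep q (hall q hq)).1
  have hcol : col p = e := by rw [← hat p x hx, hxe]
  rw [h.colouring c l k p hl hk, lettersBefore_eq_zero hnil, Nat.zero_mod] at hcol
  subst hcol
  refine ⟨⟨by simp [code, hl, hnil], rfl⟩, fun hfalse => ?_⟩
  obtain ⟨q, y, hy, hye⟩ := hasColour_iff_atPoint.1 hfalse
  obtain ⟨c', l', k', hl', hk'⟩ := exists_getElem?_of_mem_flatten (hmem hy)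
  have h4 := h.colouring c' l' k' q hl' hk'
  rw [← hat q y hy, hye, Prod.mk.injEq] at h4
  obtain rfl := h4.1
  obtain rfl : l = l' := by simpa [hl] using hl'
  obtain ⟨z, hz, hz'⟩ := hall q (List.mem_of_getElem? hk')
  rw [hz.unique hy, hye] at hz'
  simp at hz'

end IsArcDiagram

theorem mem_boxEnds {bs : List (Box E)} {x : Strand E} :
    x ∈ boxEnds bs ↔ ∃ b ∈ bs, x ∈ b.ends := by
  induction bs with
  | nil => simp [boxEnds]
  | cons b bs ih => simp [boxEnds, ih, or_comm]

theorem Box.mem_ends {b : Box E} {x : Strand E} :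
    x ∈ b.ends ↔ (x.1 = true ∧ (x.2 = b.overOut ∨ x.2 = b.underOut)) ∨
      (x.1 = false ∧ (x.2 = b.overIn ∨ x.2 = b.underIn)) := by
  obtain ⟨d, e⟩ := x
  obtain ⟨p, a1, a2, a3, a4⟩ := b
  cases p <;> cases d <;> simp [Box.ends, Box.in₁, Box.in₂, Box.out₁, Box.out₂, or_comm]

/-- Every arc of a Gauss code leaves at most one crossing and enters at most one. -/
theorem IsBox.nodup_boxEnds {g : SignedGaussCode} (hg : LettersDistinct g)
    {bs : List (Box (ℕ × ℕ))} (hb : ∀ b ∈ bs, IsBox g b) (hn : bs.Nodup) :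
    (boxEnds bs).Nodup := by
  have hio : ∀ b, IsBox g b → b.overIn ≠ b.underIn := by
    rintro b ⟨n, h1, h2, -, -⟩ h
    rw [h] at h1
    simpa using h1.unique h2
  have hoo : ∀ b, IsBox g b → b.overOut ≠ b.underOut := by
    rintro b hb h
    obtain ⟨n, h1, h2, h3, h4⟩ := id hb
    rw [h3, h4] at h
    exact hio b hb (arcAfter_inj h1 h2 h)
  -- two crossings that share an incoming end have the same label
  have hin : ∀ b c, IsBox g b → IsBox g c → ∀ e, (e = b.overIn ∨ e = b.underIn) →
      (e = c.overIn ∨ e = c.underIn) → b = c := by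
    rintro ⟨p, a1, a2, a3, a4⟩ ⟨q, c1, c2, c3, c4⟩ ⟨n, h1, h2, h3, h4⟩ ⟨m, h5, h6, h7, h8⟩ e he he'
    simp only at *
    have hnm : n = m ∧ p = q := by
      rcases he with rfl | rfl <;> rcases he' with rfl | rfl
      · simpa using h1.unique h5
      · simpa using h1.unique h6
      · simpa using h2.unique h5
      · simpa using h2.unique h6
    obtain ⟨rfl, rfl⟩ := hnm
    obtain rfl := hg _ _ _ _ h1 h5 rfl rfl
    obtain rfl := hg _ _ _ _ h2 h6 rfl rfl
    rw [h3, h4, h7, h8]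
  have hout : ∀ b c, IsBox g b → IsBox g c → ∀ e, (e = b.overOut ∨ e = b.underOut) →
      (e = c.overOut ∨ e = c.underOut) → b = c := by
    intro b c hb hc e he he'
    obtain ⟨n, h1, h2, h3, h4⟩ := id hb
    obtain ⟨m, h5, h6, h7, h8⟩ := id hc
    rw [h3, h4] at he
    rw [h7, h8] at he'
    rcases he with rfl | rfl <;> rcases he' with he' | he'
    · exact hin b c hb hc _ (.inl rfl) (.inl (arcAfter_inj h1 h5 he'))
    · exact hin b c hb hc _ (.inl rfl) (.inr (arcAfter_inj h1 h6 he'))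
    · exact hin b c hb hc _ (.inr rfl) (.inl (arcAfter_inj h2 h5 he'))
    · exact hin b c hb hc _ (.inr rfl) (.inr (arcAfter_inj h2 h6 he'))
  induction bs with
  | nil => simp [boxEnds]
  | cons b bs ih =>
    obtain ⟨hb1, hb2⟩ := List.forall_mem_cons.1 hb
    obtain ⟨hn1, hn2⟩ := List.nodup_cons.1 hn
    rw [boxEnds, List.nodup_append']
    refine ⟨ih hb2 hn2, ?_, ?_⟩
    · obtain ⟨p, a1, a2, a3, a4⟩ := b
      have h1 := hio _ hb1
      have h2 := hoo _ hb1
      have h3 := h1.symm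
      have h4 := h2.symm
      cases p <;> simp [Box.ends, Box.in₁, Box.in₂, Box.out₁, Box.out₂] at h1 h2 h3 h4 ⊢ <;>
        simp [h1, h2, h3, h4]
    · intro x hx hx'
      obtain ⟨c, hc, hx⟩ := mem_boxEnds.1 hx
      have : b = c := by
        rcases Box.mem_ends.1 hx with ⟨h1, h2⟩ | ⟨h1, h2⟩ <;>
          rcases Box.mem_ends.1 hx' with ⟨h3, h4⟩ | ⟨h3, h4⟩
        · exact hout _ _ hb1 (hb2 c hc) _ h4 h2
        · simp [h1] at h3
        · simp [h1] at h3
        · exact hin _ _ hb1 (hb2 c hc) _ h4 h2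
      exact hn1 (this ▸ hc)

/-- A component without classical crossings does not meet any crossing. -/
theorem not_occurs_of_isFree {g : SignedGaussCode} {bs : List (Box (ℕ × ℕ))}
    (hb : ∀ b ∈ bs, IsBox g b) {e : ℕ × ℕ} (he : IsFree g e) : ¬ Occurs e (boxEnds bs) := by
  have key : ∀ f x, LetterAt g f x → e.1 ≠ f.1 := by
    rintro f x ⟨w, h1, h2⟩ h
    rw [← h, he.1] at h1
    obtain rfl := Option.some.inj h1
    simp at h2
  rintro ⟨x, hx, rfl⟩
  obtain ⟨b, hbm, hx⟩ := mem_boxEnds.1 hx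
  obtain ⟨n, h1, h2, h3, h4⟩ := hb b hbm
  rcases Box.mem_ends.1 hx with ⟨-, h | h⟩ | ⟨-, h | h⟩
  · exact key _ _ h1 (by rw [h, h3]; rfl)
  · exact key _ _ h2 (by rw [h, h4]; rfl)
  · exact key _ _ h1 (by rw [h])
  · exact key _ _ h2 (by rw [h])

/-! ### Counting the closed circles -/

/-- Apply a map of colours to the ends of a crossing. -/
def Box.map (φ : F → E) (b : Box F) : Box E :=
  ⟨b.positive, φ b.overIn, φ b.overOut, φ b.underIn, φ b.underOut⟩

theorem CGen.toBox_map (φ : F → E) (g : CGen F) : (g.map φ).toBox = g.toBox.map (Box.map φ) := by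
  cases g with
  | box r x y e f =>
    obtain ⟨a, x⟩ := x
    obtain ⟨b, y⟩ := y
    cases r <;> cases a <;> cases b <;> rfl
  | _ => rfl

theorem boxes_recolour (φ : F → E) (w : CWord F) :
    boxes (recolour φ w) = (boxes w).map (Box.map φ) := by
  simp only [boxes, recolour, List.filterMap_map, List.map_filterMap]
  refine List.filterMap_congr fun s _ => ?_
  exact CGen.toBox_map φ s.gen

theorem boxes_circles (l : List (Strand E)) : boxes (circles l) = [] := by
  induction l with
  | nil => rfl
  | cons x l ih => exact ih

theorem recolour_circles (φ : F → E) (l : List (Strand F)) :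
    recolour φ (circles l) = circles (l.map (Strand.map φ)) := by
  induction l with
  | nil => rfl
  | cons x l ih => simpa [recolour, CSlice.map, CGen.map] using ih

theorem circles_append (l m : List (Strand E)) : circles (l ++ m) = circles l ++ circles m := by
  simp [circles]

theorem hasColour_circles {l : List (Strand E)} {e : E} :
    HasColour [] (circles l) e ↔ e ∈ l.map Prod.snd := by
  induction l with
  | nil => simp [HasColour]
  | cons x l ih =>
    have h : Tangle [] (circles [x]) [] := tangle_circles _
    have := HasColour.append_iff (v := circles l) (e := e) h
    rw [← circles_append, List.singleton_append] at this
    rw [this, ih]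
    simp [HasColour, dual, eq_comm]

theorem HasColour.of_front {bs : List (Box E)} {e : E} (h : HasColour [] (front bs) e) :
    Occurs e (boxEnds bs) := by
  induction bs with
  | nil => simp [front, HasColour] at h
  | cons b bs ih =>
    rw [front, HasColour.append_iff b.tangle_state] at h
    rw [boxEnds, occurs_append]
    rcases h with h | h
    · right
      revert h
      obtain ⟨p, a1, a2, a3, a4⟩ := b
      cases p <;>
        simp [HasColour, Box.state, Box.gen, Box.ends, Box.in₁, Box.in₂, Box.out₁, Box.out₂,
          dual] <;>
        tauto
    · have := (HasColour.pad_iff (A := []) (L := []) (R := b.ends) (w := front bs) (e := e)).1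
        (by simpa using h)
      rcases this with h | h | h
      · simp at h
      · exact .inr h
      · exact .inl (ih h)

/-- If `P` is the set of the colours of those components of `W` that have no classical crossing,
then the circles of the normal form of `W` have the colours in `P`, each of them once. The second
assumption says that the strands of such a component cannot be marked independently of each other,
and that no other strand can be marked independently of the crossings. -/
theorem circles_colours {W N : CWord E} {bs : List (Box E)} {cs : List (Strand E)} {P : E → Prop}
    (hN : ∀ s ∈ N, s.gen.IsCupless) (h : Eqv [] [] W (front bs ++ N ++ circles cs))
    (hP : ∀ e, P e → HasColour [] W e ∧ ¬ Occurs e (boxEnds bs))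
    (hmark : ∀ W' : CWord (E × Bool), recolour Prod.fst W' = W → Tangle [] W' [] →
      (∀ b ∈ boxes W', b.overIn.2 = false ∧ b.underIn.2 = false) →
      ∀ e, HasColour [] W' (e, true) → P e ∧ ¬ HasColour [] W' (e, false)) :
    (cs.map Prod.snd).Nodup ∧ ∀ e, e ∈ cs.map Prod.snd ↔ P e := by
  obtain ⟨C, t0, t3⟩ := tangle_append.1 h.right
  obtain ⟨D, t1, t2⟩ := tangle_append.1 t0
  obtain rfl := t1.det (tangle_front bs)
  obtain rfl : C = [] := by
    cases cs with
    | nil => exact t3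
    | cons x cs => exact t3.1
  have key : ∀ c₁ x c₂, cs = c₁ ++ x :: c₂ →
      P x.2 ∧ x.2 ∉ c₁.map Prod.snd ∧ x.2 ∉ c₂.map Prod.snd := by
    rintro c₁ x c₂ rfl
    set φ : E → E × Bool := fun e => (e, false) with hφ
    -- only the circle `x` is marked
    set V : CWord (E × Bool) := recolour φ (front bs ++ N) ++
      circles (c₁.map (Strand.map φ) ++ (x.1, (x.2, true)) :: c₂.map (Strand.map φ)) with hV
    have hR : Tangle [] (recolour φ (front bs ++ N)) [] := Tangle.recolour φ t0
    have hVT : Tangle [] V [] := hR.append (tangle_circles _)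
    have hVW : recolour Prod.fst V = front bs ++ N ++ circles (c₁ ++ x :: c₂) := by
      have : (Strand.map Prod.fst ∘ Strand.map φ : Strand E → Strand E) = id := rfl
      have this' : ∀ y : Strand E, Strand.map Prod.fst (Strand.map φ y) = y := fun y => rfl
      rw [hV, recolour_append, recolour_circles]
      congr 1
      · simp only [recolour, List.map_map]
        refine (List.map_congr_left fun s _ => ?_).trans (List.map_id _)
        obtain ⟨l, g, r⟩ := s
        cases g <;> simp [CSlice.map, CGen.map, this, this']
        exact ⟨rfl, rfl⟩
      · simp only [List.map_append, List.map_cons, List.map_map, this, List.map_id]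
        rfl
    obtain ⟨W', h1, h2⟩ := h.symm.lift hVW hVT
    have h3 : ∀ b ∈ boxes W', b.overIn.2 = false ∧ b.underIn.2 = false := by
      intro b hb
      rw [← h2.boxes_perm.mem_iff, hV, boxes_append, boxes_circles, List.append_nil,
        boxes_recolour] at hb
      obtain ⟨b, -, rfl⟩ := List.mem_map.1 hb
      exact ⟨rfl, rfl⟩
    have hcirc : ∀ f, HasColour [] (circles (c₁.map (Strand.map φ) ++
        (x.1, (x.2, true)) :: c₂.map (Strand.map φ))) f → HasColour [] W' f := by
      intro f hf
      rw [← h2.hasColour_iff, hV, HasColour.append_iff hR]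
      exact .inr hf
    obtain ⟨h4, h5⟩ := hmark W' h1 h2.right h3 x.2 (hcirc _ (by simp [hasColour_circles]))
    refine ⟨h4, fun hx => h5 (hcirc _ ?_), fun hx => h5 (hcirc _ ?_)⟩
    · rw [hasColour_circles]
      obtain ⟨y, hy, hyx⟩ := List.mem_map.1 hx
      simp only [List.map_append, List.map_map, List.mem_append, List.mem_map]
      exact .inl ⟨y, hy, by simp [Strand.map, hφ, hyx]⟩
    · rw [hasColour_circles]
      obtain ⟨y, hy, hyx⟩ := List.mem_map.1 hx
      simp only [List.map_append, List.map_cons, List.map_map, List.mem_append, List.mem_cons,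
        List.mem_map]
      exact .inr (.inr ⟨y, hy, by simp [Strand.map, hφ, hyx]⟩)
  constructor
  · rw [List.Nodup, List.pairwise_map, List.pairwise_iff_getElem]
    intro i j hi hj hij he
    have e1 : cs = cs.take i ++ cs[i] :: cs.drop (i + 1) := by simp
    refine (key _ _ _ e1).2.2 (List.mem_map.2 ⟨cs[j], ?_, he.symm⟩)
    rw [List.mem_iff_getElem?]
    refine ⟨j - (i + 1), ?_⟩
    rw [List.getElem?_drop, show i + 1 + (j - (i + 1)) = j by omega, List.getElem?_eq_getElem hj]
  · intro e
    constructor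
    · intro he
      obtain ⟨x, hx, rfl⟩ := List.mem_map.1 he
      obtain ⟨c₁, c₂, rfl⟩ := List.append_of_mem hx
      exact (key _ _ _ rfl).1
    · intro he
      obtain ⟨h1, h2⟩ := hP e he
      rw [h.hasColour_iff, HasColour.append_iff t0, HasColour.append_iff t1,
        hasColour_circles] at h1
      rcases h1 with (h1 | h1) | h1
      · exact absurd h1.of_front h2
      · exact absurd (h1.of_cupless hN t2) h2
      · exact h1

/-- The direction of a closed circle can be reversed. -/
theorem circle_flip (x : Strand E) : Eqv [] [] (circles [x]) (circles [dual x]) := by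
  have e1 : Eqv [x, dual x] [] [⟨[], .virt x (dual x), []⟩, ⟨[], .cap (dual x), []⟩]
      [⟨[], .cap x, []⟩] := .of_move (.curlCap x) (by simp) (by simp)
  have e2 : Eqv [] [dual x, x] [⟨[], .cup x, []⟩, ⟨[], .virt x (dual x), []⟩]
      [⟨[], .cup (dual x), []⟩] := .of_move (.curlCup x) (by simp) (by simp)
  have f1 := e1.append_left (u := [⟨[], .cup x, []⟩]) (A := []) (by simp)
  have f2 := e2.append_right (v := [⟨[], .cap (dual x), []⟩]) (C := []) (by simp)
  simpa using f1.symm.trans f2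

theorem circles_flip (l : List (Strand E)) :
    Eqv [] [] (circles l) (circles (l.map fun x => (true, x.2))) := by
  induction l with
  | nil => exact .refl (by simp)
  | cons x l ih =>
    have h : Eqv [] [] (circles [x]) (circles [(true, x.2)]) := by
      obtain ⟨a, e⟩ := x
      cases a
      · exact circle_flip _
      · exact .refl (tangle_circles _)
    simpa using (h.append_right (tangle_circles l)).trans (ih.append_left (tangle_circles _))

/-! ### From coloured diagrams to virtual diagrams -/

theorem CMove.forget {m m' : CWord E} (h : CMove m m') :
    LocalMove (VirtualKnot.forget m) (VirtualKnot.forget m') := by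
  cases h with
  | exchange g h M =>
    simpa [VirtualKnot.forget, CSlice.forget, CGen.forget_dom, CGen.forget_cod] using
      LocalMove.exchange g.forget h.forget (M.map Prod.fst)
  | zigzagRight x => exact .zigzagRight x.1
  | zigzagLeft x => exact .zigzagLeft x.1
  | slideCap x y => exact .slideCap .virtual x.1 y.1
  | slideCup x y => exact .slideCup .virtual x.1 y.1
  | rotate r x y e f => exact .slideCap (.classical r) x.1 y.1
  | curlCap x => exact .curlCap .virtual x.1
  | curlCup x => exact .curlCup .virtual x.1
  | bigon x y => exact .bigon .virtual x.1 y.1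
  | triangle x y z => exact .triangle .virtual .virtual .virtual x.1 y.1 z.1 trivial
  | triangleBox x r y z e f => exact .triangle .virtual .virtual (.classical r) x.1 y.1 z.1 trivial

theorem forget_pad (L R : List (Strand E)) (w : CWord E) :
    forget (pad L R w) = (forget w).map (Slice.pad (L.map Prod.fst) (R.map Prod.fst)) := by
  simp [forget, pad, CSlice.forget, CSlice.pad, Slice.pad]

theorem forget_append (u v : CWord E) : forget (u ++ v) = forget u ++ forget v := by
  simp [forget]

theorem forget_circles (l : List (Strand E)) : forget (circles l) =
    (l.map Prod.fst).flatMap fun a => [⟨[], .cup a, []⟩, ⟨[], .cap a, []⟩] := by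
  induction l with
  | nil => rfl
  | cons x l ih => simpa [forget, CSlice.forget, CGen.forget] using ih

theorem PlaneDiagram.eq_of_word {T : Type} {K K' : PlaneDiagram T} (h : K.word = K'.word) :
    K = K' := by
  cases K
  cases K'
  cases h
  rfl

/-- Moves of coloured diagrams are moves of virtual diagrams. -/
theorem Eqv.equivalent {w w' : CWord E} (h : Eqv [] [] w w') {K K' : VirtualDiagram}
    (hK : K.word = forget w) (hK' : K'.word = forget w') : K.Equivalent K' := by
  obtain ⟨h1, -, h⟩ := h
  suffices H : (Tangle [] w [] ↔ Tangle [] w' []) ∧ (Tangle [] w [] → ∀ K K' : VirtualDiagram,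
      K.word = forget w → K'.word = forget w' → K.Equivalent K') from H.2 h1 K K' hK hK'
  clear h1 hK hK' K K'
  induction h with
  | rel _ _ h =>
    obtain ⟨h1, h2, u, v, m, m', L, R, hm, rfl, rfl⟩ := h
    refine ⟨⟨fun _ => h2, fun _ => h1⟩, fun _ K K' hK hK' => .rel _ _ ?_⟩
    exact ⟨forget u, forget v, forget m, forget m', _, _, hm.forget,
      by rw [hK, forget_append, forget_append, forget_pad],
      by rw [hK', forget_append, forget_append, forget_pad]⟩
  | refl _ =>
    refine ⟨.rfl, fun _ K K' hK hK' => ?_⟩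
    obtain rfl := PlaneDiagram.eq_of_word (hK.trans hK'.symm)
    exact .refl _
  | symm _ _ _ ih => exact ⟨ih.1.symm, fun h K K' hK hK' => (ih.2 (ih.1.2 h) K' K hK' hK).symm⟩
  | trans _ y _ _ _ ih ih' =>
    refine ⟨ih.1.trans ih'.1, fun h K K' hK hK' => ?_⟩
    have hy := ih.1.1 h
    exact .trans _ ⟨forget y, hy.forget⟩ _ (ih.2 h _ _ hK rfl) (ih'.2 hy _ _ rfl hK')

/-- A signed Gauss code determines a virtual diagram up to equivalence. -/
theorem VirtualDiagram.HasSignedCode.equivalent {K₁ K₂ : VirtualDiagram} {g : SignedGaussCode}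
    (h₁ : K₁.HasSignedCode g) (h₂ : K₂.HasSignedCode g) : K₁.Equivalent K₂ := by
  obtain ⟨name₁, ls₁, col₁, W₁, hg₁, a₁⟩ := exists_isArcDiagram h₁
  obtain ⟨name₂, ls₂, col₂, W₂, hg₂, a₂⟩ := exists_isArcDiagram h₂
  have hbox : ∀ b ∈ boxes W₁, IsBox g b := fun b hb => hg₁ ▸ a₁.mem_boxes.1 hb
  have hp : (boxes W₁).Perm (boxes W₂) :=
    (List.perm_ext_iff_of_nodup a₁.nodup_boxes a₂.nodup_boxes).2 fun b => by
      rw [a₁.mem_boxes, a₂.mem_boxes, ← hg₁, ← hg₂]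
  have hd : (boxEnds (boxes W₁)).Nodup :=
    IsBox.nodup_boxEnds (hg₁ ▸ a₁.lettersDistinct) hbox a₁.nodup_boxes
  obtain ⟨N, c₁, c₂, hN, e₁, e₂⟩ := eqv_of_boxes a₁.tangle a₂.tangle hp hd
  have f₁ := circles_colours (P := IsFree g) hN e₁
    (fun e he => ⟨a₁.hasColour_of_isFree (hg₁ ▸ he), not_occurs_of_isFree hbox he⟩)
    (fun W' w1 w2 w3 e he => by
      rw [hg₁]
      exact a₁.isFree_of_marked w1 w2 w3 he)
  have f₂ := circles_colours (P := IsFree g) hN e₂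
    (fun e he => ⟨a₂.hasColour_of_isFree (hg₂ ▸ he), not_occurs_of_isFree hbox he⟩)
    (fun W' w1 w2 w3 e he => by
      rw [hg₂]
      exact a₂.isFree_of_marked w1 w2 w3 he)
  have hlen : c₁.length = c₂.length := by
    have := ((List.perm_ext_iff_of_nodup f₁.1 f₂.1).2 fun e => by rw [f₁.2, f₂.2]).length_eq
    simpa using this
  have hcs : ∀ (W : CWord (ℕ × ℕ)) c, Eqv [] [] W (front (boxes W₁) ++ N ++ circles c) →
      Eqv [] [] W (front (boxes W₁) ++ N ++ circles (c.map fun x => (true, x.2))) := by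
    intro W c e
    obtain ⟨C, t1, t2⟩ := tangle_append.1 e.right
    obtain rfl : C = [] := by
      cases c with
      | nil => exact t2
      | cons x c => exact t2.1
    exact e.trans ((circles_flip c).append_left t1)
  have g₁ := hcs _ _ e₁
  have g₂ := hcs _ _ e₂
  have hw : forget (front (boxes W₁) ++ N ++ circles (c₁.map fun x => (true, x.2))) =
      forget (front (boxes W₁) ++ N ++ circles (c₂.map fun x => (true, x.2))) := by
    rw [forget_append _ (circles _), forget_append _ (circles _), forget_circles, forget_circles]
    simp [Function.comp_def, hlen]
  exact .trans _ ⟨_, g₁.right.forget⟩ _ (g₁.equivalent a₁.forget_eq.symm rfl)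
    (g₂.symm.equivalent hw a₂.forget_eq.symm)

/-! ### Crossings for a planar shadow -/

/-- Turn the double point of a slice, if any, into a classical crossing; `r` tells whether its
rising strand is the overcrossing one. -/
def Slice.decorate (r : Bool) (s : Slice Unit) : Slice Crossing :=
  ⟨s.left, match s.gen with
    | .cup a => .cup a
    | .cap a => .cap a
    | .cross _ a b => .cross (.classical r) a b, s.right⟩

theorem Slice.decorate_dom (r : Bool) (s : Slice Unit) : (s.decorate r).dom = s.dom := by
  obtain ⟨_, g, _⟩ := s
  cases g <;> rfl

theorem Slice.decorate_cod (r : Bool) (s : Slice Unit) : (s.decorate r).cod = s.cod := by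
  obtain ⟨_, g, _⟩ := s
  cases g <;> rfl

theorem Slice.decorate_through (r : Bool) (s : Slice Unit) (side : Bool) (j : ℕ) :
    (s.decorate r).through side j = s.through side j := by
  obtain ⟨_, g, _⟩ := s
  cases g <;> rfl

theorem Slice.decorate_crossed (r : Bool) (s : Slice Unit) (side : Bool) (j : ℕ) :
    (s.decorate r).crossed side j =
      (s.crossed side j).map fun x => (.classical r, x.2) := by
  obtain ⟨l, g, _⟩ := s
  cases g with
  | cup => rfl
  | cap => rfl
  | cross _ a b =>
    by_cases hj : l.length ≤ j ∧ j < l.length + 2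
    · simp [Slice.crossed, Slice.decorate, hj]
      rfl
    · simp [Slice.crossed, Slice.decorate, hj]

theorem isTangle_decorate {w : List (Slice Unit)} {A B : List Bool} (h : IsTangle A w B)
    (r : ℕ → Bool) : IsTangle A (w.mapIdx fun i s => s.decorate (r i)) B := by
  induction w generalizing A r with
  | nil => exact h
  | cons s w ih =>
    rw [List.mapIdx_cons]
    exact ⟨by rw [Slice.decorate_dom]; exact h.1,
      by rw [Slice.decorate_cod]; exact ih h.2 fun i => r (i + 1)⟩

/-- Turn the double points of a shadow into classical crossings; `r i` tells whether the rising
strand in slice `i` is the overcrossing one. -/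
def Shadow.decorate (S : Shadow) (r : ℕ → Bool) : VirtualDiagram :=
  ⟨S.word.mapIdx fun i s => s.decorate (r i), isTangle_decorate S.closed r⟩

section Decorate

variable (S : Shadow) (r : ℕ → Bool)

theorem Shadow.getElem?_decorate (i : ℕ) :
    (S.decorate r).word[i]? = S.word[i]?.map (Slice.decorate (r i)) := by
  simp [Shadow.decorate]

theorem Shadow.decorate_level (i : ℕ) : (S.decorate r).level i = S.level i := by
  cases i with
  | zero => rfl
  | succ i =>
    simp only [PlaneDiagram.level, Shadow.getElem?_decorate]
    cases S.word[i]? <;> simp [Slice.decorate_cod]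

theorem Shadow.decorate_dir (p : ℕ × ℕ) : (S.decorate r).dir p = S.dir p := by
  simp [PlaneDiagram.dir, Shadow.decorate_level]

theorem Shadow.decorate_sliceAfter (p : ℕ × ℕ) :
    (S.decorate r).sliceAfter p = S.sliceAfter p := by
  simp [PlaneDiagram.sliceAfter, Shadow.decorate_dir]

theorem Shadow.decorate_next (p : ℕ × ℕ) : (S.decorate r).next p = S.next p := by
  simp only [PlaneDiagram.next, Shadow.decorate_dir, Shadow.decorate_sliceAfter,
    Shadow.getElem?_decorate]
  cases S.word[S.sliceAfter p]? <;> simp [Slice.decorate_through]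

theorem Shadow.decorate_passage (p : ℕ × ℕ) : (S.decorate r).passage p =
    (S.passage p).map fun x => (x.1, .classical (r x.1), x.2.2) := by
  simp only [PlaneDiagram.passage, Shadow.decorate_dir, Shadow.decorate_sliceAfter,
    Shadow.getElem?_decorate]
  cases S.word[S.sliceAfter p]? with
  | none => rfl
  | some s =>
    simp only [Option.map_some, Option.bind_some, Slice.decorate_crossed]
    cases s.crossed (!S.dir p) p.2 <;> rfl

theorem Shadow.decorate_isClassical : (S.decorate r).IsClassical := by
  intro s hs a b
  obtain ⟨i, hi⟩ := List.mem_iff_getElem?.1 hs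
  rw [Shadow.getElem?_decorate, Option.map_eq_some_iff] at hi
  obtain ⟨⟨_, g, _⟩, -, rfl⟩ := hi
  cases g <;> simp [Slice.decorate]

theorem Shadow.decorate_isTraversal {ls : List (List (ℕ × ℕ))} (h : S.IsTraversal ls) :
    (S.decorate r).IsTraversal ls := by
  have hn : (S.decorate r).next = S.next := funext (S.decorate_next r)
  simp only [PlaneDiagram.IsTraversal, PlaneDiagram.IsTour, PlaneDiagram.IsPoint, hn,
    S.decorate_level r]
  exact h

end Decorate

/-- Codes that are related letter by letter have letters at the same places. -/
theorem exists_letterAt_of_forall₂ {α β : Type} {R : α → β → Prop} {g : List (List α)}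
    {h : List (List β)} (H : List.Forall₂ (List.Forall₂ R) g h) {e : ℕ × ℕ} {z : β}
    (hz : LetterAt h e z) : ∃ x, LetterAt g e x ∧ R x z := by
  obtain ⟨w, h1, h2⟩ := hz
  obtain ⟨hl, hg⟩ := List.forall₂_iff_get.1 H
  obtain ⟨hi, rfl⟩ := List.getElem?_eq_some_iff.1 h1
  have h3 := hg e.1 (hl ▸ hi) hi
  obtain ⟨hl', hg'⟩ := List.forall₂_iff_get.1 h3
  obtain ⟨hj, rfl⟩ := List.getElem?_eq_some_iff.1 h2
  have hj' : e.2 < g[e.1].length := by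
    have : g[e.1].length = h[e.1].length := hl'
    omega
  exact ⟨g[e.1][e.2], ⟨_, List.getElem?_eq_getElem _, List.getElem?_eq_getElem hj'⟩,
    hg' e.2 hj' hj⟩

/-- It suffices to compare codes of the same shape letter by letter. -/
theorem eq_map_of_forall₂ {α β : Type} {R : α → β → Prop} {g : List (List α)}
    {h : List (List β)} (H : List.Forall₂ (List.Forall₂ R) g h) {f : β → α}
    (hf : ∀ e x z, LetterAt g e x → LetterAt h e z → R x z → x = f z) :
    g = h.map fun l => l.map f := by
  obtain ⟨hl, hg⟩ := List.forall₂_iff_get.1 H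
  refine List.ext_getElem (by simpa using hl) fun c h1 h2 => ?_
  have h2' : c < h.length := by simpa using h2
  obtain ⟨hl', hg'⟩ := List.forall₂_iff_get.1 (hg c h1 h2')
  rw [List.getElem_map]
  refine List.ext_getElem (by simpa using hl') fun k h3 h4 => ?_
  have h4' : k < h[c].length := by simpa using h4
  rw [List.getElem_map]
  exact hf (c, k) _ _ ⟨_, List.getElem?_eq_getElem h1, List.getElem?_eq_getElem h3⟩
    ⟨_, List.getElem?_eq_getElem h2', List.getElem?_eq_getElem h4'⟩ (hg' k h3 h4')

/-- If the signs of `g` are standard and every crossing occurs once as an over- and once as an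
undercrossing, then `g` is the signed Gauss code of a classical diagram. -/
theorem SignedGaussCode.IsStandard.exists_classical {g : SignedGaussCode} (h : g.IsStandard)
    (hg : LettersDistinct g) :
    ∃ D : VirtualDiagram, D.IsClassical ∧ D.HasSignedCode g := by
  obtain ⟨S, _, ⟨ls, ht, name, hn, rfl⟩, hf⟩ := h
  set q : List (List (ℕ × Unit × Bool × Bool × Bool)) :=
    ls.map fun l => l.filterMap S.passage with hq
  set loc : ℕ × Unit × Bool × Bool × Bool → LocalLetter := fun x =>
    ⟨name x.1, turnsCounter x.2.2.1 x.2.2.2.1 x.2.2.2.2⟩ with hloc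
  have hF : List.Forall₂ (List.Forall₂ fun x z => SignedLetter.Fits x (loc z)) g q := by
    have : (ls.map fun l => l.filterMap fun p => (S.passage p).map loc) =
        q.map fun l => l.map loc := by
      simp [hq, Function.comp_def, List.map_filterMap]
    rw [this, List.forall₂_map_right_iff] at hf
    exact hf.imp fun _ _ h => List.forall₂_map_right_iff.1 h
  obtain ⟨col, hcol⟩ := exists_isArcColouring S.passage ht.2.1
  -- the two letters of a crossing differ in `isOver`, so that one choice of `r` fits both of them
  have hpass : ∀ i, ∃ r, ∀ e x a b rising, LetterAt g e x →
      LetterAt q e (i, (), a, b, rising) → x.isOver = (rising == r) := by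
    intro i
    by_cases hi : ∃ s a b, S.word[i]? = some s ∧ s.gen = .cross () a b
    · obtain ⟨s, a, b, hs, hsg⟩ := hi
      have hlet : ∀ rising, ∃ e x, LetterAt g e x ∧ LetterAt q e (i, (), a, b, rising) ∧
          x.label = name i := by
        intro rising
        obtain ⟨p, hp, hpp⟩ := S.exists_passage hs hsg rising
        have h1 := hcol.letterAt ((ht.2.2 p).2 hp) hpp
        obtain ⟨x, h2, h3⟩ := exists_letterAt_of_forall₂ hF h1
        exact ⟨_, x, h2, h1, h3.1⟩
      obtain ⟨e₁, x₁, h1, h1', h1''⟩ := hlet true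
      obtain ⟨e₀, x₀, h0, h0', h0''⟩ := hlet false
      have hne : ∀ e x e' x' a b a' b' rising, LetterAt g e x → LetterAt g e' x' →
          LetterAt q e (i, (), a, b, rising) → LetterAt q e' (i, (), a', b', !rising) →
          x.label = x'.label → x.isOver = !x'.isOver := by
        intro e x e' x' a b a' b' rising hx hx' hz hz' hl
        by_contra hcon
        obtain rfl := hg e e' x x' hx hx' hl (by simpa using hcon)
        simpa using hz.unique hz'
      refine ⟨x₁.isOver, fun e x a' b' rising hx hz => ?_⟩
      have hxl : x.label = name i := by
        obtain ⟨y, hy, hy'⟩ := exists_letterAt_of_forall₂ hF hz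
        rw [hx.unique hy]
        exact hy'.1
      have h10 := hne _ _ _ _ _ _ _ _ true h1 h0 h1' h0' (h1''.trans h0''.symm)
      cases rising
      · have := hne _ _ _ _ _ _ _ _ false hx h1 hz h1' (hxl.trans h1''.symm)
        rw [this]
        cases x₁.isOver <;> rfl
      · have := hne _ _ _ _ _ _ _ _ true hx h0 hz h0' (hxl.trans h0''.symm)
        rw [this, h10]
        cases x₀.isOver <;> rfl
    · refine ⟨true, fun e x a b rising _ hz => absurd ?_ hi⟩
      obtain ⟨p, hp, hpp, -⟩ := hcol.exists_of_letterAt hz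
      simp only [PlaneDiagram.passage, Option.bind_eq_some_iff, Option.map_eq_some_iff,
        Prod.mk.injEq] at hpp
      obtain ⟨s, hs, y, hy, hi', rfl⟩ := hpp
      rw [hi'] at hs
      obtain ⟨l, gen, r⟩ := s
      cases gen with
      | cross t a' b' => exact ⟨_, a', b', hs, rfl⟩
      | cup => simp [Slice.crossed] at hy
      | cap => simp [Slice.crossed] at hy
  choose r hr using hpass
  refine ⟨S.decorate r, S.decorate_isClassical r, ls, S.decorate_isTraversal r ht, name, hn, ?_⟩
  have : (ls.map fun l => l.filterMap fun p =>
      ((S.decorate r).passage p).bind (signedLetter name)) =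
      q.map fun l => l.map fun x =>
        ⟨name x.1, x.2.2.2.2 == r x.1, turnsCounter x.2.2.1 x.2.2.2.1 (r x.1)⟩ := by
    simp only [hq, List.map_map, Function.comp_def, List.map_filterMap]
    refine List.map_congr_left fun l _ => List.filterMap_congr fun p _ => ?_
    rw [Shadow.decorate_passage]
    cases S.passage p <;> rfl
  rw [this]
  refine eq_map_of_forall₂ hF ?_
  rintro e x ⟨i, _, a, b, rising⟩ hx hz ⟨h1, h2⟩
  have h3 := hr i e x a b rising hx hz
  obtain ⟨lab, o, pos⟩ := x
  simp only [hloc] at h1 h2 h3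
  rw [SignedLetter.mk.injEq]
  refine ⟨h1, h3, ?_⟩
  rw [h2, h3]
  cases rising <;> cases r i <;> cases a <;> cases b <;> rfl

end VirtualKnot

theorem theorem2 (K : VirtualKnot.VirtualDiagram) (g : VirtualKnot.SignedGaussCode)
    (hK : K.HasSignedCode g)
    (hplanar : g.underlying.IsPlanar)
    (hstandard : g.IsStandard) :
    ∃ D : VirtualKnot.VirtualDiagram, D.IsClassical ∧ K.Equivalent D := by
  obtain ⟨name, ls, col, W, rfl, a⟩ := VirtualKnot.exists_isArcDiagram hK
  obtain ⟨D, h1, h2⟩ := hstandard.exists_classical a.lettersDistinct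
  exact ⟨D, h1, hK.equivalent h2⟩
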